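/- Let $M\subseteq B(H)$ be a von Neumann algebra with a faithful normal tracial state $\tau$ (for instance $H=L^2(M,\tau)$). Realise $L^1(M,\tau)_+$ as the positive self-adjoint operators $x$ on $H$ affiliated with $M$ with $\tau(x)<\infty$, where $\tau(x)=\sup_{t>0}\tau(x1_{[0,t]}(x))$, and let $S=\{x\in L^1(M,\tau)_+:\tau(x)=1\}$. For affiliated self-adjoint $x,y$ write $x\le y$ if $y-x$ is positive semidefinite on $\operatorname{dom}(x)\cap\operatorname{dom}(y)$, and for $x,y\in S$ put $$m(x,y)=\max\{\lambda\in\mathbb R:\lambda y\le x\},\qquad d(x,y)=\frac{1-m(x,y)m(y,x)}{1+m(x,y)m(y,x)}.$$ A densely defined operator $x$ is boundedly invertible if there is $b\in B(H)$ with $xb=1$ and $bx\subseteq 1$. Let $S^\times$ be the set of boundedly invertible elements of $S$, let $S^\circ=S\setminus S^\times$, and let $S_b^\times=S^\times\cap M$, $S_u^\times=S^\times\setminus M$, $S_b^\circ=S^\circ\cap M$, $S_u^\circ=S^\circ\setminus M$. Then: 1. If $x,y\in S$ satisfy $d(x,y)<1$, then $x$ is bounded if and only if $y$ is bounded, and $x$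 is boundedly invertible if and only if $y$ is boundedly invertible. In particular, $S$ is the disjoint union of the four sets $S_b^\times,S_u^\times,S_b^\circ,S_u^\circ$, each of which is clopen for the metric $d$ on $S$, and $d(x,y)=1$ whenever $x$ and $y$ lie in different ones of them. 2. For all $x,y\in S_b^\times$ one has $d(x,y)<1$. 3. If $M\neq\mathbb C$, then $S_b^\times$ and $S_b^\circ$ have $d$-diameter $1$, and the diameter of $S_b^\circ$ is attained. 4. If $M$ is infinite dimensional, then $S_u^\times$ and $S_u^\circ$ have $d$-diameter $1$, and both diameters are attained. 5. If $M$ is infinite dimensional, then $S_b^\times$ is not totally bounded for $d$. -/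

import Mathlib

/-!
Tracial von Neumann algebras, the normal state space realised by unbounded affiliated operators,
and the Hennion metric on it.
-/

noncomputable section

namespace HennionGeometry

variable {H : Type*} [NormedAddCommGroup H] [InnerProductSpace ℂ H] [CompleteSpace H]

/-- `τ` is a faithful normal tracial state on the von Neumann algebra `M`. Normality is
preservation of suprema of bounded increasing nets of positive elements. -/
structure IsFaithfulNormalTracialState (M : VonNeumannAlgebra H)
    (τ : M.toStarSubalgebra →ₗ[ℂ] ℂ) : Prop where
  map_one : τ 1 = 1
  nonneg : ∀ a : M.toStarSubalgebra, 0 ≤ (τ (star a * a)).re ∧ (τ (star a * a)).im = 0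
  faithful : ∀ a : M.toStarSubalgebra, τ (star a * a) = 0 → a = 0
  tracial : ∀ a b : M.toStarSubalgebra, τ (a * b) = τ (b * a)
  normal : ∀ (D : Set M.toStarSubalgebra) (s : M.toStarSubalgebra), D.Nonempty →
    (∀ a ∈ D, (0 : H →L[ℂ] H) ≤ a) → DirectedOn (· ≤ ·) D →
    IsLUB D s → IsLUB ((fun a => (τ a).re) '' D) (τ s).re

/-- A bounded operator, viewed as an everywhere defined unbounded operator. -/
def ofBounded (a : H →L[ℂ] H) : H →ₗ.[ℂ] H :=
  (a : H →ₗ[ℂ] H).toPMap ⊤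

/-- `x ≤ y` : the operator `y - x` is positive semidefinite on `dom x ∩ dom y`. -/
def OpLE (x y : H →ₗ.[ℂ] H) : Prop :=
  ∀ ξ : (y - x).domain, 0 ≤ (inner ℂ ((y - x) ξ) (ξ : H)).re

/-- Affiliation with `M` (for closed densely defined `x`): `x` commutes with the commutant of
`M`, that is `a' x ⊆ x a'` for all `a' ∈ M'`. -/
def IsAffiliated (M : VonNeumannAlgebra H) (x : H →ₗ.[ℂ] H) : Prop :=
  ∀ a' ∈ M.commutant, ∀ ξ : x.domain, ∃ h : a' (ξ : H) ∈ x.domain, x ⟨a' (ξ : H), h⟩ = a' (x ξ)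

/-- The positive self-adjoint operators affiliated with `M` (self-adjoint operators are
densely defined and closed). -/
def posAffiliated (M : VonNeumannAlgebra H) : Set (H →ₗ.[ℂ] H) :=
  {x | IsSelfAdjoint x ∧ IsAffiliated M x ∧ OpLE 0 x}

/-- The trace of a positive affiliated operator, with values in `[0, ∞]`. By the spectral theorem
and normality of `τ` it equals `sup_t τ (x 1_{[0,t]}(x))`: the operators `x 1_{[0,t]}(x)` are
among the `a` below, and `a ≤ x` gives `τ (e a e) ≤ τ (x e)` for `e = 1_{[0,t]}(x)`. -/
def trace (M : VonNeumannAlgebra H) (τ : M.toStarSubalgebra →ₗ[ℂ] ℂ) (x : H →ₗ.[ℂ] H) :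
    ENNReal :=
  ⨆ (a : M.toStarSubalgebra) (_ : (0 : H →L[ℂ] H) ≤ a) (_ : OpLE (ofBounded (a : H →L[ℂ] H)) x),
    ENNReal.ofReal (τ a).re

/-- The positive part of `L¹(M, τ)`. -/
def L1Pos (M : VonNeumannAlgebra H) (τ : M.toStarSubalgebra →ₗ[ℂ] ℂ) : Set (H →ₗ.[ℂ] H) :=
  {x | x ∈ posAffiliated M ∧ trace M τ x < ⊤}

/-- The normal state space `S`. -/
def S (M : VonNeumannAlgebra H) (τ : M.toStarSubalgebra →ₗ[ℂ] ℂ) : Set (H →ₗ.[ℂ] H) :=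
  {x | x ∈ L1Pos M τ ∧ trace M τ x = 1}

/-- The quantity `m(x, y) = max {t : ℝ | t y ≤ x}`. -/
def m (x y : H →ₗ.[ℂ] H) : ℝ :=
  sSup {t : ℝ | OpLE ((t : ℂ) • y) x}

/-- The Hennion metric. -/
def d (x y : H →ₗ.[ℂ] H) : ℝ :=
  (1 - m x y * m y x) / (1 + m x y * m y x)

/-- The operator `x` is bounded on its domain. -/
def IsBoundedOp (x : H →ₗ.[ℂ] H) : Prop :=
  ∃ C : ℝ, ∀ ξ : x.domain, ‖x ξ‖ ≤ C * ‖(ξ : H)‖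

/-- There is a bounded everywhere defined `b` with `x b = 1` and `b x ⊆ 1`. -/
def IsBoundedlyInvertible (x : H →ₗ.[ℂ] H) : Prop :=
  ∃ b : H →L[ℂ] H, (∀ ξ : H, ∃ h : b ξ ∈ x.domain, x ⟨b ξ, h⟩ = ξ) ∧
    ∀ ξ : x.domain, b (x ξ) = ξ

/-- The elements of `M`, viewed as unbounded operators. -/
def algebraSet (M : VonNeumannAlgebra H) : Set (H →ₗ.[ℂ] H) :=
  ofBounded '' (M : Set (H →L[ℂ] H))

section Pieces

variable (M : VonNeumannAlgebra H) (τ : M.toStarSubalgebra →ₗ[ℂ] ℂ)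

/-- `S^×` -/
def Sinv : Set (H →ₗ.[ℂ] H) := {x | x ∈ S M τ ∧ IsBoundedlyInvertible x}

/-- `S^∘` -/
def Ssing : Set (H →ₗ.[ℂ] H) := S M τ \ Sinv M τ

/-- `S_b^×` -/
def SbInv : Set (H →ₗ.[ℂ] H) := Sinv M τ ∩ algebraSet M

/-- `S_u^×` -/
def SuInv : Set (H →ₗ.[ℂ] H) := Sinv M τ \ algebraSet M

/-- `S_b^∘` -/
def SbSing : Set (H →ₗ.[ℂ] H) := Ssing M τ ∩ algebraSet M

/-- `S_u^∘` -/
def SuSing : Set (H →ₗ.[ℂ] H) := Ssing M τ \ algebraSet M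

/-- The list `S_b^×, S_u^×, S_b^∘, S_u^∘`. -/
def piece : Fin 4 → Set (H →ₗ.[ℂ] H) :=
  ![SbInv M τ, SuInv M τ, SbSing M τ, SuSing M τ]

/-- The topology of the metric `d` on `S`: a set is open when it contains an open `d`-ball of
positive radius around each of its points. -/
abbrev hennionTopology : TopologicalSpace (S M τ) where
  IsOpen U := ∀ x ∈ U, ∃ ε : ℝ, 0 < ε ∧ ∀ y : S M τ, d (x : H →ₗ.[ℂ] H) y < ε → y ∈ U
  isOpen_univ := fun _ _ => ⟨1, one_pos, fun _ _ => trivial⟩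
  isOpen_inter := by
    rintro U V hU hV x ⟨hxU, hxV⟩
    obtain ⟨ε, hε, h⟩ := hU x hxU
    obtain ⟨δ, hδ, h'⟩ := hV x hxV
    exact ⟨min ε δ, lt_min hε hδ, fun y hy =>
      ⟨h y (hy.trans_le (min_le_left _ _)), h' y (hy.trans_le (min_le_right _ _))⟩⟩
  isOpen_sUnion := by
    rintro 𝒰 h𝒰 x ⟨U, hU, hx⟩
    obtain ⟨ε, hε, h⟩ := h𝒰 U hU x hx
    exact ⟨ε, hε, fun y hy => ⟨U, hU, h y hy⟩⟩

/-- `A ⊆ S` is totally bounded for `d`: for each `ε > 0` it is covered by finitely many open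
`d`-balls of radius `ε` with centres in `S`. -/
def DTotallyBounded (A : Set (H →ₗ.[ℂ] H)) : Prop :=
  ∀ ε : ℝ, 0 < ε → ∃ t : Set (H →ₗ.[ℂ] H), t.Finite ∧ t ⊆ S M τ ∧
    ∀ x ∈ A, ∃ c ∈ t, d x c < ε

end Pieces

/-- The set of `d`-distances between points of `A`; its least upper bound is the diameter of
`A`, which is attained exactly when it is a greatest element. -/
def distances (A : Set (H →ₗ.[ℂ] H)) : Set ℝ :=
  {r | ∃ x ∈ A, ∃ y ∈ A, r = d x y}

end HennionGeometry

end

noncomputable section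

namespace HennionGeometry

open Filter Topology

set_option linter.unusedSectionVars false

variable {H : Type*} [NormedAddCommGroup H] [InnerProductSpace ℂ H] [CompleteSpace H]

/-! If `d x y < 1`, then m(x,y) and m(y,x) are both positive, so t y ≤ x and s x ≤ y for some t, s >
0. The proof studies what such a domination transports, and bounds m by ratios of quadratic forms at
common vectors.

Boundedness is transported because a bounded self-adjoint x is everywhere defined
(`isBoundedOp_of_opLE`). Invertibility is the delicate point (`isBoundedlyInvertible_of_opLE`): the
inequality s x ≤ y is known only on dom x ∩ dom y, which need not be a core for y. Finiteness of the
trace repairs this. The domain of x is the range of (1 + x)⁻¹, hence contains the ranges of spectral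
projections of trace close to 1, while projections whose ranges meet trivially have traces adding up
to at most 1. So dom x meets the range of every nonzero projection of M (`exists_mem_range_inf`), in
particular any spectral subspace on which y would be too small. Since unit balls then stay inside
one piece, the pieces are clopen. Bounded invertible states are all comparable to 1, hence to each
other.

If M ≠ ℂ there is a nontrivial projection p. The normalised p and 1 - p are at distance 1, and their
perturbations by ε(1 - p) and εp are invertible and nearly so.

If M is infinite dimensional it contains a strictly decreasing sequence of projections q n
(`exists_strictAnti_projections`); otherwise 1 is a finite sum of minimal projections, and each
space pMq between two of these has dimension at most one. The normalisations of 1 + q n are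
uniformly separated, which excludes total boundedness. After arranging q n → 0 and τ(q n) ≤ 16⁻ⁿ, a
contraction r in M has eigenvalues 1, 1/2, 1/4, …, and r⁻² has finite trace. The normalisations of
r⁻¹ - β and r⁻² - β are unbounded and at distance 1; they are invertible for β = 0 and have a kernel
for β = 1. -/

section FormsAndSupports

/-! ### Quadratic forms, projections and supports of bounded operators. -/

section BoundedOperators

theorem form_nonneg {a : H →L[ℂ] H} (ha : 0 ≤ a) (ξ : H) : 0 ≤ (inner ℂ (a ξ) ξ).re :=
  ((ContinuousLinearMap.nonneg_iff_isPositive a).1 ha).re_inner_nonneg_left ξ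

theorem nonneg_of_form {a : H →L[ℂ] H} (ha : IsSelfAdjoint a)
    (h : ∀ ξ, 0 ≤ (inner ℂ (a ξ) ξ).re) : 0 ≤ a :=
  (ContinuousLinearMap.nonneg_iff_isPositive a).2
    (ContinuousLinearMap.isPositive_def'.2 ⟨ha, fun ξ => h ξ⟩)

theorem form_mono {a b : H →L[ℂ] H} (hab : a ≤ b) (ξ : H) :
    (inner ℂ (a ξ) ξ).re ≤ (inner ℂ (b ξ) ξ).re := by
  have := form_nonneg (sub_nonneg.2 hab) ξ
  simp only [sub_apply, inner_sub_left, Complex.sub_re] at this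
  linarith

theorem le_of_form {a b : H →L[ℂ] H} (ha : IsSelfAdjoint a) (hb : IsSelfAdjoint b)
    (h : ∀ ξ, (inner ℂ (a ξ) ξ).re ≤ (inner ℂ (b ξ) ξ).re) : a ≤ b := by
  refine sub_nonneg.1 (nonneg_of_form (hb.sub ha) fun ξ => ?_)
  simp only [sub_apply, inner_sub_left, Complex.sub_re]
  linarith [h ξ]

theorem re_inner_self (ξ : H) : (inner ℂ ξ ξ : ℂ).re = ‖ξ‖ ^ 2 := by
  rw [inner_self_eq_norm_sq_to_K]; norm_cast

theorem le_one_of_form {a : H →L[ℂ] H} (ha : IsSelfAdjoint a)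
    (h : ∀ ξ, (inner ℂ (a ξ) ξ).re ≤ ‖ξ‖ ^ 2) : a ≤ 1 :=
  le_of_form ha (IsSelfAdjoint.one _) fun ξ => (h ξ).trans_eq (re_inner_self ξ).symm

theorem inner_left_of_isSelfAdjoint {a : H →L[ℂ] H} (ha : IsSelfAdjoint a) (ξ η : H) :
    inner ℂ (a ξ) η = inner ℂ ξ (a η) := by
  conv_lhs => rw [← ha.star_eq]
  exact ContinuousLinearMap.adjoint_inner_left a η ξ

theorem form_projection {p : H →L[ℂ] H} (hp : IsStarProjection p) (ξ : H) :
    (inner ℂ (p ξ) ξ).re = ‖p ξ‖ ^ 2 := by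
  have h : p (p ξ) = p ξ := DFunLike.congr_fun hp.isIdempotentElem.eq ξ
  rw [← re_inner_self, ← inner_left_of_isSelfAdjoint hp.isSelfAdjoint (p ξ) ξ, h]

theorem norm_projection_apply_le {p : H →L[ℂ] H} (hp : IsStarProjection p) (ξ : H) :
    ‖p ξ‖ ≤ ‖ξ‖ := by
  have h1 := form_projection hp ξ
  have h2 := (Complex.re_le_norm _).trans (norm_inner_le_norm (𝕜 := ℂ) (p ξ) ξ)
  rw [h1] at h2
  rcases (norm_nonneg (p ξ)).eq_or_lt with h | h
  · rw [← h]; exact norm_nonneg ξ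
  · nlinarith

theorem projection_nonneg {p : H →L[ℂ] H} (hp : IsStarProjection p) : 0 ≤ p :=
  nonneg_of_form hp.isSelfAdjoint fun ξ => by rw [form_projection hp]; positivity

theorem projection_le_one {p : H →L[ℂ] H} (hp : IsStarProjection p) : p ≤ 1 :=
  le_one_of_form hp.isSelfAdjoint fun ξ => by
    rw [form_projection hp]
    exact pow_le_pow_left₀ (norm_nonneg _) (norm_projection_apply_le hp ξ) 2

theorem projection_le_of_mul_eq {p q : H →L[ℂ] H} (hp : IsStarProjection p)
    (hq : IsStarProjection q) (h : p * q = p) : p ≤ q :=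
  le_of_form hp.isSelfAdjoint hq.isSelfAdjoint fun ξ => by
    rw [form_projection hp, form_projection hq, ← h]
    exact pow_le_pow_left₀ (norm_nonneg _) (norm_projection_apply_le hp _) 2

theorem le_projection_of_mul_eq {x e : H →L[ℂ] H} (hx : IsSelfAdjoint x) (h1 : x ≤ 1)
    (he : IsStarProjection e) (h : x * e = x) : x ≤ e := by
  refine le_of_form hx he.isSelfAdjoint fun ξ => ?_
  have h2 : e * x = x := by
    have := congrArg star h
    rwa [star_mul, hx.star_eq, he.isSelfAdjoint.star_eq] at this
  have e1 : (inner ℂ (x ξ) ξ : ℂ) = inner ℂ (x (e ξ)) (e ξ) := by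
    rw [← inner_left_of_isSelfAdjoint he.isSelfAdjoint]
    change _ = inner ℂ ((e * (x * e)) ξ) ξ
    rw [h, h2]
  rw [e1, form_projection he, ← re_inner_self]
  exact form_mono h1 (e ξ)

theorem isSelfAdjoint_ofReal_smul (c : ℝ) {a : H →L[ℂ] H} (ha : IsSelfAdjoint a) :
    IsSelfAdjoint ((c : ℂ) • a) := by
  rw [isSelfAdjoint_iff, star_smul, ha.star_eq, Complex.star_def, Complex.conj_ofReal]

theorem form_ofReal_smul (c : ℝ) (a : H →L[ℂ] H) (ξ : H) :
    (inner ℂ (((c : ℂ) • a) ξ) ξ : ℂ).re = c * (inner ℂ (a ξ) ξ : ℂ).re := by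
  rw [smul_apply, inner_smul_left, Complex.conj_ofReal, Complex.re_ofReal_mul]

theorem ofReal_smul_nonneg {c : ℝ} (hc : 0 ≤ c) {a : H →L[ℂ] H} (ha : 0 ≤ a) :
    0 ≤ (c : ℂ) • a :=
  nonneg_of_form (isSelfAdjoint_ofReal_smul c (IsSelfAdjoint.of_nonneg ha)) fun ξ => by
    rw [form_ofReal_smul]; exact mul_nonneg hc (form_nonneg ha ξ)

theorem form_le_norm (a : H →L[ℂ] H) (ξ : H) : (inner ℂ (a ξ) ξ).re ≤ ‖a‖ * ‖ξ‖ ^ 2 := by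
  refine (Complex.re_le_norm _).trans ((norm_inner_le_norm _ _).trans ?_)
  nlinarith [a.le_opNorm ξ, norm_nonneg ξ]

/-- On the spectrum, (1 - t)ⁿ ≤ (1 + t)⁻ⁿ ≤ (1 + nt)⁻¹ by Bernoulli, so t(1 - t)ⁿ ≤ 1/n. -/
theorem norm_one_sub_pow_mul_le {a : H →L[ℂ] H} (h0 : 0 ≤ a) (h1 : a ≤ 1) {n : ℕ} (hn : 0 < n) :
    ‖(1 - a) ^ n * a‖ ≤ 1 / n := by
  have hsa : IsSelfAdjoint a := IsSelfAdjoint.of_nonneg h0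
  have e : (1 - a) ^ n * a = cfc (fun t : ℝ => (1 - t) ^ n * t) a := by
    rw [cfc_mul _ _ a, cfc_pow _ _ a, cfc_sub _ _ a, cfc_id' ℝ a, cfc_const_one ℝ a]
  rw [e]
  refine norm_cfc_le (by positivity) fun t ht => ?_
  have ht0 : 0 ≤ t := spectrum_nonneg_of_nonneg h0 ht
  have ht1 : t ≤ 1 := (CFC.le_one_iff (R := ℝ) a).1 h1 t ht
  rw [Real.norm_of_nonneg (mul_nonneg (pow_nonneg (by linarith) _) ht0),
    le_div_iff₀ (by positivity)]
  have hb := one_add_mul_le_pow (a := t) (by linarith) n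
  have h2 : (1 - t) ^ n * (1 + t) ^ n ≤ 1 := by
    rw [← mul_pow]; exact pow_le_one₀ (by nlinarith) (by nlinarith)
  have h3 : 0 ≤ (1 - t) ^ n := pow_nonneg (by linarith) _
  nlinarith

/-- The support (range) projection of a bounded operator. -/
def supp (a : H →L[ℂ] H) : H →L[ℂ] H := a.range.topologicalClosure.starProjection

theorem isStarProjection_supp (a : H →L[ℂ] H) : IsStarProjection (supp a) :=
  isStarProjection_starProjection

theorem supp_apply_mem (a : H →L[ℂ] H) (ξ : H) : supp a ξ ∈ closure (Set.range a) :=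
  Submodule.starProjection_apply_mem a.range.topologicalClosure ξ

theorem supp_apply_eq_self {a : H →L[ℂ] H} {ξ : H} (h : ξ ∈ closure (Set.range a)) :
    supp a ξ = ξ :=
  Submodule.starProjection_eq_self_iff.2 h

theorem supp_apply_apply (a : H →L[ℂ] H) (ξ : H) : supp a (a ξ) = a ξ :=
  supp_apply_eq_self (subset_closure ⟨ξ, rfl⟩)

theorem apply_supp_apply {a : H →L[ℂ] H} (ha : IsSelfAdjoint a) (ξ : H) : a (supp a ξ) = a ξ := by
  have h : supp a * a = a := ContinuousLinearMap.ext (supp_apply_apply a)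
  have h2 := congrArg star h
  rw [star_mul, ha.star_eq, (isStarProjection_supp a).isSelfAdjoint.star_eq] at h2
  exact DFunLike.congr_fun h2 ξ

theorem supp_eq_zero_iff {a : H →L[ℂ] H} : supp a = 0 ↔ a = 0 := by
  constructor
  · intro h
    ext ξ
    rw [← supp_apply_apply, h]; rfl
  · intro h
    ext ξ
    have := supp_apply_mem a ξ
    subst h
    have h2 : closure (Set.range (0 : H →L[ℂ] H)) = {0} := by
      rw [show Set.range (0 : H →L[ℂ] H) = {0} from ?_, closure_singleton]
      ext; simp
    rw [h2] at this
    exact this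

theorem supp_apply_eq_zero_iff {a : H →L[ℂ] H} (ha : IsSelfAdjoint a) {ξ : H} :
    supp a ξ = 0 ↔ a ξ = 0 := by
  constructor
  · intro h
    rw [← apply_supp_apply ha, h, map_zero]
  · intro h
    have h1 : ∀ η ∈ closure (Set.range a), inner ℂ ξ η = (0 : ℂ) := by
      intro η hη
      refine closure_minimal (s := Set.range a) (t := {η | inner ℂ ξ η = (0 : ℂ)}) ?_
        (isClosed_eq (by fun_prop) continuous_const) hη
      rintro _ ⟨ζ, rfl⟩
      change inner ℂ ξ (a ζ) = 0
      rw [← inner_left_of_isSelfAdjoint ha, h, inner_zero_left]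
    have h2 := h1 _ (supp_apply_mem a ξ)
    have h3 := form_projection (isStarProjection_supp a) ξ
    rw [← inner_conj_symm, h2, map_zero, Complex.zero_re] at h3
    exact norm_eq_zero.1 (pow_eq_zero_iff two_ne_zero |>.1 h3.symm)

/-- A relation between bounded operators that holds on the range of `a` extends to the range of
the support projection. -/
theorem apply_supp_of_comp_eq {a b c : H →L[ℂ] H} (h : b * a = c * a) {ξ : H}
    (hξ : supp a ξ = ξ) : b ξ = c ξ := by
  have hm : ξ ∈ closure (Set.range a) := hξ ▸ supp_apply_mem a ξ
  refine closure_minimal (s := Set.range a) (t := {η | b η = c η}) ?_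
    (isClosed_eq (by fun_prop) (by fun_prop)) hm
  rintro _ ⟨ζ, rfl⟩
  exact DFunLike.congr_fun h ζ

theorem norm_one_sub_le_one {a : H →L[ℂ] H} (h0 : 0 ≤ a) (h1 : a ≤ 1) : ‖1 - a‖ ≤ 1 :=
  (CStarAlgebra.norm_le_one_iff_of_nonneg (1 - a) (sub_nonneg.2 h1)).2 (by simpa using h0)

theorem norm_one_sub_pow_le_one {a : H →L[ℂ] H} (h0 : 0 ≤ a) (h1 : a ≤ 1) (n : ℕ) :
    ‖(1 - a) ^ n‖ ≤ 1 := by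
  rcases Nat.eq_zero_or_pos n with rfl | hn
  · rw [pow_zero]; exact ContinuousLinearMap.norm_id_le
  · exact (norm_pow_le' _ hn).trans (pow_le_one₀ (norm_nonneg _) (norm_one_sub_le_one h0 h1))

/-- The powers fix the kernel of a and tend to zero on its range by `norm_one_sub_pow_mul_le`; being
contractions they also do so on the closure of the range. Approximating the support by polynomials
in a is what lets the trace identity compare the supports of b*b and bb*. -/
theorem tendsto_one_sub_pow_apply {a : H →L[ℂ] H} (h0 : 0 ≤ a) (h1 : a ≤ 1) (ξ : H) :
    Tendsto (fun n : ℕ => ((1 - a) ^ n) ξ) atTop (𝓝 (ξ - supp a ξ)) := by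
  have hsa : IsSelfAdjoint a := IsSelfAdjoint.of_nonneg h0
  have hfix : ∀ n : ℕ, ((1 - a) ^ n) (ξ - supp a ξ) = ξ - supp a ξ := by
    intro n
    induction n with
    | zero => simp
    | succ n ih =>
      rw [pow_succ, mul_apply_eq_comp]
      have : (1 - a) (ξ - supp a ξ) = ξ - supp a ξ := by
        simp [apply_supp_apply hsa]
      rw [this, ih]
  have hz : Tendsto (fun n : ℕ => ((1 - a) ^ n) (supp a ξ)) atTop (𝓝 0) := by
    rw [Metric.tendsto_atTop]
    intro ε hε
    obtain ⟨_, ⟨ζ, rfl⟩, hζ⟩ := Metric.mem_closure_iff.1 (supp_apply_mem a ξ) (ε / 2) (half_pos hε)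
    obtain ⟨N, hN⟩ := exists_nat_gt (2 * ‖ζ‖ / ε)
    refine ⟨N + 1, fun n hn => ?_⟩
    have hnpos : 0 < n := by omega
    have hnN : 2 * ‖ζ‖ / ε < n := hN.trans (by exact_mod_cast hn)
    rw [dist_zero_right]
    have e : ((1 - a) ^ n) (supp a ξ) = ((1 - a) ^ n) (supp a ξ - a ζ) + ((1 - a) ^ n * a) ζ := by
      rw [map_sub, mul_apply_eq_comp, sub_add_cancel]
    rw [e]
    have b1 : ‖((1 - a) ^ n) (supp a ξ - a ζ)‖ < ε / 2 := by
      refine lt_of_le_of_lt ?_ (dist_eq_norm (supp a ξ) (a ζ) ▸ hζ)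
      refine (ContinuousLinearMap.le_opNorm _ _).trans ?_
      exact mul_le_of_le_one_left (norm_nonneg _) (norm_one_sub_pow_le_one h0 h1 n)
    have b2 : ‖((1 - a) ^ n * a) ζ‖ ≤ ε / 2 := by
      refine (ContinuousLinearMap.le_opNorm _ _).trans ?_
      refine (mul_le_mul_of_nonneg_right (norm_one_sub_pow_mul_le h0 h1 hnpos)
        (norm_nonneg _)).trans ?_
      have : (0 : ℝ) < n := by exact_mod_cast hnpos
      rw [div_lt_iff₀ hε] at hnN
      rw [div_mul_eq_mul_div, one_mul, div_le_iff₀ this]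
      linarith
    exact (norm_add_le _ _).trans_lt (by linarith)
  have : (fun n : ℕ => ((1 - a) ^ n) ξ)
      = fun n : ℕ => ((1 - a) ^ n) (supp a ξ) + (ξ - supp a ξ) := by
    ext n
    conv_lhs => rw [← add_sub_cancel (supp a ξ) ξ, map_add, hfix]
  rw [this]
  simpa using hz.add_const (ξ - supp a ξ)

end BoundedOperators

end FormsAndSupports

/-! ### Projections of M and the trace. -/

section TracialState

section Membership

variable {M : VonNeumannAlgebra H}

theorem mem_of_commute {a : H →L[ℂ] H} (h : ∀ b ∈ M.commutant, b * a = a * b) : a ∈ M := by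
  rw [← M.commutant_commutant]
  exact VonNeumannAlgebra.mem_commutant_iff.2 h

theorem cfc_mem {a : H →L[ℂ] H} (ha : a ∈ M) (f : ℝ → ℝ) : cfc f a ∈ M :=
  mem_of_commute fun b hb =>
    ((show Commute a b from VonNeumannAlgebra.mem_commutant_iff.1 hb a ha).cfc_real f).eq.symm

theorem starProjection_mem {V : Submodule ℂ H} [V.HasOrthogonalProjection]
    (h : ∀ b ∈ M.commutant, ∀ ξ ∈ V, b ξ ∈ V) : V.starProjection ∈ M := by
  rw [VonNeumannAlgebra.IsStarProjection.mem_iff isStarProjection_starProjection]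
  intro b hb
  rw [Submodule.range_starProjection]
  exact fun ξ hξ => h b hb ξ hξ

theorem supp_mem {a : H →L[ℂ] H} (ha : a ∈ M) : supp a ∈ M := by
  refine starProjection_mem fun b hb ξ hξ => ?_
  refine map_mem_closure (s := Set.range a) b.continuous hξ ?_
  rintro _ ⟨ζ, rfl⟩
  exact ⟨b ζ, DFunLike.congr_fun (VonNeumannAlgebra.mem_commutant_iff.1 hb a ha) ζ⟩

/-- The support projection as an element of the algebra. -/
def suppIn (a : M.toStarSubalgebra) : M.toStarSubalgebra := ⟨supp (a : H →L[ℂ] H), supp_mem a.2⟩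

/-- The functional calculus inside the algebra. -/
def cfcIn (f : ℝ → ℝ) (a : M.toStarSubalgebra) : M.toStarSubalgebra :=
  ⟨cfc f (a : H →L[ℂ] H), cfc_mem a.2 f⟩

theorem exists_star_mul_self {a : M.toStarSubalgebra} (ha : (0 : H →L[ℂ] H) ≤ a) :
    ∃ c : M.toStarSubalgebra, a = star c * c := by
  have hsa : IsSelfAdjoint (a : H →L[ℂ] H) := IsSelfAdjoint.of_nonneg ha
  refine ⟨cfcIn Real.sqrt a, Subtype.ext ?_⟩
  change (a : H →L[ℂ] H) = star (cfc Real.sqrt (a : H →L[ℂ] H)) * cfc Real.sqrt (a : H →L[ℂ] H)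
  rw [(cfc_predicate Real.sqrt (a : H →L[ℂ] H)).star_eq, ← cfc_mul _ _ (a : H →L[ℂ] H)]
  conv_lhs => rw [← cfc_id' ℝ (a : H →L[ℂ] H)]
  refine cfc_congr fun t ht => ?_
  exact (Real.mul_self_sqrt (spectrum_nonneg_of_nonneg ha ht)).symm

end Membership

section Trace

variable {M : VonNeumannAlgebra H} {τ : M.toStarSubalgebra →ₗ[ℂ] ℂ}

namespace IsFaithfulNormalTracialState

variable (hτ : IsFaithfulNormalTracialState M τ)
include hτ

theorem re_nonneg {a : M.toStarSubalgebra} (ha : (0 : H →L[ℂ] H) ≤ a) : 0 ≤ (τ a).re := by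
  obtain ⟨c, rfl⟩ := exists_star_mul_self ha
  exact (hτ.nonneg c).1

theorem re_pos {a : M.toStarSubalgebra} (ha : (0 : H →L[ℂ] H) ≤ a) (hne : a ≠ 0) :
    0 < (τ a).re := by
  obtain ⟨c, rfl⟩ := exists_star_mul_self ha
  refine lt_of_le_of_ne (hτ.nonneg c).1 fun h => hne ?_
  rw [hτ.faithful c (Complex.ext h.symm (hτ.nonneg c).2), mul_zero]

theorem re_mono {a b : M.toStarSubalgebra} (hab : a ≤ b) : (τ a).re ≤ (τ b).re := by
  have h := hτ.re_nonneg (a := b - a) (sub_nonneg.2 hab)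
  rw [map_sub, Complex.sub_re] at h
  linarith

theorem re_one : (τ 1).re = 1 := by rw [hτ.map_one, Complex.one_re]

theorem one_ne_zero : (1 : M.toStarSubalgebra) ≠ 0 := by
  intro h
  have := hτ.map_one
  rw [h, map_zero] at this
  exact zero_ne_one this

/-- Normality along monotone sequences that converge as quadratic forms. -/
theorem tendsto_re {a : ℕ → M.toStarSubalgebra} {s : M.toStarSubalgebra}
    (ha : ∀ n, (0 : H →L[ℂ] H) ≤ a n) (hmono : Monotone a) (hs : IsSelfAdjoint (s : H →L[ℂ] H))
    (hlim : ∀ ξ : H, Tendsto (fun n => (inner ℂ ((a n : H →L[ℂ] H) ξ) ξ : ℂ).re) atTop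
      (𝓝 (inner ℂ ((s : H →L[ℂ] H) ξ) ξ : ℂ).re)) :
    Tendsto (fun n => (τ (a n)).re) atTop (𝓝 (τ s).re) := by
  have hsa : ∀ n, IsSelfAdjoint (a n : H →L[ℂ] H) := fun n => IsSelfAdjoint.of_nonneg (ha n)
  have hformmono : ∀ ξ : H, Monotone fun n => (inner ℂ ((a n : H →L[ℂ] H) ξ) ξ : ℂ).re :=
    fun ξ m n hmn => form_mono (hmono hmn) ξ
  have hub : ∀ n, a n ≤ s := fun n =>
    le_of_form (hsa n) hs fun ξ => (hformmono ξ).ge_of_tendsto (hlim ξ) n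
  have hlub : IsLUB (Set.range a) s := by
    refine ⟨?_, fun t ht => ?_⟩
    · rintro _ ⟨n, rfl⟩; exact hub n
    · have hat : ∀ n, a n ≤ t := fun n => ht ⟨n, rfl⟩
      have htsa : IsSelfAdjoint (t : H →L[ℂ] H) :=
        IsSelfAdjoint.of_nonneg ((ha 0).trans (hat 0))
      exact le_of_form hs htsa fun ξ =>
        le_of_tendsto' (hlim ξ) fun n => form_mono (hat n) ξ
  have h := hτ.normal (Set.range a) s ⟨a 0, 0, rfl⟩ (by rintro _ ⟨n, rfl⟩; exact ha n)
    (directedOn_range.2 hmono.directed_le) hlub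
  rw [← Set.range_comp] at h
  exact tendsto_atTop_isLUB (fun m n hmn => hτ.re_mono (hmono hmn)) h

/-- The traces of `1 - (1 - a) ^ n` converge to the trace of the support projection of `a`. -/
theorem tendsto_re_one_sub_pow {a : M.toStarSubalgebra} (h0 : (0 : H →L[ℂ] H) ≤ a)
    (h1 : a ≤ 1) :
    Tendsto (fun n : ℕ => (τ (1 - (1 - a) ^ n)).re) atTop (𝓝 (τ (suppIn a)).re) := by
  have hc0 : (0 : H →L[ℂ] H) ≤ 1 - (a : H →L[ℂ] H) := sub_nonneg.2 h1
  have hc1 : 1 - (a : H →L[ℂ] H) ≤ 1 := by simpa using h0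
  have hanti : Antitone fun n : ℕ => (1 - (a : H →L[ℂ] H)) ^ n :=
    CStarAlgebra.pow_antitone hc0 hc1
  refine hτ.tendsto_re (fun n => ?_) (fun m n hmn => ?_) (isStarProjection_supp _).isSelfAdjoint
    fun ξ => ?_
  · have := hanti (Nat.zero_le n)
    simpa using this
  · exact sub_le_sub_left (hanti hmn) 1
  · have ht := tendsto_one_sub_pow_apply h0 h1 ξ
    have e : ∀ n : ℕ, (((1 - (1 - a) ^ n : M.toStarSubalgebra) : H →L[ℂ] H) ξ)
        = ξ - ((1 - (a : H →L[ℂ] H)) ^ n) ξ := fun n => rfl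
    simp only [e]
    have h2 := ((tendsto_const_nhds (x := ξ)).sub ht)
    rw [sub_sub_cancel] at h2
    exact (Complex.continuous_re.tendsto _).comp (h2.inner tendsto_const_nhds)

/-- In the limit n → ∞ this says that the supports of b*b and bb* have the same trace, without a
polar decomposition. Each increment (1 - b*b)ⁿ b*b is carried to (1 - bb*)ⁿ bb* by moving b around
the trace. -/
theorem re_one_sub_pow_comm (b : M.toStarSubalgebra) (n : ℕ) :
    τ (1 - (1 - star b * b) ^ n) = τ (1 - (1 - b * star b) ^ n) := by
  have hcomm : ∀ n : ℕ, b * (1 - star b * b) ^ n = (1 - b * star b) ^ n * b := by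
    intro n
    induction n with
    | zero => simp
    | succ n ih => rw [pow_succ, ← mul_assoc, ih, pow_succ, mul_assoc, mul_assoc]; noncomm_ring
  have hstep : ∀ (c : M.toStarSubalgebra) (n : ℕ),
      1 - (1 - c) ^ (n + 1) = 1 - (1 - c) ^ n + (1 - c) ^ n * c := by
    intro c n; rw [pow_succ]; noncomm_ring
  induction n with
  | zero => simp
  | succ n ih =>
    rw [hstep, hstep, map_add, map_add, ih]
    congr 1
    rw [hτ.tracial _ (star b * b), mul_assoc, hcomm, hτ.tracial (star b), mul_assoc]

/-- Two projections whose ranges meet trivially have traces summing to at most one. -/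
theorem re_le_of_range_inf_eq_bot {p q : M.toStarSubalgebra}
    (hp : IsStarProjection (p : H →L[ℂ] H)) (hq : IsStarProjection (q : H →L[ℂ] H))
    (h : ∀ ξ, (p : H →L[ℂ] H) ξ = ξ → (q : H →L[ℂ] H) ξ = ξ → ξ = 0) :
    (τ p).re ≤ 1 - (τ q).re := by
  have he : IsStarProjection (((1 - q : M.toStarSubalgebra)) : H →L[ℂ] H) := hq.one_sub
  set e : M.toStarSubalgebra := 1 - q with hedef
  set b : M.toStarSubalgebra := e * p with hb
  have hpA : star p = p := Subtype.ext hp.isSelfAdjoint.star_eq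
  have heA : star e = e := Subtype.ext he.isSelfAdjoint.star_eq
  have hee : e * e = e := Subtype.ext he.isIdempotentElem.eq
  have hform : ∀ ξ : H, (inner ℂ (((star b * b : M.toStarSubalgebra) : H →L[ℂ] H) ξ) ξ : ℂ).re
      = ‖(e : H →L[ℂ] H) ((p : H →L[ℂ] H) ξ)‖ ^ 2 := fun ξ => by
    rw [← re_inner_self]
    congr 1
    exact ContinuousLinearMap.adjoint_inner_left (b : H →L[ℂ] H) ξ ((b : H →L[ℂ] H) ξ)
  have hsa : IsSelfAdjoint ((star b * b : M.toStarSubalgebra) : H →L[ℂ] H) :=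
    IsSelfAdjoint.star_mul_self (b : H →L[ℂ] H)
  have h0 : (0 : H →L[ℂ] H) ≤ (star b * b : M.toStarSubalgebra) :=
    star_mul_self_nonneg (b : H →L[ℂ] H)
  have h1 : star b * b ≤ 1 := le_one_of_form hsa fun ξ => by
    rw [hform]
    exact pow_le_pow_left₀ (norm_nonneg _)
      ((norm_projection_apply_le he _).trans (norm_projection_apply_le hp _)) 2
  -- If b kills ξ, then pξ is fixed by p and by q, so pξ = 0 by hypothesis. Thus ker b ⊆ ker p,
  -- which is the inequality between the supports.
  have hps : p ≤ suppIn (star b * b) := by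
    refine projection_le_of_mul_eq hp (isStarProjection_supp _) ?_
    ext ξ
    set s := supp ((star b * b : M.toStarSubalgebra) : H →L[ℂ] H) with hs
    have hz : s (ξ - s ξ) = 0 := by
      have : s (s ξ) = s ξ := DFunLike.congr_fun (isStarProjection_supp _).isIdempotentElem.eq ξ
      rw [map_sub, this, sub_self]
    rw [hs, supp_apply_eq_zero_iff hsa] at hz
    have h3 := hform (ξ - s ξ)
    rw [hs, hz, inner_zero_left, Complex.zero_re] at h3
    have h4 : (e : H →L[ℂ] H) ((p : H →L[ℂ] H) (ξ - s ξ)) = 0 :=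
      norm_eq_zero.1 (pow_eq_zero_iff two_ne_zero |>.1 h3.symm)
    have h5 : (p : H →L[ℂ] H) (ξ - s ξ) = 0 := by
      refine h _ (DFunLike.congr_fun hp.isIdempotentElem.eq _) ?_
      exact (sub_eq_zero.1 h4).symm
    rw [map_sub, sub_eq_zero] at h5
    exact h5.symm
  refine (hτ.re_mono hps).trans ?_
  refine le_of_tendsto' (hτ.tendsto_re_one_sub_pow h0 h1) fun n => ?_
  -- After exchanging b*b for bb*, whose range lies in that of e = 1 - q, each approximant is
  -- dominated by e.
  rw [hτ.re_one_sub_pow_comm]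
  have hqe : (τ e).re = 1 - (τ q).re := by rw [hedef, map_sub, Complex.sub_re, hτ.re_one]
  rw [← hqe]
  refine hτ.re_mono ?_
  have hbe : star b * e = star b := by rw [hb, star_mul, heA, mul_assoc, hee]
  have hbbe : b * star b * e = b * star b := by rw [mul_assoc b (star b) e, hbe]
  have hpow : ∀ n : ℕ, (1 - (1 - b * star b) ^ n) * e = 1 - (1 - b * star b) ^ n := by
    intro n
    induction n with
    | zero => simp
    | succ n ih =>
      have : 1 - (1 - b * star b) ^ (n + 1)
          = 1 - (1 - b * star b) ^ n + (1 - b * star b) ^ n * (b * star b) := by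
        rw [pow_succ]; noncomm_ring
      rw [this, add_mul, ih, mul_assoc ((1 - b * star b) ^ n) (b * star b) e, hbbe]
  have hc1 : b * star b ≤ 1 := by
    have : b * star b = e * p * e := by rw [hb, star_mul, heA, hpA, ← mul_assoc, mul_assoc e p p,
      show p * p = p from Subtype.ext hp.isIdempotentElem.eq]
    rw [this]
    have hsb : IsSelfAdjoint ((e * p * e : M.toStarSubalgebra) : H →L[ℂ] H) := by
      rw [← this]; exact IsSelfAdjoint.mul_star_self (b : H →L[ℂ] H)
    refine le_one_of_form hsb fun ξ => ?_
    have : (inner ℂ (((e * p * e : M.toStarSubalgebra) : H →L[ℂ] H) ξ) ξ : ℂ)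
        = inner ℂ ((p : H →L[ℂ] H) ((e : H →L[ℂ] H) ξ)) ((e : H →L[ℂ] H) ξ) :=
      inner_left_of_isSelfAdjoint he.isSelfAdjoint _ _
    rw [this, form_projection hp]
    exact pow_le_pow_left₀ (norm_nonneg _)
      ((norm_projection_apply_le hp _).trans (norm_projection_apply_le he _)) 2
  have hc0 : (0 : H →L[ℂ] H) ≤ 1 - (b * star b : M.toStarSubalgebra) := sub_nonneg.2 hc1
  have hpow0 : (0 : H →L[ℂ] H) ≤ (1 - (b * star b : M.toStarSubalgebra)) ^ n :=
    CStarAlgebra.pow_nonneg hc0 n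
  refine le_projection_of_mul_eq ?_ ?_ he (congrArg Subtype.val (hpow n))
  · exact (IsSelfAdjoint.one _).sub (IsSelfAdjoint.of_nonneg hpow0)
  · exact sub_le_self _ hpow0

end IsFaithfulNormalTracialState

end Trace

end TracialState

/-! ### Unbounded self-adjoint operators and their resolvents. -/

section SelfAdjointOperators

section SelfAdjoint

variable {x : H →ₗ.[ℂ] H}

theorem inner_apply_left (hx : IsSelfAdjoint x) (ξ η : x.domain) :
    inner ℂ (x ξ) (η : H) = inner ℂ (ξ : H) (x η) := by
  have h := LinearPMap.adjoint_isFormalAdjoint hx.dense_domain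
  rw [LinearPMap.isSelfAdjoint_def.1 hx] at h
  exact h ξ η

theorem exists_mem_domain (hx : IsSelfAdjoint x) {η w : H}
    (h : ∀ ξ : x.domain, inner ℂ w (ξ : H) = inner ℂ η (x ξ)) :
    ∃ hη : η ∈ x.domain, x ⟨η, hη⟩ = w := by
  have h1 : η ∈ x.adjoint.domain := LinearPMap.mem_adjoint_domain_of_exists η ⟨w, h⟩
  have h2 := LinearPMap.adjoint_apply_eq hx.dense_domain ⟨η, h1⟩ h
  have key : ∀ y : H →ₗ.[ℂ] H, y = x → ∀ hy : η ∈ y.domain, y ⟨η, hy⟩ = w →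
      ∃ hη : η ∈ x.domain, x ⟨η, hη⟩ = w := by
    rintro y rfl hy h; exact ⟨hy, h⟩
  exact key _ (LinearPMap.isSelfAdjoint_def.1 hx) h1 h2

theorem isSelfAdjoint_of_maximal (hd : Dense (x.domain : Set H))
    (hs : ∀ ξ η : x.domain, inner ℂ (x ξ) (η : H) = inner ℂ (ξ : H) (x η))
    (hm : ∀ η w : H, (∀ ξ : x.domain, inner ℂ w (ξ : H) = inner ℂ η (x ξ)) → η ∈ x.domain) :
    IsSelfAdjoint x := by
  rw [LinearPMap.isSelfAdjoint_def]
  have hle : x ≤ x.adjoint := LinearPMap.IsFormalAdjoint.le_adjoint hd hs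
  refine (LinearPMap.eq_of_le_of_domain_eq hle (le_antisymm hle.1 fun η hη => ?_)).symm
  exact hm η (x.adjoint ⟨η, hη⟩) fun ξ => LinearPMap.adjoint_isFormalAdjoint hd ⟨η, hη⟩ ξ

theorem form_nonneg_of_opLE (h : OpLE 0 x) (ξ : x.domain) : 0 ≤ (inner ℂ (x ξ) (ξ : H)).re := by
  have := h ⟨ξ, ξ.2, trivial⟩
  simpa [LinearPMap.sub_apply] using this

/-- Cauchy-Schwarz for the quadratic form of a positive operator. -/
theorem re_inner_sq_le (hx : IsSelfAdjoint x) (h : OpLE 0 x) (ξ η : x.domain) :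
    (inner ℂ (x ξ) (η : H)).re ^ 2
      ≤ (inner ℂ (x ξ) (ξ : H)).re * (inner ℂ (x η) (η : H)).re := by
  have hsymm : (inner ℂ (x η) (ξ : H)).re = (inner ℂ (x ξ) (η : H)).re := by
    rw [inner_apply_left hx, ← inner_conj_symm, Complex.conj_re]
  have hq : ∀ t : ℝ, 0 ≤ (inner ℂ (x η) (η : H)).re * (t * t)
      + 2 * (inner ℂ (x ξ) (η : H)).re * t + (inner ℂ (x ξ) (ξ : H)).re := by
    intro t
    have h1 := form_nonneg_of_opLE h (ξ + (t : ℂ) • η)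
    rw [LinearPMap.map_add, LinearPMap.map_smul] at h1
    simp only [Submodule.coe_add, Submodule.coe_smul, inner_add_left, inner_add_right,
      inner_smul_left, inner_smul_right, Complex.add_re, Complex.conj_ofReal, Complex.re_ofReal_mul,
      hsymm] at h1
    linarith
  have := discrim_le_zero hq
  rw [discrim] at this
  nlinarith

/-- A self-adjoint operator whose shift is bounded below has an everywhere defined bounded
resolvent. -/
theorem exists_bounded_inverse (hx : IsSelfAdjoint x) (s : ℝ) {c : ℝ} (hc : 0 < c)
    (hb : ∀ ξ : x.domain, c * ‖(ξ : H)‖ ≤ ‖x ξ + (s : ℂ) • (ξ : H)‖) :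
    ∃ b : H →L[ℂ] H, (∀ ξ : H, ∃ h : b ξ ∈ x.domain, x ⟨b ξ, h⟩ + (s : ℂ) • b ξ = ξ) ∧
      ∀ ξ : x.domain, b (x ξ + (s : ℂ) • (ξ : H)) = ξ := by
  let T : x.domain →ₗ[ℂ] H := x.toFun + (s : ℂ) • x.domain.subtype
  have hT : ∀ ξ : x.domain, T ξ = x ξ + (s : ℂ) • (ξ : H) := fun ξ => rfl
  have hinj : Function.Injective T := by
    refine (injective_iff_map_eq_zero T).2 fun ξ h => ?_
    have h1 := hb ξ
    rw [← hT, h, norm_zero] at h1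
    have : ‖(ξ : H)‖ = 0 := le_antisymm (by nlinarith [norm_nonneg (ξ : H)]) (norm_nonneg _)
    exact Subtype.ext (norm_eq_zero.1 this)
  -- The map (ξ, xξ) ↦ xξ + sξ is bounded below on the graph of x, which is complete, so its range
  -- is closed.
  have hclosed : IsClosed (T.range : Set H) := by
    have hg : IsClosed (x.graph : Set (H × H)) := hx.isClosed
    have : CompleteSpace x.graph := hg.completeSpace_coe
    let φ : x.graph →L[ℂ] H := (ContinuousLinearMap.snd ℂ H H
      + (s : ℂ) • ContinuousLinearMap.fst ℂ H H).comp x.graph.subtypeL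
    have hφ : ∀ z : x.graph, φ z = (z : H × H).2 + (s : ℂ) • (z : H × H).1 := fun z => rfl
    have hanti : AntilipschitzWith (Real.toNNReal (1 + (1 + |s|) / c)) φ := by
      refine AddMonoidHomClass.antilipschitz_of_bound φ fun z => ?_
      obtain ⟨ξ, h1, h2⟩ := (LinearPMap.mem_graph_iff x).1 z.2
      have hz := hb ξ
      rw [h1, h2, ← hφ] at hz
      have hn1 : ‖(z : H × H).1‖ ≤ ‖φ z‖ / c := by rw [le_div_iff₀ hc]; linarith
      have hn2 : ‖(z : H × H).2‖ ≤ ‖φ z‖ + |s| * (‖φ z‖ / c) := by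
        have : (z : H × H).2 = φ z - (s : ℂ) • (z : H × H).1 := by rw [hφ]; abel
        rw [this]
        refine (norm_sub_le _ _).trans (add_le_add le_rfl ?_)
        rw [norm_smul, Complex.norm_real, Real.norm_eq_abs]
        exact mul_le_mul_of_nonneg_left hn1 (abs_nonneg s)
      have hφ0 := norm_nonneg (φ z)
      have hd : 0 ≤ ‖φ z‖ / c := by positivity
      have hsd : 0 ≤ |s| * (‖φ z‖ / c) := by positivity
      rw [Real.coe_toNNReal _ (by positivity)]
      have e : (1 + (1 + |s|) / c) * ‖φ z‖ = ‖φ z‖ + ‖φ z‖ / c + |s| * (‖φ z‖ / c) := by ring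
      rw [e]
      change max ‖(z : H × H).1‖ ‖(z : H × H).2‖ ≤ _
      exact max_le (by linarith) (by linarith)
    have := hanti.isClosed_range φ.uniformContinuous
    convert this using 1
    ext η
    constructor
    · rintro ⟨ξ, rfl⟩
      exact ⟨⟨_, x.mem_graph ξ⟩, rfl⟩
    · rintro ⟨z, rfl⟩
      obtain ⟨ξ, h1, h2⟩ := (LinearPMap.mem_graph_iff x).1 z.2
      exact ⟨ξ, by rw [hT, h1, h2, hφ]⟩
  -- A vector orthogonal to the range lies in the domain of x* = x and is annihilated by x + s,
  -- hence vanishes by the lower bound.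
  have hsurj : T.range = ⊤ := by
    have : CompleteSpace T.range := hclosed.completeSpace_coe
    rw [← Submodule.orthogonal_eq_bot_iff, Submodule.eq_bot_iff]
    intro η hη
    rw [Submodule.mem_orthogonal'] at hη
    obtain ⟨h1, h2⟩ := exists_mem_domain hx (η := η) (w := -((s : ℂ) • η)) fun ξ => by
      have := hη (T ξ) ⟨ξ, rfl⟩
      rw [hT, inner_add_right, inner_smul_right] at this
      rw [inner_neg_left, inner_smul_left, Complex.conj_ofReal]
      linear_combination -this
    have h3 := hb ⟨η, h1⟩
    rw [h2] at h3
    simp only [neg_add_cancel, norm_zero] at h3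
    exact norm_eq_zero.1 (le_antisymm (by nlinarith [norm_nonneg η]) (norm_nonneg _))
  let e := LinearEquiv.ofBijective T ⟨hinj, LinearMap.range_eq_top.1 hsurj⟩
  have he : ∀ ξ, T (e.symm ξ) = ξ := fun ξ => e.apply_symm_apply ξ
  refine ⟨LinearMap.mkContinuous (x.domain.subtype ∘ₗ e.symm.toLinearMap) c⁻¹ fun ξ => ?_,
    fun ξ => ⟨(e.symm ξ).2, he ξ⟩, fun ξ => ?_⟩
  · have := hb (e.symm ξ)
    rw [← hT, he] at this
    rw [inv_mul_eq_div, le_div_iff₀ hc, mul_comm]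
    exact this
  · exact congrArg Subtype.val (e.symm_apply_apply ξ)

theorem norm_le_norm_apply_add (h : OpLE 0 x) (ξ : x.domain) : ‖(ξ : H)‖ ≤ ‖x ξ + (ξ : H)‖ := by
  have h1 := form_nonneg_of_opLE h ξ
  have h2 := (Complex.re_le_norm _).trans (norm_inner_le_norm (𝕜 := ℂ) (x ξ + (ξ : H)) (ξ : H))
  rw [inner_add_left, Complex.add_re, re_inner_self] at h2
  rcases (norm_nonneg (ξ : H)).eq_or_lt with h | h
  · rw [← h]; exact norm_nonneg _
  · nlinarith

end SelfAdjoint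

/-- The resolvent `(1 + x)⁻¹` of a positive affiliated operator, as an element of the algebra. -/
theorem exists_resolvent {M : VonNeumannAlgebra H} {x : H →ₗ.[ℂ] H} (hx : x ∈ posAffiliated M) :
    ∃ r : M.toStarSubalgebra, (0 : H →L[ℂ] H) ≤ r ∧ r ≤ 1 ∧
      (∀ ξ : H, ∃ h : (r : H →L[ℂ] H) ξ ∈ x.domain, x ⟨_, h⟩ = ξ - (r : H →L[ℂ] H) ξ) ∧
      ∀ ξ : x.domain, (r : H →L[ℂ] H) (x ξ + ξ) = ξ := by
  obtain ⟨hsa, haff, hpos⟩ := hx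
  obtain ⟨r, hr1, hr2⟩ := exists_bounded_inverse hsa 1 one_pos (c := 1) fun ξ => by
    simpa using norm_le_norm_apply_add hpos ξ
  simp only [Complex.ofReal_one, one_smul] at hr1 hr2
  have hr : ∀ ξ : H, ∃ h : r ξ ∈ x.domain, x ⟨_, h⟩ = ξ - r ξ := fun ξ => by
    obtain ⟨h, e⟩ := hr1 ξ
    exact ⟨h, eq_sub_of_add_eq e⟩
  have hrM : r ∈ M := mem_of_commute fun b hb => by
    ext ξ
    obtain ⟨h, e⟩ := hr1 ξ
    obtain ⟨h', e'⟩ := haff b hb ⟨r ξ, h⟩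
    have := hr2 ⟨b (r ξ), h'⟩
    rw [e'] at this
    change r (b (x ⟨r ξ, h⟩) + b (r ξ)) = b (r ξ) at this
    rw [← map_add, e] at this
    exact this.symm
  have hrsa : IsSelfAdjoint r := by
    rw [ContinuousLinearMap.isSelfAdjoint_iff_isSymmetric]
    intro ξ η
    obtain ⟨h, e⟩ := hr1 ξ
    obtain ⟨h', e'⟩ := hr1 η
    change inner ℂ (r ξ) η = inner ℂ ξ (r η)
    conv_lhs => rw [← e']
    conv_rhs => rw [← e]
    rw [inner_add_left, inner_add_right, ← inner_apply_left hsa ⟨_, h⟩ ⟨_, h'⟩]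
  have hr0 : 0 ≤ r := nonneg_of_form hrsa fun ξ => by
    obtain ⟨h, e⟩ := hr1 ξ
    have : (inner ℂ (r ξ) ξ : ℂ).re = (inner ℂ (x ⟨_, h⟩) (r ξ)).re + ‖r ξ‖ ^ 2 := by
      have e2 : (inner ℂ (r ξ) ξ : ℂ) = inner ℂ (r ξ) (x ⟨_, h⟩ + r ξ) :=
        congrArg (inner ℂ (r ξ)) e.symm
      rw [e2, inner_add_right, Complex.add_re, re_inner_self, ← inner_conj_symm, Complex.conj_re]
    rw [this]
    have := form_nonneg_of_opLE hpos ⟨_, h⟩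
    positivity
  refine ⟨⟨r, hrM⟩, hr0, ?_, hr, hr2⟩
  refine le_one_of_form hrsa fun ξ => ?_
  obtain ⟨h, e⟩ := hr1 ξ
  have h1 := norm_le_norm_apply_add hpos ⟨_, h⟩
  rw [e] at h1
  refine (Complex.re_le_norm _).trans ((norm_inner_le_norm _ _).trans ?_)
  change ‖r ξ‖ ≤ ‖ξ‖ at h1
  nlinarith [norm_nonneg ξ]

end SelfAdjointOperators

/-! ### Spectral truncation by continuous functions, and ranges of dense-range elements of M. -/

section Truncation

section Cut

/-- A continuous function vanishing on `(-∞, κ]` and equal to `1` on `[2 κ, ∞)`. -/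
def cut (κ t : ℝ) : ℝ := min 1 (max (t / κ - 1) 0)

@[fun_prop]
theorem continuous_cut (κ : ℝ) : Continuous fun t => cut κ t := by
  unfold cut; fun_prop

theorem cut_nonneg (κ t : ℝ) : 0 ≤ cut κ t := le_min zero_le_one (le_max_right _ _)

theorem cut_le_one (κ t : ℝ) : cut κ t ≤ 1 := min_le_left _ _

theorem cut_eq_zero {κ t : ℝ} (hκ : 0 < κ) (h : t ≤ κ) : cut κ t = 0 := by
  have : t / κ - 1 ≤ 0 := by rw [sub_nonpos, div_le_one hκ]; exact h
  rw [cut, max_eq_right this, min_eq_right zero_le_one]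

theorem cut_eq_one {κ t : ℝ} (hκ : 0 < κ) (h : 2 * κ ≤ t) : cut κ t = 1 := by
  have : 1 ≤ t / κ - 1 := by rw [le_sub_iff_add_le, le_div_iff₀ hκ]; linarith
  rw [cut, min_eq_left (this.trans (le_max_left _ _))]

theorem sub_le_cut {κ t : ℝ} (hκ : 0 < κ) (hκ1 : κ ≤ 1) (h1 : t ≤ 1) : t - κ ≤ cut κ t := by
  refine le_min (by linarith) ?_
  rcases le_total t κ with h | h
  · exact (sub_nonpos.2 h).trans (le_max_right _ _)
  · refine le_trans ?_ (le_max_left _ _)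
    rw [div_sub_one hκ.ne', le_div_iff₀ hκ]
    nlinarith

variable {r : H →L[ℂ] H} {κ : ℝ}

/-- Vectors in the spectral subspace `r > κ` lie in the range of `r`. -/
theorem exists_preimage_of_supp_cut (hr : IsSelfAdjoint r) (hκ : 0 < κ) {ξ : H}
    (hξ : supp (cfc (cut κ) r) ξ = ξ) :
    ∃ η : H, r η = ξ ∧ (inner ℂ η ξ : ℂ).re ≤ κ⁻¹ * ‖ξ‖ ^ 2 := by
  -- The function 1 / max(t, κ) is continuous, bounded by κ⁻¹, and inverts t wherever `cut κ` is
  -- nonzero; applied to r it inverts r on the support of `cut κ`.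
  have hcont : Continuous fun t : ℝ => (max t κ)⁻¹ :=
    Continuous.inv₀ (by fun_prop) fun t => (hκ.trans_le (le_max_right _ _)).ne'
  set g := cfc (fun t : ℝ => (max t κ)⁻¹) r with hg
  have hmul : r * g * cfc (cut κ) r = 1 * cfc (cut κ) r := by
    have e : r * g = cfc (fun t : ℝ => t * (max t κ)⁻¹) r := by
      rw [cfc_mul (fun t => t) _ r continuousOn_id hcont.continuousOn, cfc_id' ℝ r]
    have hcont' : Continuous fun t : ℝ => t * (max t κ)⁻¹ := continuous_id.mul hcont
    rw [e, one_mul, ← cfc_mul _ _ r hcont'.continuousOn (continuous_cut κ).continuousOn]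
    refine cfc_congr fun t _ => ?_
    rcases le_total t κ with h | h
    · simp [cut_eq_zero hκ h]
    · simp only [max_eq_left h]
      rw [mul_inv_cancel₀ (hκ.trans_le h).ne', one_mul]
  refine ⟨g ξ, apply_supp_of_comp_eq hmul hξ, ?_⟩
  refine (form_le_norm g ξ).trans (mul_le_mul_of_nonneg_right ?_ (by positivity))
  refine norm_cfc_le (by positivity) fun t _ => ?_
  have hm := hκ.trans_le (le_max_right t κ)
  rw [Real.norm_of_nonneg (by positivity)]
  exact inv_anti₀ hκ (le_max_right _ _)

/-- If r has no spectrum above κ then r² ≤ κr. Pointwise on [0,1] this is t² ≤ κt + `cut κ t`, from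
`sub_le_cut`, and the last term contributes the zero operator. -/
theorem sq_le_of_cfc_cut_eq_zero (h0 : 0 ≤ r) (h1 : r ≤ 1) (hκ : 0 < κ) (hκ1 : κ ≤ 1)
    (h : cfc (cut κ) r = 0) (ξ : H) : ‖r ξ‖ ^ 2 ≤ κ * (inner ℂ (r ξ) ξ : ℂ).re := by
  have hsa : IsSelfAdjoint r := IsSelfAdjoint.of_nonneg h0
  have hle : r * r ≤ (κ : ℝ) • r := by
    have e : r = cfc (fun t : ℝ => t) r := (cfc_id' ℝ r).symm
    have e1 : r * r = cfc (fun t : ℝ => t * t) r := by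
      rw [cfc_mul _ _ r, ← e]
    have e2 : κ • r = cfc (fun t : ℝ => κ • t + cut κ t) r := by
      rw [cfc_add (a := r) (fun t => κ • t) (cut κ), h, add_zero, cfc_smul κ (fun t => t) r, ← e]
    rw [e1, e2]
    refine cfc_mono (fun t ht => ?_) 
    have ht0 : 0 ≤ t := spectrum_nonneg_of_nonneg h0 ht
    have ht1 : t ≤ 1 := (CFC.le_one_iff (R := ℝ) r).1 h1 t ht
    have := sub_le_cut hκ hκ1 ht1
    have hc := cut_nonneg κ t
    simp only [smul_eq_mul]
    rcases le_total t κ with h | h <;> nlinarith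
  have := form_mono hle ξ
  rw [show (r * r) ξ = r (r ξ) from rfl, inner_left_of_isSelfAdjoint hsa, re_inner_self] at this
  refine this.trans_eq ?_
  rw [show (κ • r) ξ = (κ : ℂ) • r ξ from rfl, inner_smul_left, Complex.conj_ofReal,
    Complex.re_ofReal_mul]

end Cut

section Density

variable {M : VonNeumannAlgebra H} {τ : M.toStarSubalgebra →ₗ[ℂ] ℂ}
variable (hτ : IsFaithfulNormalTracialState M τ)
include hτ

theorem IsFaithfulNormalTracialState.re_supp_le {a : M.toStarSubalgebra}
    (h0 : (0 : H →L[ℂ] H) ≤ a) (h1 : a ≤ 1) : (τ a).re ≤ (τ (suppIn a)).re := by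
  have hsa : IsSelfAdjoint (a : H →L[ℂ] H) := IsSelfAdjoint.of_nonneg h0
  refine hτ.re_mono (le_projection_of_mul_eq hsa h1 (isStarProjection_supp _) ?_)
  ext ξ
  exact apply_supp_apply hsa ξ

/-- On [0,1] one has 1 - (1 - t)ⁿ ≤ `cut κ t` + 2nκ: the cut equals 1 from 2κ on, and below 2κ
Bernoulli bounds the left side by nt. With n fixed and κ small, the spectral part above κ carries
almost all of the trace seen by the n-th approximant. -/
theorem IsFaithfulNormalTracialState.one_sub_re_le_cut {r : M.toStarSubalgebra}
    (h0 : (0 : H →L[ℂ] H) ≤ r) (h1 : r ≤ 1) {κ : ℝ} (hκ : 0 < κ) (n : ℕ) :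
    (τ (1 - (1 - r) ^ n)).re - 2 * n * κ ≤ (τ (suppIn (cfcIn (cut κ) r))).re := by
  have hsa : IsSelfAdjoint (r : H →L[ℂ] H) := IsSelfAdjoint.of_nonneg h0
  have hc0 : (0 : H →L[ℂ] H) ≤ cfcIn (cut κ) r := cfc_nonneg fun t _ => cut_nonneg κ t
  have hc1 : cfcIn (cut κ) r ≤ 1 := cfc_le_one (cut κ) (r : H →L[ℂ] H) fun t _ => cut_le_one κ t
  refine le_trans ?_ (hτ.re_supp_le hc0 hc1)
  have hle : 1 - (1 - r) ^ n ≤ cfcIn (cut κ) r + ((2 * n * κ : ℝ) : ℂ) • 1 := by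
    change (1 - (1 - (r : H →L[ℂ] H)) ^ n) ≤ cfc (cut κ) (r : H →L[ℂ] H)
      + ((2 * n * κ : ℝ) : ℂ) • (1 : H →L[ℂ] H)
    have e1 : 1 - (1 - (r : H →L[ℂ] H)) ^ n
        = cfc (fun t : ℝ => 1 - (1 - t) ^ n) (r : H →L[ℂ] H) := by
      rw [cfc_sub _ _ (r : H →L[ℂ] H), cfc_pow _ _ (r : H →L[ℂ] H), cfc_sub _ _ (r : H →L[ℂ] H),
        cfc_id' ℝ (r : H →L[ℂ] H), cfc_const_one ℝ (r : H →L[ℂ] H)]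
    have e2 : cfc (cut κ) (r : H →L[ℂ] H) + ((2 * n * κ : ℝ) : ℂ) • (1 : H →L[ℂ] H)
        = cfc (fun t : ℝ => cut κ t + 2 * n * κ) (r : H →L[ℂ] H) := by
      rw [cfc_add (a := (r : H →L[ℂ] H)) (cut κ) (fun _ => 2 * n * κ), cfc_const _ (r : H →L[ℂ] H)]
      rfl
    rw [e1, e2]
    refine cfc_mono (fun t ht => ?_)
    have ht0 : 0 ≤ t := spectrum_nonneg_of_nonneg h0 ht
    have ht1 : t ≤ 1 := (CFC.le_one_iff (R := ℝ) (r : H →L[ℂ] H)).1 h1 t ht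
    have hp : 0 ≤ (1 - t) ^ n := pow_nonneg (by linarith) _
    have hcn := cut_nonneg κ t
    rcases le_total (2 * κ) t with h | h
    · rw [cut_eq_one hκ h]
      have : 0 ≤ 2 * n * κ := by positivity
      linarith
    · have hb := one_add_mul_le_pow (a := -t) (by linarith) n
      rw [← sub_eq_add_neg] at hb
      have : (n : ℝ) * t ≤ n * (2 * κ) := mul_le_mul_of_nonneg_left h (by positivity)
      nlinarith
  have := hτ.re_mono hle
  rw [map_add, map_smul, hτ.map_one, smul_eq_mul, mul_one, Complex.add_re, Complex.ofReal_re] at this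
  linarith

/-- The range of an element with dense range meets the range of every nonzero projection. -/
theorem IsFaithfulNormalTracialState.exists_mem_range_inf {p r : M.toStarSubalgebra}
    (hp : IsStarProjection (p : H →L[ℂ] H)) (hp0 : p ≠ 0)
    (h0 : (0 : H →L[ℂ] H) ≤ r) (h1 : r ≤ 1) (hd : DenseRange (r : H →L[ℂ] H)) :
    ∃ η : H, (r : H →L[ℂ] H) η ≠ 0 ∧
      (p : H →L[ℂ] H) ((r : H →L[ℂ] H) η) = (r : H →L[ℂ] H) η := by
  have hsa : IsSelfAdjoint (r : H →L[ℂ] H) := IsSelfAdjoint.of_nonneg h0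
  have hpos := hτ.re_pos (projection_nonneg hp) hp0
  have hs1 : suppIn r = 1 := by
    ext ξ
    exact supp_apply_eq_self (hd ξ)
  have hlim := hτ.tendsto_re_one_sub_pow h0 h1
  rw [hs1, hτ.re_one] at hlim
  -- Half of τ(p) is spent on the choice of n and less than half on κ, so the spectral projection q
  -- of r above κ has τ(q) > 1 - τ(p). Its range lies in the range of r, and it must meet that of p.
  obtain ⟨n, hn⟩ := (hlim.eventually (lt_mem_nhds (show 1 - (τ p).re / 2 < 1 by linarith))).exists
  obtain ⟨κ, hκ, hκn⟩ : ∃ κ : ℝ, 0 < κ ∧ 2 * n * κ < (τ p).re / 2 := by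
    refine ⟨(τ p).re / 2 / (2 * n + 1), by positivity, ?_⟩
    rw [mul_div_assoc', div_lt_iff₀ (by positivity)]
    nlinarith
  have hq := hτ.one_sub_re_le_cut h0 h1 hκ n
  by_contra! hcon
  have := hτ.re_le_of_range_inf_eq_bot hp
    (isStarProjection_supp ((cfcIn (cut κ) r : M.toStarSubalgebra) : H →L[ℂ] H))
    (q := suppIn (cfcIn (cut κ) r)) fun ξ hpξ hqξ => by
      obtain ⟨η, rfl, -⟩ := exists_preimage_of_supp_cut hsa hκ hqξ
      by_contra hne
      exact hcon η hne hpξ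
  linarith

end Density

end Truncation

/-! ### Domination of operators: transport of boundedness and invertibility. -/

section Comparison

section Order

variable {x y : H →ₗ.[ℂ] H}

theorem opLE_smul_iff {t : ℝ} : OpLE ((t : ℂ) • y) x ↔
    ∀ (ξ : H) (hx : ξ ∈ x.domain) (hy : ξ ∈ y.domain),
      t * (inner ℂ (y ⟨ξ, hy⟩) ξ : ℂ).re ≤ (inner ℂ (x ⟨ξ, hx⟩) ξ : ℂ).re := by
  have key : ∀ ξ : (x - (t : ℂ) • y).domain,
      (inner ℂ ((x - (t : ℂ) • y) ξ) (ξ : H) : ℂ).re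
        = (inner ℂ (x ⟨ξ, ξ.2.1⟩) (ξ : H) : ℂ).re
          - t * (inner ℂ (y ⟨ξ, ξ.2.2⟩) (ξ : H) : ℂ).re := by
    intro ξ
    rw [LinearPMap.sub_apply, inner_sub_left, Complex.sub_re, LinearPMap.smul_apply,
      inner_smul_left, Complex.conj_ofReal, Complex.re_ofReal_mul]
  constructor
  · intro h ξ hx hy
    have := h ⟨ξ, hx, hy⟩
    rw [key] at this
    linarith
  · intro h ξ
    rw [key]
    linarith [h ξ ξ.2.1 ξ.2.2]

/-- The set contains 0, and the real supremum of an unbounded set is 0 by convention; either way the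
value is nonnegative. -/
theorem m_nonneg (hx : OpLE 0 x) : 0 ≤ m x y :=
  Real.sSup_nonneg' ⟨0, opLE_smul_iff.2 fun ξ h _ => by
    rw [zero_mul]; exact form_nonneg_of_opLE hx ⟨ξ, h⟩, le_rfl⟩

theorem d_le_one (hx : OpLE 0 x) (hy : OpLE 0 y) : d x y ≤ 1 := by
  have h := mul_nonneg (m_nonneg (y := y) hx) (m_nonneg (y := x) hy)
  rw [d, div_le_one (by linarith)]
  linarith

theorem d_comm (x y : H →ₗ.[ℂ] H) : d x y = d y x := by
  rw [d, d, mul_comm]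

theorem d_lt_one_iff (hx : OpLE 0 x) (hy : OpLE 0 y) : d x y < 1 ↔ 0 < m x y * m y x := by
  have h := mul_nonneg (m_nonneg (y := y) hx) (m_nonneg (y := x) hy)
  rw [d, div_lt_one (by linarith)]
  constructor <;> intro <;> linarith

theorem exists_opLE_of_m_pos (hx : OpLE 0 x) (h : 0 < m x y) :
    ∃ t : ℝ, 0 < t ∧ OpLE ((t : ℂ) • y) x := by
  obtain ⟨t, ht, h0⟩ := exists_lt_of_lt_csSup (s := {t : ℝ | OpLE ((t : ℂ) • y) x})
    ⟨0, opLE_smul_iff.2 fun ξ h _ => by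
      rw [zero_mul]; exact form_nonneg_of_opLE hx ⟨ξ, h⟩⟩ h
  exact ⟨t, h0, ht⟩

theorem exists_opLE_of_d_lt_one (hx : OpLE 0 x) (hy : OpLE 0 y) (h : d x y < 1) :
    ∃ t : ℝ, 0 < t ∧ OpLE ((t : ℂ) • y) x := by
  refine exists_opLE_of_m_pos hx ?_
  refine (m_nonneg hx).lt_of_ne fun h0 => ?_
  have := (d_lt_one_iff hx hy).1 h
  rw [← h0, zero_mul] at this
  exact lt_irrefl _ this

end Order

section Bounded

variable {x y : H →ₗ.[ℂ] H}

/-- Every functional ξ ↦ ⟨η, xξ⟩ is continuous, so every η lies in the domain of x* = x. -/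
theorem domain_eq_top_of_isBoundedOp (hx : IsSelfAdjoint x) (hb : IsBoundedOp x) :
    x.domain = ⊤ := by
  obtain ⟨C, hC⟩ := hb
  rw [Submodule.eq_top_iff']
  intro η
  have hc : Continuous x.toFun := (LinearMap.mkContinuous x.toFun C hC).continuous
  have : η ∈ x.adjoint.domain := by
    rw [LinearPMap.mem_adjoint_domain_iff]
    exact (innerSL ℂ η).continuous.comp hc
  rwa [LinearPMap.isSelfAdjoint_def.1 hx] at this

theorem isBoundedOp_ofBounded (a : H →L[ℂ] H) : IsBoundedOp (ofBounded a) :=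
  ⟨‖a‖, fun ξ => a.le_opNorm ξ⟩

theorem isBoundedOp_iff_mem_algebraSet {M : VonNeumannAlgebra H} (hx : x ∈ posAffiliated M) :
    IsBoundedOp x ↔ x ∈ algebraSet M := by
  constructor
  · intro hb
    have htop := domain_eq_top_of_isBoundedOp hx.1 hb
    obtain ⟨C, hC⟩ := hb
    let f : H →ₗ[ℂ] x.domain := (LinearMap.id).codRestrict x.domain fun ξ => by
      rw [htop]; trivial
    let a : H →L[ℂ] H := LinearMap.mkContinuous (x.toFun ∘ₗ f) C fun ξ => hC (f ξ)
    refine ⟨a, mem_of_commute fun b hb => ?_, ?_⟩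
    · ext ξ
      obtain ⟨h, e⟩ := hx.2.1 b hb (f ξ)
      exact e.symm
    · refine LinearPMap.ext htop.symm fun ξ h1 h2 => rfl
  · rintro ⟨a, -, rfl⟩
    exact isBoundedOp_ofBounded a

/-- As x is everywhere defined, the inequality bounds the form of y on all of dom y. Cauchy–Schwarz
for this form and density of dom y turn the form bound into a norm bound. -/
theorem isBoundedOp_of_opLE (hx : IsSelfAdjoint x) (hy : IsSelfAdjoint y) (hy0 : OpLE 0 y)
    {t : ℝ} (ht : 0 < t) (h : OpLE ((t : ℂ) • y) x) (hb : IsBoundedOp x) : IsBoundedOp y := by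
  have htop := domain_eq_top_of_isBoundedOp hx hb
  obtain ⟨C, hC⟩ := hb
  rw [opLE_smul_iff] at h
  set K := |C| / t with hK
  have hK0 : 0 ≤ K := by positivity
  have hform : ∀ ξ : y.domain, (inner ℂ (y ξ) (ξ : H) : ℂ).re ≤ K * ‖(ξ : H)‖ ^ 2 := by
    intro ξ
    have hξ : (ξ : H) ∈ x.domain := by rw [htop]; trivial
    have h1 := h ξ hξ ξ.2
    have h2 := (Complex.re_le_norm _).trans (norm_inner_le_norm (𝕜 := ℂ) (x ⟨ξ, hξ⟩) (ξ : H))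
    have h3 := hC ⟨ξ, hξ⟩
    have h4 : C ≤ |C| := le_abs_self C
    rw [hK, div_mul_eq_mul_div, le_div_iff₀ ht]
    have h5 : ‖x ⟨ξ, hξ⟩‖ ≤ |C| * ‖(ξ : H)‖ :=
      h3.trans (mul_le_mul_of_nonneg_right h4 (norm_nonneg _))
    nlinarith [norm_nonneg (ξ : H)]
  refine ⟨K, fun ξ => ?_⟩
  have hall : ∀ η : H, (inner ℂ (y ξ) η : ℂ).re ≤ K * ‖(ξ : H)‖ * ‖η‖ := by
    intro η
    refine closure_minimal (s := (y.domain : Set H))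
      (t := {η | (inner ℂ (y ξ) η : ℂ).re ≤ K * ‖(ξ : H)‖ * ‖η‖}) ?_
      (isClosed_le (Complex.continuous_re.comp (by fun_prop)) (by fun_prop)) (hy.dense_domain η)
    intro η hη
    have h1 := re_inner_sq_le hy hy0 ξ ⟨η, hη⟩
    have h2 := hform ξ
    have h3 := hform ⟨η, hη⟩
    have h4 := form_nonneg_of_opLE hy0 ξ
    have h5 := form_nonneg_of_opLE hy0 ⟨η, hη⟩
    have h6 : (inner ℂ (y ξ) η : ℂ).re ^ 2 ≤ (K * ‖(ξ : H)‖ * ‖η‖) ^ 2 :=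
      calc _ ≤ _ := h1
        _ ≤ (K * ‖(ξ : H)‖ ^ 2) * (K * ‖η‖ ^ 2) := mul_le_mul h2 h3 h5 (by positivity)
        _ = _ := by ring
    exact (abs_le_of_sq_le_sq' h6 (by positivity)).2
  have := hall (y ξ)
  rw [re_inner_self] at this
  rcases (norm_nonneg (y ξ)).eq_or_lt with h0 | h0
  · rw [← h0]; positivity
  · nlinarith

end Bounded

section Invertible

variable {x y : H →ₗ.[ℂ] H}

/-- Cauchy–Schwarz for the form of x at bξ and ξ, with x(bξ) = ξ, gives ‖ξ‖⁴ ≤ ⟨ξ, bξ⟩⟨xξ, ξ⟩ ≤ ‖b‖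
‖ξ‖² ⟨xξ, ξ⟩. Adding 1 to ‖b‖ keeps the constant positive. -/
theorem form_bounded_below (hx : IsSelfAdjoint x) (hx0 : OpLE 0 x) (hinv : IsBoundedlyInvertible x) :
    ∃ ε : ℝ, 0 < ε ∧ ∀ ξ : x.domain, ε * ‖(ξ : H)‖ ^ 2 ≤ (inner ℂ (x ξ) (ξ : H) : ℂ).re := by
  obtain ⟨b, hb, -⟩ := hinv
  refine ⟨(‖b‖ + 1)⁻¹, by positivity, fun ξ => ?_⟩
  obtain ⟨h, e⟩ := hb ξ
  have h1 := re_inner_sq_le hx hx0 ⟨_, h⟩ ξ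
  rw [e, re_inner_self] at h1
  have h2 := (Complex.re_le_norm _).trans (norm_inner_le_norm (𝕜 := ℂ) (ξ : H) (b ξ))
  have h3 := b.le_opNorm ξ
  have h4 := form_nonneg_of_opLE hx0 ξ
  rw [inv_mul_le_iff₀ (by positivity)]
  set F := (inner ℂ (x ξ) (ξ : H) : ℂ).re
  have h5 : (‖(ξ : H)‖ ^ 2) ^ 2 ≤ ‖b‖ * ‖(ξ : H)‖ ^ 2 * F := by
    refine h1.trans (mul_le_mul_of_nonneg_right ?_ h4)
    refine h2.trans ?_
    nlinarith [norm_nonneg (ξ : H)]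
  rcases (sq_nonneg ‖(ξ : H)‖).eq_or_lt with h0 | h0
  · rw [← h0]; positivity
  · nlinarith

theorem isBoundedlyInvertible_of_norm_le (hx : IsSelfAdjoint x) {c : ℝ} (hc : 0 < c)
    (h : ∀ ξ : x.domain, c * ‖(ξ : H)‖ ≤ ‖x ξ‖) : IsBoundedlyInvertible x := by
  obtain ⟨b, h1, h2⟩ := exists_bounded_inverse hx 0 hc (by simpa using h)
  simp only [Complex.ofReal_zero, zero_smul, add_zero] at h1 h2
  exact ⟨b, h1, h2⟩

theorem isBoundedlyInvertible_of_form (hx : IsSelfAdjoint x) {c : ℝ} (hc : 0 < c)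
    (h : ∀ ξ : x.domain, c * ‖(ξ : H)‖ ^ 2 ≤ (inner ℂ (x ξ) (ξ : H) : ℂ).re) :
    IsBoundedlyInvertible x := by
  refine isBoundedlyInvertible_of_norm_le hx hc fun ξ => ?_
  have h1 := (h ξ).trans ((Complex.re_le_norm _).trans (norm_inner_le_norm (x ξ) (ξ : H)))
  rcases (norm_nonneg (ξ : H)).eq_or_lt with h0 | h0
  · rw [← h0, mul_zero]; exact norm_nonneg _
  · nlinarith

variable {M : VonNeumannAlgebra H} {τ : M.toStarSubalgebra →ₗ[ℂ] ℂ}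

/-- On dom x ∩ dom y the form of y is at least c = sε. If y had spectrum below c/2, the
corresponding spectral projection would be a nonzero projection of M with range in dom y. That range
meets dom x, the dense range of (1 + x)⁻¹, in a nonzero vector, where the two estimates contradict
each other. -/
theorem isBoundedlyInvertible_of_opLE (hτ : IsFaithfulNormalTracialState M τ)
    (hx : x ∈ posAffiliated M) (hy : y ∈ posAffiliated M) {s : ℝ} (hs : 0 < s)
    (h : OpLE ((s : ℂ) • x) y) (hinv : IsBoundedlyInvertible x) : IsBoundedlyInvertible y := by
  obtain ⟨ε, hε, hεx⟩ := form_bounded_below hx.1 hx.2.2 hinv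
  rw [opLE_smul_iff] at h
  have hc : 0 < s * ε := mul_pos hs hε
  set c := s * ε with hcdef
  have hxy : ∀ (ξ : H) (_ : ξ ∈ x.domain) (h2 : ξ ∈ y.domain),
      c * ‖ξ‖ ^ 2 ≤ (inner ℂ (y ⟨ξ, h2⟩) ξ : ℂ).re := fun ξ h1 h2 => by
    refine le_trans ?_ (h ξ h2 h1)
    rw [hcdef, mul_assoc]
    exact mul_le_mul_of_nonneg_left (hεx ⟨ξ, h1⟩) hs.le
  obtain ⟨r, hr0, hr1, hrx, hrx'⟩ := exists_resolvent hx
  obtain ⟨R, hR0, hR1, hRy, hRy'⟩ := exists_resolvent hy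
  have hRsa : IsSelfAdjoint (R : H →L[ℂ] H) := IsSelfAdjoint.of_nonneg hR0
  -- With R = (1 + y)⁻¹, the condition R > κ is the condition y < c/2.
  set κ : ℝ := (1 + c / 2)⁻¹ with hκdef
  have hκ : 0 < κ := by positivity
  have hκ1 : κ ≤ 1 := inv_le_one_of_one_le₀ (by linarith)
  have hκinv : κ⁻¹ = 1 + c / 2 := inv_inv _
  have hdense : DenseRange (r : H →L[ℂ] H) := by
    refine hx.1.dense_domain.mono fun ξ hξ => ?_
    exact ⟨x ⟨ξ, hξ⟩ + ξ, hrx' ⟨ξ, hξ⟩⟩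
  have hcut : cfc (cut κ) (R : H →L[ℂ] H) = 0 := by
    by_contra hne
    have hp0 : suppIn (cfcIn (cut κ) R) ≠ 0 := fun h0 =>
      hne (supp_eq_zero_iff.1 (congrArg Subtype.val h0))
    obtain ⟨η, hη0, hη⟩ := hτ.exists_mem_range_inf (isStarProjection_supp _) hp0 hr0 hr1 hdense
    obtain ⟨hξx, -⟩ := hrx η
    set ξ := (r : H →L[ℂ] H) η
    obtain ⟨ζ, hζ, hζle⟩ := exists_preimage_of_supp_cut hRsa hκ hη
    obtain ⟨hξy, hy2⟩ := hRy ζ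
    have h1 := hxy _ (by rw [hζ]; exact hξx) hξy
    rw [hy2, hζ, inner_sub_left, Complex.sub_re, re_inner_self] at h1
    rw [hκinv] at hζle
    have : 0 < ‖ξ‖ ^ 2 := by have := norm_pos_iff.2 hη0; positivity
    nlinarith
  refine isBoundedlyInvertible_of_form hy.1 (half_pos hc) fun ξ => ?_
  -- R² ≤ κR applied to (1 + y)ξ reads ‖ξ‖² ≤ κ(⟨yξ, ξ⟩ + ‖ξ‖²), that is, y ≥ c/2.
  have h1 := sq_le_of_cfc_cut_eq_zero hR0 hR1 hκ hκ1 hcut (y ξ + ξ)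
  rw [hRy' ξ, ← inner_conj_symm, Complex.conj_re, inner_add_left, Complex.add_re,
    re_inner_self] at h1
  rw [← inv_mul_le_iff₀ hκ, hκinv] at h1
  linarith

end Invertible

end Comparison

/-! ### The partition into four pieces, estimates on m and d, and bounded states. -/

section Pieces

section Separation

variable {M : VonNeumannAlgebra H} {τ : M.toStarSubalgebra →ₗ[ℂ] ℂ} {x y : H →ₗ.[ℂ] H}

theorem isBoundedOp_of_d_lt_one (hx : x ∈ posAffiliated M) (hy : y ∈ posAffiliated M)
    (h : d x y < 1) (hb : IsBoundedOp x) : IsBoundedOp y := by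
  obtain ⟨t, ht, hle⟩ := exists_opLE_of_d_lt_one hx.2.2 hy.2.2 h
  exact isBoundedOp_of_opLE hx.1 hy.1 hy.2.2 ht hle hb

theorem isBoundedlyInvertible_of_d_lt_one (hτ : IsFaithfulNormalTracialState M τ)
    (hx : x ∈ posAffiliated M) (hy : y ∈ posAffiliated M)
    (h : d x y < 1) (hb : IsBoundedlyInvertible x) : IsBoundedlyInvertible y := by
  rw [d_comm] at h
  obtain ⟨t, ht, hle⟩ := exists_opLE_of_d_lt_one hy.2.2 hx.2.2 h
  exact isBoundedlyInvertible_of_opLE hτ hx hy ht hle hb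

theorem piece_subset_S (i : Fin 4) : piece M τ i ⊆ S M τ := by
  intro x hx
  fin_cases i
  exacts [hx.1.1, hx.1.1, hx.1.1, hx.1.1]

theorem iUnion_piece : (⋃ i, piece M τ i) = S M τ := by
  refine Set.Subset.antisymm (Set.iUnion_subset piece_subset_S) fun x hx => ?_
  rw [Set.mem_iUnion]
  by_cases h1 : IsBoundedlyInvertible x <;> by_cases h2 : x ∈ algebraSet M
  · exact ⟨0, ⟨hx, h1⟩, h2⟩
  · exact ⟨1, ⟨hx, h1⟩, h2⟩
  · exact ⟨2, ⟨hx, fun h => h1 h.2⟩, h2⟩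
  · exact ⟨3, ⟨hx, fun h => h1 h.2⟩, h2⟩

theorem disjoint_piece {i j : Fin 4} (hij : i ≠ j) : Disjoint (piece M τ i) (piece M τ j) := by
  rw [Set.disjoint_left]
  intro x hi hj
  fin_cases i <;> fin_cases j <;>
    simp only [piece, SbInv, SuInv, SbSing, SuSing, Ssing, Set.mem_inter_iff, Set.mem_sdiff,
      Matrix.cons_val, Fin.zero_eta, Fin.mk_one, Fin.reduceFinMk, ne_eq] at hi hj hij <;> tauto

theorem mem_piece_of_d_lt_one (hτ : IsFaithfulNormalTracialState M τ) {i : Fin 4}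
    (hx : x ∈ piece M τ i) (hy : y ∈ S M τ) (h : d x y < 1) : y ∈ piece M τ i := by
  have hxS := piece_subset_S i hx
  have hxp := hxS.1.1
  have hyp := hy.1.1
  have h' : d y x < 1 := by rwa [d_comm]
  have hb : x ∈ algebraSet M ↔ y ∈ algebraSet M := by
    rw [← isBoundedOp_iff_mem_algebraSet hxp, ← isBoundedOp_iff_mem_algebraSet hyp]
    exact ⟨isBoundedOp_of_d_lt_one hxp hyp h, isBoundedOp_of_d_lt_one hyp hxp h'⟩
  have hi : x ∈ Sinv M τ ↔ y ∈ Sinv M τ :=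
    ⟨fun hs => ⟨hy, isBoundedlyInvertible_of_d_lt_one hτ hxp hyp h hs.2⟩,
      fun hs => ⟨hxS, isBoundedlyInvertible_of_d_lt_one hτ hyp hxp h' hs.2⟩⟩
  fin_cases i
  · exact ⟨hi.1 hx.1, hb.1 hx.2⟩
  · exact ⟨hi.1 hx.1, fun hn => hx.2 (hb.2 hn)⟩
  · exact ⟨⟨hy, fun hn => hx.1.2 (hi.2 hn)⟩, hb.1 hx.2⟩
  · exact ⟨⟨hy, fun hn => hx.1.2 (hi.2 hn)⟩, fun hn => hx.2 (hb.2 hn)⟩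

theorem d_eq_one_of_mem_piece (hτ : IsFaithfulNormalTracialState M τ) {i j : Fin 4} (hij : i ≠ j)
    (hx : x ∈ piece M τ i) (hy : y ∈ piece M τ j) : d x y = 1 := by
  have hxS := piece_subset_S i hx
  have hyS := piece_subset_S j hy
  refine le_antisymm (d_le_one hxS.1.1.2.2 hyS.1.1.2.2) (not_lt.1 fun h => ?_)
  exact Set.disjoint_left.1 (disjoint_piece hij) (mem_piece_of_d_lt_one hτ hx hyS h) hy

/-- The open unit ball around a point stays in the piece of that point; by symmetry of d the same
radius works for the complement. -/
theorem isClopen_piece (hτ : IsFaithfulNormalTracialState M τ) (i : Fin 4) :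
    @IsClopen _ (hennionTopology M τ) ((↑) ⁻¹' piece M τ i : Set (S M τ)) := by
  let _ := hennionTopology M τ
  constructor
  · refine ⟨fun x hx => ⟨1, one_pos, fun y hy hyi => hx ?_⟩⟩
    exact mem_piece_of_d_lt_one hτ hyi x.2 (by rwa [d_comm])
  · exact fun x hx => ⟨1, one_pos, fun y hy => mem_piece_of_d_lt_one hτ hx y.2 hy⟩

end Separation

section Estimates

variable {x y : H →ₗ.[ℂ] H}

theorem m_mul_form_le (hx : OpLE 0 x) (hy : OpLE 0 y) {ξ : H} (h1 : ξ ∈ x.domain)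
    (h2 : ξ ∈ y.domain) :
    m x y * (inner ℂ (y ⟨ξ, h2⟩) ξ : ℂ).re ≤ (inner ℂ (x ⟨ξ, h1⟩) ξ : ℂ).re := by
  have hx1 := form_nonneg_of_opLE hx ⟨ξ, h1⟩
  rcases (form_nonneg_of_opLE hy ⟨ξ, h2⟩).eq_or_lt with h0 | h0
  · change 0 = (inner ℂ (y ⟨ξ, h2⟩) ξ : ℂ).re at h0
    rw [← h0, mul_zero]; exact hx1
  · rw [← le_div_iff₀ h0]
    refine Real.sSup_le (fun t ht => ?_) (div_nonneg hx1 h0.le)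
    rw [le_div_iff₀ h0]
    exact opLE_smul_iff.1 ht ξ h1 h2

/-- The vector ξ makes the set of admissible t bounded above, so that the supremum is not the
default value 0. -/
theorem le_m {t : ℝ} (ht : OpLE ((t : ℂ) • y) x) {ξ : H} (h1 : ξ ∈ x.domain)
    (h2 : ξ ∈ y.domain) (h0 : 0 < (inner ℂ (y ⟨ξ, h2⟩) ξ : ℂ).re) : t ≤ m x y := by
  refine le_csSup ⟨(inner ℂ (x ⟨ξ, h1⟩) ξ : ℂ).re / (inner ℂ (y ⟨ξ, h2⟩) ξ : ℂ).re, ?_⟩ ht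
  intro s hs
  rw [le_div_iff₀ h0]
  exact opLE_smul_iff.1 hs ξ h1 h2

theorem one_sub_two_mul_le_d (hx : OpLE 0 x) (hy : OpLE 0 y) :
    1 - 2 * (m x y * m y x) ≤ d x y := by
  have h := mul_nonneg (m_nonneg (y := y) hx) (m_nonneg (y := x) hy)
  rw [d, le_div_iff₀ (by linarith)]
  nlinarith

theorem d_eq_one_of_m_eq_zero (h : m x y = 0) : d x y = 1 := by
  rw [d, h]; simp

theorem m_eq_zero_of_forall (hx : OpLE 0 x) (h : ∀ t : ℝ, 0 < t → ¬ OpLE ((t : ℂ) • y) x) :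
    m x y = 0 := by
  by_contra hne
  obtain ⟨t, ht, hle⟩ := exists_opLE_of_m_pos hx ((m_nonneg hx).lt_of_ne (Ne.symm hne))
  exact h t ht hle

end Estimates

section BoundedStates

variable {M : VonNeumannAlgebra H} {τ : M.toStarSubalgebra →ₗ[ℂ] ℂ}

theorem opLE_iff {x y : H →ₗ.[ℂ] H} : OpLE x y ↔
    ∀ (ξ : H) (hx : ξ ∈ x.domain) (hy : ξ ∈ y.domain),
      (inner ℂ (x ⟨ξ, hx⟩) ξ : ℂ).re ≤ (inner ℂ (y ⟨ξ, hy⟩) ξ : ℂ).re := by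
  have h := opLE_smul_iff (x := y) (y := x) (t := 1)
  rw [Complex.ofReal_one, one_smul] at h
  rw [h]
  simp only [one_mul]
  exact ⟨fun h ξ a b => h ξ b a, fun h ξ a b => h ξ b a⟩

theorem opLE_ofBounded_iff {a : H →L[ℂ] H} {x : H →ₗ.[ℂ] H} : OpLE (ofBounded a) x ↔
    ∀ ξ : x.domain, (inner ℂ (a ξ) (ξ : H) : ℂ).re ≤ (inner ℂ (x ξ) (ξ : H) : ℂ).re := by
  rw [opLE_iff]
  exact ⟨fun h ξ => h ξ trivial ξ.2, fun h ξ _ hξ => h ⟨ξ, hξ⟩⟩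

theorem ofBounded_mem_posAffiliated {a : M.toStarSubalgebra} (ha : (0 : H →L[ℂ] H) ≤ a) :
    ofBounded (a : H →L[ℂ] H) ∈ posAffiliated M := by
  refine ⟨?_, fun b hb ξ => ⟨trivial, ?_⟩, ?_⟩
  · rw [LinearPMap.isSelfAdjoint_def, ofBounded,
      ContinuousLinearMap.toPMap_adjoint_eq_adjoint_toPMap_of_dense _ (by simp),
      (IsSelfAdjoint.of_nonneg ha).adjoint_eq]
  · exact (DFunLike.congr_fun (VonNeumannAlgebra.mem_commutant_iff.1 hb _ a.2) (ξ : H))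
  · rw [opLE_iff]
    intro ξ _ _
    change (inner ℂ (0 : H) ξ : ℂ).re ≤ (inner ℂ ((a : H →L[ℂ] H) ξ) ξ : ℂ).re
    rw [inner_zero_left]
    exact form_nonneg ha ξ

theorem trace_ofBounded (hτ : IsFaithfulNormalTracialState M τ) {a : M.toStarSubalgebra}
    (ha : (0 : H →L[ℂ] H) ≤ a) :
    trace M τ (ofBounded (a : H →L[ℂ] H)) = ENNReal.ofReal (τ a).re := by
  refine le_antisymm (iSup₂_le fun b hb => iSup_le fun hba => ?_) ?_
  · refine ENNReal.ofReal_le_ofReal (hτ.re_mono ?_)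
    refine le_of_form (IsSelfAdjoint.of_nonneg hb) (IsSelfAdjoint.of_nonneg ha) fun ξ => ?_
    exact opLE_ofBounded_iff.1 hba ⟨ξ, trivial⟩
  · refine le_iSup₂_of_le a ha (le_iSup_of_le ?_ le_rfl)
    exact opLE_ofBounded_iff.2 fun ξ => le_rfl

theorem ofBounded_mem_S (hτ : IsFaithfulNormalTracialState M τ) {a : M.toStarSubalgebra}
    (ha : (0 : H →L[ℂ] H) ≤ a) (h1 : (τ a).re = 1) : ofBounded (a : H →L[ℂ] H) ∈ S M τ := by
  have h := trace_ofBounded hτ ha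
  rw [h1, ENNReal.ofReal_one] at h
  exact ⟨⟨ofBounded_mem_posAffiliated ha, h ▸ ENNReal.one_lt_top⟩, h⟩

/-- The state with density proportional to `a`. -/
def density (τ : M.toStarSubalgebra →ₗ[ℂ] ℂ) (a : M.toStarSubalgebra) : H →ₗ.[ℂ] H :=
  ofBounded ((((τ a).re⁻¹ : ℝ) : ℂ) • (a : H →L[ℂ] H))

theorem density_form (a : M.toStarSubalgebra) (ξ : (density τ a).domain) :
    (inner ℂ (density τ a ξ) (ξ : H) : ℂ).re
      = (τ a).re⁻¹ * (inner ℂ ((a : H →L[ℂ] H) ξ) (ξ : H) : ℂ).re :=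
  form_ofReal_smul _ _ _

theorem density_mem_S (hτ : IsFaithfulNormalTracialState M τ) {a : M.toStarSubalgebra}
    (ha : (0 : H →L[ℂ] H) ≤ a) (hne : a ≠ 0) : density τ a ∈ S M τ := by
  have hpos := hτ.re_pos ha hne
  refine ofBounded_mem_S hτ (a := (((τ a).re⁻¹ : ℝ) : ℂ) • a) ?_ ?_
  · exact ofReal_smul_nonneg (inv_nonneg.2 hpos.le) ha
  · rw [map_smul, smul_eq_mul, Complex.re_ofReal_mul, inv_mul_cancel₀ hpos.ne']

theorem density_mem_SbInv (hτ : IsFaithfulNormalTracialState M τ) {a : M.toStarSubalgebra}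
    (ha : IsSelfAdjoint (a : H →L[ℂ] H)) {c : ℝ} (hc : 0 < c)
    (h : ∀ ξ : H, c * ‖ξ‖ ^ 2 ≤ (inner ℂ ((a : H →L[ℂ] H) ξ) ξ : ℂ).re) :
    density τ a ∈ SbInv M τ := by
  have ha0 : (0 : H →L[ℂ] H) ≤ a := nonneg_of_form ha fun ξ => le_trans (by positivity) (h ξ)
  have hne : a ≠ 0 := by
    rintro rfl
    refine hτ.one_ne_zero (Subtype.ext ?_)
    ext ξ
    have := h ξ
    simp only [ZeroMemClass.coe_zero, zero_apply, inner_zero_left, Complex.zero_re] at this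
    have h2 : ‖ξ‖ ^ 2 ≤ 0 := by nlinarith [sq_nonneg ‖ξ‖]
    exact norm_eq_zero.1 (pow_eq_zero_iff two_ne_zero |>.1 (le_antisymm h2 (sq_nonneg _)))
  have hpos := hτ.re_pos ha0 hne
  have hS := density_mem_S hτ ha0 hne
  refine ⟨⟨hS, isBoundedlyInvertible_of_form hS.1.1.1 (c := (τ a).re⁻¹ * c) (by positivity)
    fun ξ => ?_⟩, ?_⟩
  · rw [density_form, mul_assoc]
    exact mul_le_mul_of_nonneg_left (h ξ) (by positivity)
  · exact ⟨_, ((((τ a).re⁻¹ : ℝ) : ℂ) • a).2, rfl⟩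

theorem not_isBoundedlyInvertible_of_apply_eq_zero {x : H →ₗ.[ℂ] H} (ξ : x.domain)
    (h0 : (ξ : H) ≠ 0) (h : x ξ = 0) : ¬ IsBoundedlyInvertible x := by
  rintro ⟨b, -, hb⟩
  exact h0 (by rw [← hb ξ, h, map_zero])

theorem density_mem_SbSing (hτ : IsFaithfulNormalTracialState M τ) {a : M.toStarSubalgebra}
    (ha : (0 : H →L[ℂ] H) ≤ a) (hne : a ≠ 0) {ξ : H} (hξ : ξ ≠ 0) (h : (a : H →L[ℂ] H) ξ = 0) :
    density τ a ∈ SbSing M τ := by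
  refine ⟨⟨density_mem_S hτ ha hne, fun hinv => ?_⟩, ⟨_, ((((τ a).re⁻¹ : ℝ) : ℂ) • a).2, rfl⟩⟩
  refine not_isBoundedlyInvertible_of_apply_eq_zero (x := density τ a) ⟨ξ, trivial⟩ hξ ?_ hinv.2
  change (((τ a).re⁻¹ : ℝ) : ℂ) • (a : H →L[ℂ] H) ξ = 0
  rw [h, smul_zero]

/-- If x ≥ ε and y is given by b, then ε/(‖b‖ + 1) · y ≤ ε ≤ x, and symmetrically. -/
theorem d_lt_one_of_mem_SbInv (hτ : IsFaithfulNormalTracialState M τ) {x y : H →ₗ.[ℂ] H}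
    (hx : x ∈ SbInv M τ) (hy : y ∈ SbInv M τ) : d x y < 1 := by
  have key : ∀ x ∈ SbInv M τ, ∀ y ∈ SbInv M τ, 0 < m x y := by
    intro x hx y hy
    have hxp := hx.1.1.1.1
    have hyp := hy.1.1.1.1
    obtain ⟨ε, hε, hεx⟩ := form_bounded_below hxp.1 hxp.2.2 hx.1.2
    obtain ⟨δ, hδ, hδy⟩ := form_bounded_below hyp.1 hyp.2.2 hy.1.2
    obtain ⟨a, -, rfl⟩ := hx.2
    obtain ⟨b, -, rfl⟩ := hy.2
    obtain ⟨ξ, hξ⟩ : ∃ ξ : H, ξ ≠ 0 := by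
      by_contra! h
      exact hτ.one_ne_zero (Subtype.ext (ContinuousLinearMap.ext fun ξ => (h _).trans (h _).symm))
    have hpos : 0 < (inner ℂ (ofBounded b ⟨ξ, trivial⟩) ξ : ℂ).re := by
      refine lt_of_lt_of_le ?_ (hδy ⟨ξ, trivial⟩)
      have := norm_pos_iff.2 hξ
      positivity
    refine lt_of_lt_of_le (show 0 < ε / (‖b‖ + 1) by positivity)
      (le_m (opLE_smul_iff.2 fun ζ h1 h2 => ?_) trivial trivial hpos)
    refine le_trans ?_ (hεx ⟨ζ, h1⟩)
    have h3 : (inner ℂ (ofBounded b ⟨ζ, h2⟩) ζ : ℂ).re ≤ ‖b‖ * ‖ζ‖ ^ 2 := form_le_norm b ζ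
    rw [div_mul_eq_mul_div, div_le_iff₀ (by positivity), mul_assoc]
    refine mul_le_mul_of_nonneg_left ?_ hε.le
    nlinarith [sq_nonneg ‖ζ‖]
  exact (d_lt_one_iff hx.1.1.1.1.2.2 hy.1.1.1.1.2.2).2 (mul_pos (key x hx y hy) (key y hy x hx))

end BoundedStates

end Pieces

/-! ### Nontrivial projections and the diameters of the bounded pieces. -/

section Diameter

variable {M : VonNeumannAlgebra H} {τ : M.toStarSubalgebra →ₗ[ℂ] ℂ}

/-- The functions f and g are the positive parts on the two sides of the midpoint. Both f(a) and
g(a) are nonzero, and g(a)f(a) = 0, so g(a) kills the support of f(a), which therefore is neither 0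
nor 1. -/
theorem exists_projection_of_two_mem_spectrum {a : M.toStarSubalgebra}
    (ha : IsSelfAdjoint (a : H →L[ℂ] H)) {s t : ℝ} (hst : s < t)
    (hs : s ∈ spectrum ℝ (a : H →L[ℂ] H)) (ht : t ∈ spectrum ℝ (a : H →L[ℂ] H)) :
    ∃ p : M.toStarSubalgebra, IsStarProjection (p : H →L[ℂ] H) ∧ p ≠ 0 ∧ p ≠ 1 := by
  set f : ℝ → ℝ := fun u => max (u - (s + t) / 2) 0 with hf
  set g : ℝ → ℝ := fun u => max ((s + t) / 2 - u) 0 with hg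
  have hfc : Continuous f := by fun_prop
  have hgc : Continuous g := by fun_prop
  have hne : ∀ h : ℝ → ℝ, Continuous h → ∀ u ∈ spectrum ℝ (a : H →L[ℂ] H), h u ≠ 0 →
      cfc h (a : H →L[ℂ] H) ≠ 0 := by
    intro h hc u hu hhu h0
    rw [← cfc_const_zero ℝ (a : H →L[ℂ] H)] at h0
    exact hhu ((cfc_eq_cfc_iff_eqOn (R := ℝ) ha hc.continuousOn).1 h0 hu)
  have hf0 : cfc f (a : H →L[ℂ] H) ≠ 0 := hne f hfc t ht (by
    rw [hf]; exact (lt_max_of_lt_left (by linarith)).ne')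
  have hg0 : cfc g (a : H →L[ℂ] H) ≠ 0 := hne g hgc s hs (by
    rw [hg]; exact (lt_max_of_lt_left (by linarith)).ne')
  have hgf : cfc g (a : H →L[ℂ] H) * cfc f (a : H →L[ℂ] H) = 0 * cfc f (a : H →L[ℂ] H) := by
    rw [zero_mul, ← cfc_mul g f _ hgc.continuousOn hfc.continuousOn,
      ← cfc_const_zero ℝ (a : H →L[ℂ] H)]
    refine cfc_congr fun u _ => ?_
    rcases le_total u ((s + t) / 2) with h | h
    · simp [hf, max_eq_right (sub_nonpos.2 h)]
    · simp [hg, max_eq_right (sub_nonpos.2 h)]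
  refine ⟨suppIn (cfcIn f a), isStarProjection_supp _, fun h => ?_, fun h => ?_⟩
  · exact hf0 (supp_eq_zero_iff.1 (congrArg Subtype.val h))
  · refine hg0 (ContinuousLinearMap.ext fun ξ => ?_)
    exact apply_supp_of_comp_eq hgf (DFunLike.congr_fun (congrArg Subtype.val h) ξ)

/-- Otherwise every self-adjoint element has at most one spectral value and is a scalar, and M is
spanned by its self-adjoint elements. -/
theorem exists_projection (hM : M.toStarSubalgebra ≠ ⊥) :
    ∃ p : M.toStarSubalgebra, IsStarProjection (p : H →L[ℂ] H) ∧ p ≠ 0 ∧ p ≠ 1 := by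
  by_contra hcon
  have hscalar : ∀ a : M.toStarSubalgebra, IsSelfAdjoint (a : H →L[ℂ] H) →
      (a : H →L[ℂ] H) ∈ (⊥ : StarSubalgebra ℂ (H →L[ℂ] H)) := by
    intro a ha
    have hsub : (spectrum ℝ (a : H →L[ℂ] H)).Subsingleton := by
      intro s hs t ht
      rcases lt_trichotomy s t with h | h | h
      · exact (hcon (exists_projection_of_two_mem_spectrum ha h hs ht)).elim
      · exact h
      · exact (hcon (exists_projection_of_two_mem_spectrum ha h ht hs)).elim
    obtain ⟨c, hc⟩ : ∃ c : ℝ, ∀ u ∈ spectrum ℝ (a : H →L[ℂ] H), u = c := by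
      rcases hsub.eq_empty_or_singleton with h | ⟨c, h⟩
      · exact ⟨0, by simp [h]⟩
      · exact ⟨c, by simp [h]⟩
    have : (a : H →L[ℂ] H) = algebraMap ℝ (H →L[ℂ] H) c := by
      rw [← cfc_const c (a : H →L[ℂ] H)]
      conv_lhs => rw [← cfc_id' ℝ (a : H →L[ℂ] H)]
      exact cfc_congr hc
    rw [this, StarSubalgebra.mem_bot]
    exact ⟨(c : ℂ), rfl⟩
  refine hM (eq_bot_iff.2 fun b hb => ?_)
  have hre : (realPart b : H →L[ℂ] H) ∈ M.toStarSubalgebra := by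
    rw [realPart_apply_coe]
    exact SMulMemClass.smul_mem ((2⁻¹ : ℝ) : ℂ) (add_mem hb (star_mem hb))
  have him : (imaginaryPart b : H →L[ℂ] H) ∈ M.toStarSubalgebra := by
    rw [imaginaryPart_apply_coe]
    exact SMulMemClass.smul_mem (-Complex.I)
      (SMulMemClass.smul_mem ((2⁻¹ : ℝ) : ℂ) (sub_mem hb (star_mem hb)))
  rw [← realPart_add_I_smul_imaginaryPart b]
  exact add_mem (hscalar ⟨_, hre⟩ (realPart b).2)
    (SMulMemClass.smul_mem _ (hscalar ⟨_, him⟩ (imaginaryPart b).2))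

theorem exists_apply_eq_self {p : H →L[ℂ] H} (hp : IsStarProjection p) (h : p ≠ 0) :
    ∃ ξ : H, ξ ≠ 0 ∧ p ξ = ξ := by
  by_contra! hcon
  refine h (ContinuousLinearMap.ext fun ξ => ?_)
  by_contra hne
  exact hcon (p ξ) hne (DFunLike.congr_fun hp.isIdempotentElem.eq ξ)

theorem isGreatest_distances {A : Set (H →ₗ.[ℂ] H)} (hA : A ⊆ S M τ) {x y : H →ₗ.[ℂ] H}
    (hx : x ∈ A) (hy : y ∈ A) (h : m x y = 0) : IsGreatest (distances A) 1 := by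
  refine ⟨⟨x, hx, y, hy, (d_eq_one_of_m_eq_zero h).symm⟩, ?_⟩
  rintro _ ⟨x, hx, y, hy, rfl⟩
  exact d_le_one (hA hx).1.1.2.2 (hA hy).1.1.2.2

/-- The product of the two m's is bounded by a cross-ratio of forms at two vectors, in which the
normalising constants of x and y cancel. -/
theorem m_mul_m_le {x y : H →ₗ.[ℂ] H} (hx : OpLE 0 x) (hy : OpLE 0 y) {ξ ζ : H}
    (h1 : ξ ∈ x.domain) (h2 : ξ ∈ y.domain) (h3 : ζ ∈ x.domain) (h4 : ζ ∈ y.domain) :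
    m x y * m y x * ((inner ℂ (y ⟨ξ, h2⟩) ξ : ℂ).re * (inner ℂ (x ⟨ζ, h3⟩) ζ : ℂ).re)
      ≤ (inner ℂ (x ⟨ξ, h1⟩) ξ : ℂ).re * (inner ℂ (y ⟨ζ, h4⟩) ζ : ℂ).re := by
  have e1 := m_mul_form_le hx hy h1 h2
  have e2 := m_mul_form_le hy hx h4 h3
  have := mul_le_mul e1 e2 (mul_nonneg (m_nonneg hy) (form_nonneg_of_opLE hx ⟨ζ, h3⟩))
    (form_nonneg_of_opLE hx ⟨ξ, h1⟩)
  refine le_trans (le_of_eq ?_) this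
  ring

/-- For the normalisations x of p and y of 1 - p, a vector in the range of 1 - p has zero x-form and
positive y-form, which forces m(x,y) = 0. -/
theorem isGreatest_distances_SbSing (hτ : IsFaithfulNormalTracialState M τ)
    (hM : M.toStarSubalgebra ≠ ⊥) : IsGreatest (distances (SbSing M τ)) 1 := by
  obtain ⟨p, hp, hp0, hp1⟩ := exists_projection hM
  have hq : IsStarProjection ((1 - p : M.toStarSubalgebra) : H →L[ℂ] H) := hp.one_sub
  have hq0 : 1 - p ≠ 0 := fun h => hp1 (sub_eq_zero.1 h).symm
  obtain ⟨ξ, hξ, hpξ⟩ := exists_apply_eq_self hp fun h => hp0 (Subtype.ext h)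
  obtain ⟨ζ, hζ, hqζ⟩ := exists_apply_eq_self hq fun h => hq0 (Subtype.ext h)
  have hqξ : ((1 - p : M.toStarSubalgebra) : H →L[ℂ] H) ξ = 0 := by
    change ξ - (p : H →L[ℂ] H) ξ = 0
    rw [hpξ, sub_self]
  have hpζ : (p : H →L[ℂ] H) ζ = 0 := by
    change ζ - (p : H →L[ℂ] H) ζ = ζ at hqζ
    exact sub_eq_self.1 hqζ
  have hx := density_mem_SbSing hτ (projection_nonneg hp) hp0 hζ hpζ
  have hy := density_mem_SbSing hτ (projection_nonneg hq) hq0 hξ hqξ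
  refine isGreatest_distances (fun x hx => hx.1.1) hx hy ?_
  have hxp := hx.1.1.1.1.2.2
  have h := m_mul_form_le hxp hy.1.1.1.1.2.2 (ξ := ζ) trivial trivial
  rw [density_form _ ⟨ζ, trivial⟩, density_form _ ⟨ζ, trivial⟩] at h
  simp only [hpζ, hqζ, inner_zero_left, Complex.zero_re, mul_zero, re_inner_self] at h
  have hpos : 0 < (τ (1 - p)).re⁻¹ * ‖ζ‖ ^ 2 :=
    mul_pos (inv_pos.2 (hτ.re_pos (projection_nonneg hq) hq0)) (by
      have := norm_pos_iff.2 hζ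
      positivity)
  exact le_antisymm (by nlinarith) (m_nonneg hxp)

/-- The normalisations of p + ε(1 - p) and εp + (1 - p) have cross-ratio ε² at one vector from each
range, so their distance is at least 1 - 2ε² ≥ 1 - 2ε. -/
theorem isLUB_distances_SbInv (hτ : IsFaithfulNormalTracialState M τ)
    (hM : M.toStarSubalgebra ≠ ⊥) : IsLUB (distances (SbInv M τ)) 1 := by
  obtain ⟨p, hp, hp0, hp1⟩ := exists_projection hM
  have hq : IsStarProjection ((1 - p : M.toStarSubalgebra) : H →L[ℂ] H) := hp.one_sub
  have hq0 : 1 - p ≠ 0 := fun h => hp1 (sub_eq_zero.1 h).symm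
  obtain ⟨ξ, hξ, hpξ⟩ := exists_apply_eq_self hp fun h => hp0 (Subtype.ext h)
  obtain ⟨ζ, hζ, hqζ⟩ := exists_apply_eq_self hq fun h => hq0 (Subtype.ext h)
  have hqξ : ((1 - p : M.toStarSubalgebra) : H →L[ℂ] H) ξ = 0 := by
    change ξ - (p : H →L[ℂ] H) ξ = 0
    rw [hpξ, sub_self]
  have hpζ : (p : H →L[ℂ] H) ζ = 0 := by
    change ζ - (p : H →L[ℂ] H) ζ = ζ at hqζ
    exact sub_eq_self.1 hqζ
  have hsq : ∀ η : H, ‖(p : H →L[ℂ] H) η‖ ^ 2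
      + ‖((1 - p : M.toStarSubalgebra) : H →L[ℂ] H) η‖ ^ 2 = ‖η‖ ^ 2 := fun η => by
    rw [← form_projection hp, ← form_projection hq, ← re_inner_self, ← Complex.add_re,
      ← inner_add_left]
    congr 2
    change (p : H →L[ℂ] H) η + (η - (p : H →L[ℂ] H) η) = η
    abel
  constructor
  · rintro _ ⟨x, hx, y, hy, rfl⟩
    exact d_le_one hx.1.1.1.1.2.2 hy.1.1.1.1.2.2
  · intro B hB
    refine le_of_forall_pos_le_add fun δ hδ => ?_
    obtain ⟨ε, hε, hε1, hεδ⟩ : ∃ ε : ℝ, 0 < ε ∧ ε ≤ 1 ∧ 2 * ε ≤ δ :=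
      ⟨min 1 (δ / 2), lt_min one_pos (half_pos hδ), min_le_left _ _, by
        have := min_le_right 1 (δ / 2); linarith⟩
    have hform : ∀ (s t : ℝ) (η : H), (inner ℂ ((((s : ℂ) • p + (t : ℂ) • (1 - p) :
        M.toStarSubalgebra) : H →L[ℂ] H) η) η : ℂ).re = s * ‖(p : H →L[ℂ] H) η‖ ^ 2
          + t * ‖((1 - p : M.toStarSubalgebra) : H →L[ℂ] H) η‖ ^ 2 := by
      intro s t η
      rw [← form_projection hp, ← form_projection hq, ← form_ofReal_smul, ← form_ofReal_smul,
        ← Complex.add_re, ← inner_add_left]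
      rfl
    have hmem : ∀ s t : ℝ, ε ≤ s → ε ≤ t →
        density τ ((s : ℂ) • p + (t : ℂ) • (1 - p)) ∈ SbInv M τ := by
      intro s t hs ht
      refine density_mem_SbInv hτ ((isSelfAdjoint_ofReal_smul s hp.isSelfAdjoint).add
        (isSelfAdjoint_ofReal_smul t hq.isSelfAdjoint)) hε fun η => ?_
      rw [hform, ← hsq η, mul_add]
      exact add_le_add (mul_le_mul_of_nonneg_right hs (sq_nonneg _))
        (mul_le_mul_of_nonneg_right ht (sq_nonneg _))
    have hx := hmem 1 ε hε1 le_rfl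
    have hy := hmem ε 1 le_rfl hε1
    have hxp := hx.1.1.1.1.2.2
    have hyp := hy.1.1.1.1.2.2
    have hpr := m_mul_m_le hxp hyp (ξ := ζ) (ζ := ξ) trivial trivial trivial trivial
    rw [density_form _ ⟨ζ, trivial⟩, density_form _ ⟨ζ, trivial⟩, density_form _ ⟨ξ, trivial⟩,
      density_form _ ⟨ξ, trivial⟩] at hpr
    simp only [hform, hpξ, hqξ, hpζ, hqζ, norm_zero] at hpr
    have ha : ∀ s t : ℝ, ε ≤ s → ε ≤ t → 0 < (τ ((s : ℂ) • p + (t : ℂ) • (1 - p))).re := by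
      intro s t hs ht
      rw [map_add, map_smul, map_smul, Complex.add_re, smul_eq_mul, smul_eq_mul,
        Complex.re_ofReal_mul, Complex.re_ofReal_mul]
      exact add_pos (mul_pos (hε.trans_le hs) (hτ.re_pos (projection_nonneg hp) hp0))
        (mul_pos (hε.trans_le ht) (hτ.re_pos (projection_nonneg hq) hq0))
    have hα := inv_pos.2 (ha 1 ε hε1 le_rfl)
    have hβ := inv_pos.2 (ha ε 1 le_rfl hε1)
    have hd := one_sub_two_mul_le_d hxp hyp
    have hB' := hB ⟨_, hx, _, hy, rfl⟩
    set P := m (density τ (((1 : ℝ) : ℂ) • p + (ε : ℂ) • (1 - p)))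
      (density τ ((ε : ℂ) • p + ((1 : ℝ) : ℂ) • (1 - p)))
      * m (density τ ((ε : ℂ) • p + ((1 : ℝ) : ℂ) • (1 - p)))
      (density τ (((1 : ℝ) : ℂ) • p + (ε : ℂ) • (1 - p)))
    set α := (τ (((1 : ℝ) : ℂ) • p + (ε : ℂ) • (1 - p))).re⁻¹
    set β := (τ ((ε : ℂ) • p + ((1 : ℝ) : ℂ) • (1 - p))).re⁻¹
    have hK : 0 < α * β * (‖ζ‖ ^ 2 * ‖ξ‖ ^ 2) := by
      have := norm_pos_iff.2 hζ
      have := norm_pos_iff.2 hξ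
      positivity
    have hPε : P ≤ ε := by
      have : P * (α * β * (‖ζ‖ ^ 2 * ‖ξ‖ ^ 2)) ≤ ε ^ 2 * (α * β * (‖ζ‖ ^ 2 * ‖ξ‖ ^ 2)) := by
        linarith
      have := le_of_mul_le_mul_right this hK
      nlinarith
    linarith

end Diameter

/-! ### Minimal projections, infinite dimension and failure of total boundedness. -/

section NotTotallyBounded

section Projections

theorem mul_eq_of_projection_le {p q : H →L[ℂ] H} (hp : IsStarProjection p)
    (hq : IsStarProjection q) (h : q ≤ p) : q * p = q := by
  ext ξ
  have h1 := form_mono h (ξ - p ξ)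
  have h2 : p (ξ - p ξ) = 0 := by
    rw [map_sub, show p (p ξ) = p ξ from DFunLike.congr_fun hp.isIdempotentElem.eq ξ, sub_self]
  rw [form_projection hq, form_projection hp, h2, norm_zero] at h1
  have h3 : q (ξ - p ξ) = 0 :=
    norm_eq_zero.1 (pow_eq_zero_iff two_ne_zero |>.1 (le_antisymm (by simpa using h1) (sq_nonneg _)))
  rw [map_sub, sub_eq_zero] at h3
  exact h3.symm

theorem projection_sub {p q : H →L[ℂ] H} (hp : IsStarProjection p)
    (hq : IsStarProjection q) (h : q ≤ p) : IsStarProjection (p - q) := by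
  have h1 := mul_eq_of_projection_le hp hq h
  have h2 : p * q = q := by
    have := congrArg star h1
    rwa [star_mul, hp.isSelfAdjoint.star_eq, hq.isSelfAdjoint.star_eq] at this
  refine ⟨?_, hp.isSelfAdjoint.sub hq.isSelfAdjoint⟩
  change (p - q) * (p - q) = p - q
  rw [sub_mul, mul_sub, mul_sub, h1, h2, hp.isIdempotentElem.eq, hq.isIdempotentElem.eq]
  abel

end Projections

section FiniteDimension

variable {M : VonNeumannAlgebra H}

/-- A minimal nonzero projection. -/
structure IsMinimalProjection (p : M.toStarSubalgebra) : Prop where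
  isStarProjection : IsStarProjection (p : H →L[ℂ] H)
  ne_zero : p ≠ 0
  eq_of_le : ∀ q : M.toStarSubalgebra, IsStarProjection (q : H →L[ℂ] H) → q ≤ p → q ≠ 0 → q = p

theorem suppIn_le_of_mul_eq {p b : M.toStarSubalgebra} (hp : IsStarProjection (p : H →L[ℂ] H))
    (h : p * b = b) : suppIn b ≤ p := by
  refine projection_le_of_mul_eq (isStarProjection_supp _) hp ?_
  have h1 : (p : H →L[ℂ] H) * supp (b : H →L[ℂ] H) = supp (b : H →L[ℂ] H) := by
    ext ξ
    exact apply_supp_of_comp_eq (b := (p : H →L[ℂ] H)) (c := 1) (a := (b : H →L[ℂ] H))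
      ((congrArg Subtype.val h).trans (one_mul _).symm)
      (DFunLike.congr_fun (isStarProjection_supp (b : H →L[ℂ] H)).isIdempotentElem.eq ξ)
  have := congrArg star h1
  rwa [star_mul, hp.isSelfAdjoint.star_eq, (isStarProjection_supp _).isSelfAdjoint.star_eq] at this

/-- A continuous f vanishing near 0 is u · g(u) with g continuous, so f(b) = b g(b) inherits pb = b.
In g the two factors 1 / max(|u|, δ) stand for u⁻² off the interval where f vanishes. -/
theorem mul_cfcIn_of_mul_eq {p b : M.toStarSubalgebra} (hb : IsSelfAdjoint (b : H →L[ℂ] H))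
    (h : p * b = b) {f : ℝ → ℝ} (hf : Continuous f)
    {δ : ℝ} (hδ : 0 < δ) (hfδ : ∀ u, |u| ≤ δ → f u = 0) : p * cfcIn f b = cfcIn f b := by
  have hg : Continuous fun u : ℝ => f u * (max |u| δ)⁻¹ * (max |u| δ)⁻¹ * u := by
    have hc : Continuous fun u : ℝ => (max |u| δ)⁻¹ := Continuous.inv₀ (by fun_prop) fun u =>
      (hδ.trans_le (le_max_right _ _)).ne'
    exact ((hf.mul hc).mul hc).mul continuous_id
  have e : cfcIn f b = b * cfcIn (fun u : ℝ => f u * (max |u| δ)⁻¹ * (max |u| δ)⁻¹ * u) b := by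
    refine Subtype.ext ?_
    change cfc f (b : H →L[ℂ] H) = (b : H →L[ℂ] H) * cfc _ (b : H →L[ℂ] H)
    conv_rhs => enter [1]; rw [← cfc_id' ℝ (b : H →L[ℂ] H)]
    rw [← cfc_mul _ _ (b : H →L[ℂ] H) (continuousOn_id' _) hg.continuousOn]
    refine cfc_congr fun u _ => ?_
    rcases le_total |u| δ with hu | hu
    · simp [hfδ u hu]
    · have hu0 : |u| ≠ 0 := (hδ.trans_le hu).ne'
      simp only [max_eq_left hu]
      have : u * u = |u| * |u| := (abs_mul_abs_self u).symm
      field_simp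
      rw [sq_abs]
  rw [e, ← mul_assoc, h]

/-- The corner of a minimal projection is one dimensional. -/
theorem IsMinimalProjection.exists_eq_smul_of_isSelfAdjoint {p b : M.toStarSubalgebra}
    (hp : IsMinimalProjection p) (hb : IsSelfAdjoint (b : H →L[ℂ] H)) (h : p * b = b) :
    ∃ c : ℂ, b = c • p := by
  by_cases hb0 : b = 0
  · exact ⟨0, by rw [hb0, zero_smul]⟩
  have hsupp : suppIn b = p := hp.eq_of_le _ (isStarProjection_supp _)
    (suppIn_le_of_mul_eq hp.isStarProjection h) fun h0 =>
      hb0 (Subtype.ext (supp_eq_zero_iff.1 (congrArg Subtype.val h0)))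
  have hsub : ∀ s ∈ spectrum ℝ (b : H →L[ℂ] H), ∀ t ∈ spectrum ℝ (b : H →L[ℂ] H),
      s ≠ 0 → t ≠ 0 → s = t := by
    intro s hs t ht hs0 ht0
    by_contra hst
    -- Bumps of radius δ at s and t avoid a neighbourhood of 0, so their values at b lie in the
    -- corner and by minimality both have support p. The bumps do not overlap, so the product of
    -- these values is zero, contradicting p ≠ 0.
    obtain ⟨δ, hδ, hδs, hδt, hδst⟩ : ∃ δ : ℝ, 0 < δ ∧ 2 * δ ≤ |s| ∧ 2 * δ ≤ |t| ∧
        2 * δ ≤ |s - t| := by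
      have h1 := abs_pos.2 hs0
      have h2 := abs_pos.2 ht0
      have h3 := abs_pos.2 (sub_ne_zero.2 hst)
      refine ⟨min (min |s| |t|) |s - t| / 2, by positivity, ?_, ?_, ?_⟩
      · have := (min_le_left (min |s| |t|) |s - t|).trans (min_le_left _ _); linarith
      · have := (min_le_left (min |s| |t|) |s - t|).trans (min_le_right _ _); linarith
      · have := min_le_right (min |s| |t|) |s - t|; linarith
    have key : ∀ v ∈ spectrum ℝ (b : H →L[ℂ] H), 2 * δ ≤ |v| →
        suppIn (cfcIn (fun u => max (δ - |u - v|) 0) b) = p := by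
      intro v hv hvδ
      have hc : Continuous fun u : ℝ => max (δ - |u - v|) 0 := by fun_prop
      have hz : ∀ u : ℝ, |u| ≤ δ → max (δ - |u - v|) 0 = 0 := fun u hu => by
        have := abs_sub_abs_le_abs_sub v u
        rw [abs_sub_comm] at this
        exact max_eq_right (by linarith)
      refine hp.eq_of_le _ (isStarProjection_supp _)
        (suppIn_le_of_mul_eq hp.isStarProjection
          (mul_cfcIn_of_mul_eq hb h hc hδ hz)) fun h0 => ?_
      have h1 : cfc (fun u => max (δ - |u - v|) 0) (b : H →L[ℂ] H) = 0 :=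
        supp_eq_zero_iff.1 (congrArg Subtype.val h0)
      rw [← cfc_const_zero ℝ (b : H →L[ℂ] H)] at h1
      have h2 := (cfc_eq_cfc_iff_eqOn (R := ℝ) hb hc.continuousOn).1 h1 hv
      simp only [sub_self, abs_zero, sub_zero, max_eq_left hδ.le] at h2
      exact hδ.ne' h2
    have hs1 := key s hs hδs
    have ht1 := key t ht hδt
    have hz : cfc (fun u => max (δ - |u - s|) 0) (b : H →L[ℂ] H)
        * cfc (fun u => max (δ - |u - t|) 0) (b : H →L[ℂ] H)
        = 0 * cfc (fun u => max (δ - |u - t|) 0) (b : H →L[ℂ] H) := by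
      rw [zero_mul, ← cfc_mul _ _ (b : H →L[ℂ] H), ← cfc_const_zero ℝ (b : H →L[ℂ] H)]
      refine cfc_congr fun u _ => ?_
      have h3 := abs_sub_le s u t
      rw [abs_sub_comm s u] at h3
      rcases le_total δ |u - s| with h4 | h4
      · simp [max_eq_right (sub_nonpos.2 h4)]
      · have : δ ≤ |u - t| := by linarith
        simp [max_eq_right (sub_nonpos.2 this)]
    obtain ⟨ξ, hξ, hpξ⟩ := exists_apply_eq_self hp.isStarProjection fun h0 =>
      hp.ne_zero (Subtype.ext h0)
    have h5 := apply_supp_of_comp_eq hz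
      ((DFunLike.congr_fun (congrArg Subtype.val ht1) ξ).trans hpξ)
    have h6 := (supp_apply_eq_zero_iff (cfc_predicate _ _)).2 h5
    exact hξ (hpξ.symm.trans ((DFunLike.congr_fun (congrArg Subtype.val hs1) ξ).symm.trans h6))
  -- The spectrum lies in {0, c}, hence b² = cb; so b acts as c on its support p.
  obtain ⟨c, hc⟩ : ∃ c : ℝ, ∀ u ∈ spectrum ℝ (b : H →L[ℂ] H), u * u = c * u := by
    by_cases hex : ∃ s ∈ spectrum ℝ (b : H →L[ℂ] H), s ≠ 0
    · obtain ⟨s, hs, hs0⟩ := hex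
      refine ⟨s, fun u hu => ?_⟩
      by_cases hu0 : u = 0
      · simp [hu0]
      · rw [hsub u hu s hs hu0 hs0]
    · push Not at hex
      exact ⟨0, fun u hu => by simp [hex u hu]⟩
  have hbb : (b : H →L[ℂ] H) * b = (c : ℂ) • (1 : H →L[ℂ] H) * b := by
    have e1 : (b : H →L[ℂ] H) * b = cfc (fun u : ℝ => u * u) (b : H →L[ℂ] H) := by
      rw [cfc_mul _ _ (b : H →L[ℂ] H), cfc_id' ℝ (b : H →L[ℂ] H)]
    rw [e1, cfc_congr hc, cfc_const_mul c (fun u => u) (b : H →L[ℂ] H),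
      cfc_id' ℝ (b : H →L[ℂ] H), smul_mul_assoc, one_mul]
    rfl
  refine ⟨c, Subtype.ext (ContinuousLinearMap.ext fun ξ => ?_)⟩
  have h1 := apply_supp_of_comp_eq hbb (ξ := supp (b : H →L[ℂ] H) ξ)
    (DFunLike.congr_fun (isStarProjection_supp (b : H →L[ℂ] H)).isIdempotentElem.eq ξ)
  rw [apply_supp_apply hb] at h1
  rw [h1]
  exact congrArg (fun q : M.toStarSubalgebra => (c : ℂ) • (q : H →L[ℂ] H) ξ) hsupp

theorem IsMinimalProjection.exists_eq_smul {p : M.toStarSubalgebra} (hp : IsMinimalProjection p)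
    (a : M.toStarSubalgebra) : ∃ c : ℂ, p * a * p = c • p := by
  have hpp : p * p = p := Subtype.ext hp.isStarProjection.isIdempotentElem.eq
  have hps : star p = p := Subtype.ext hp.isStarProjection.isSelfAdjoint.star_eq
  have key : ∀ b : M.toStarSubalgebra, star b = b → ∃ c : ℂ, p * b * p = c • p := by
    intro b hb
    refine hp.exists_eq_smul_of_isSelfAdjoint (b := p * b * p) ?_ ?_
    · have : star (p * b * p) = p * b * p := by rw [star_mul, star_mul, hb, hps, mul_assoc]
      exact congrArg Subtype.val this
    · rw [← mul_assoc, ← mul_assoc, hpp]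
  obtain ⟨c, hc⟩ := key (a + star a) (by rw [star_add, star_star, add_comm])
  obtain ⟨e, he⟩ := key (Complex.I • (a - star a)) (by
    rw [star_smul, star_sub, star_star, Complex.star_def, Complex.conj_I, neg_smul, ← smul_neg,
      neg_sub])
  refine ⟨(2⁻¹ : ℂ) * c - (2⁻¹ : ℂ) * Complex.I * e, ?_⟩
  rw [sub_smul, mul_smul, mul_smul _ e, ← hc, ← he]
  simp only [mul_add, add_mul, mul_sub, sub_mul, mul_smul_comm, smul_mul_assoc, smul_add, smul_sub,
    smul_smul]
  have hI : (2⁻¹ : ℂ) * Complex.I * Complex.I = -2⁻¹ := by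
    rw [mul_assoc, Complex.I_mul_I]; ring
  rw [hI]
  module

/-- Let v = paq be nonzero and w = pbq. By minimality v*v is a nonzero multiple of q and wv* a
multiple of p, so evaluating wv*v in two ways makes w a multiple of v. -/
theorem IsMinimalProjection.exists_finiteDimensional {p q : M.toStarSubalgebra}
    (hp : IsMinimalProjection p) (hq : IsMinimalProjection q) :
    ∃ V : Submodule ℂ M.toStarSubalgebra, V.FG ∧ ∀ a, p * a * q ∈ V := by
  have hqs : star q = q := Subtype.ext hq.isStarProjection.isSelfAdjoint.star_eq
  have hps : star p = p := Subtype.ext hp.isStarProjection.isSelfAdjoint.star_eq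
  have hpp : p * p = p := Subtype.ext hp.isStarProjection.isIdempotentElem.eq
  have hqq : q * q = q := Subtype.ext hq.isStarProjection.isIdempotentElem.eq
  by_cases h : ∃ a, p * a * q ≠ 0
  · obtain ⟨a, ha⟩ := h
    refine ⟨Submodule.span ℂ {p * a * q}, Submodule.fg_span (Set.finite_singleton _), fun b => ?_⟩
    obtain ⟨c, hc⟩ := hq.exists_eq_smul (star a * p * a)
    obtain ⟨e, he⟩ := hp.exists_eq_smul (b * q * star a)
    have hvv : star (p * a * q) * (p * a * q) = c • q := by
      rw [← hc, star_mul, star_mul, hps, hqs]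
      calc _ = q * (star a * (p * p) * a) * q := by simp only [mul_assoc]
        _ = _ := by rw [hpp]
    have hc0 : c ≠ 0 := by
      rintro rfl
      rw [zero_smul] at hvv
      exact ha (Subtype.ext (CStarRing.star_mul_self_eq_zero_iff _ |>.1 (congrArg Subtype.val hvv)))
    have hwv : (p * b * q) * star (p * a * q) = e • p := by
      rw [← he, star_mul, star_mul, hps, hqs]
      calc _ = p * (b * (q * q) * star a) * p := by simp only [mul_assoc]
        _ = _ := by rw [hqq]
    have : c • (p * b * q) = e • (p * a * q) := by
      have h1 : (p * b * q) * star (p * a * q) * (p * a * q) = e • (p * a * q) := by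
        rw [hwv, smul_mul_assoc, ← mul_assoc, ← mul_assoc, hpp]
      rw [← h1, mul_assoc (p * b * q), hvv, mul_smul_comm, mul_assoc (p * b), hqq]
    rw [Submodule.mem_span_singleton]
    exact ⟨c⁻¹ * e, by rw [mul_smul, ← this, smul_smul, inv_mul_cancel₀ hc0, one_smul]⟩
  · push Not at h
    exact ⟨⊥, Submodule.fg_bot, fun a => by rw [h a]; exact Submodule.zero_mem _⟩

/-- A nonzero projection that is not minimal splits as q + (p - q) with both summands nonzero and
strictly smaller. Under the descending chain condition this reduces additive statements to minimal
projections. -/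
theorem projection_induction
    (hwf : WellFounded fun p q : {p : M.toStarSubalgebra // IsStarProjection (p : H →L[ℂ] H)} =>
      (p : M.toStarSubalgebra) < q)
    {Q : M.toStarSubalgebra → Prop} (h0 : Q 0) (hmin : ∀ p, IsMinimalProjection p → Q p)
    (hadd : ∀ p q, Q p → Q q → Q (p + q)) (p : M.toStarSubalgebra)
    (hp : IsStarProjection (p : H →L[ℂ] H)) : Q p := by
  refine hwf.induction (C := fun p => Q p) ⟨p, hp⟩ ?_
  rintro ⟨p, hp⟩ ih
  by_cases hp0 : p = 0
  · change Q p; rwa [hp0]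
  by_cases hm : IsMinimalProjection p
  · exact hmin p hm
  obtain ⟨q, hq, hqp, hq0, hne⟩ : ∃ q : M.toStarSubalgebra, IsStarProjection (q : H →L[ℂ] H) ∧
      q ≤ p ∧ q ≠ 0 ∧ q ≠ p := by
    by_contra! hcon
    exact hm ⟨hp, hp0, hcon⟩
  have hr : IsStarProjection ((p - q : M.toStarSubalgebra) : H →L[ℂ] H) := projection_sub hp hq hqp
  have h1 := ih ⟨q, hq⟩ (lt_of_le_of_ne hqp hne)
  have h2 := ih ⟨p - q, hr⟩ (lt_of_le_of_ne (sub_le_self (p : H →L[ℂ] H) (projection_nonneg hq))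
    fun h => hq0 (sub_eq_self.1 h))
  have := hadd _ _ h1 h2
  rwa [add_sub_cancel] at this

/-- An infinite dimensional von Neumann algebra has a strictly decreasing sequence of
projections. -/
theorem exists_strictAnti_projections (hM : ¬ FiniteDimensional ℂ M.toStarSubalgebra) :
    ∃ q : ℕ → M.toStarSubalgebra, StrictAnti q ∧ ∀ n, IsStarProjection (q n : H →L[ℂ] H) := by
  by_contra hcon
  have hwf : WellFounded
      fun p q : {p : M.toStarSubalgebra // IsStarProjection (p : H →L[ℂ] H)} =>
        (p : M.toStarSubalgebra) < q := by
    rw [wellFounded_iff_isEmpty_descending_chain]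
    refine ⟨fun s => hcon ⟨fun n => (s.1 n : M.toStarSubalgebra), ?_, fun n => (s.1 n).2⟩⟩
    exact strictAnti_nat_of_succ_lt s.2
  -- The left projection is decomposed here with a minimal q on the right; a second induction
  -- decomposes the right one, reaching 1 · a · 1.
  have hleft : ∀ q, IsMinimalProjection q → ∀ p : M.toStarSubalgebra,
      IsStarProjection (p : H →L[ℂ] H) →
      ∃ V : Submodule ℂ M.toStarSubalgebra, V.FG ∧ ∀ a, p * a * q ∈ V := by
    intro q hq
    refine projection_induction hwf ⟨⊥, Submodule.fg_bot, fun a => by simp⟩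
      (fun p hp => hp.exists_finiteDimensional hq) ?_
    rintro p p' ⟨V, hV, h⟩ ⟨V', hV', h'⟩
    refine ⟨V ⊔ V', hV.sup hV', fun a => ?_⟩
    rw [add_mul, add_mul]
    exact Submodule.add_mem_sup (h a) (h' a)
  have h1 : IsStarProjection ((1 : M.toStarSubalgebra) : H →L[ℂ] H) := IsStarProjection.one _
  obtain ⟨V, hV, h⟩ : ∃ V : Submodule ℂ M.toStarSubalgebra, V.FG ∧ ∀ a, 1 * a * 1 ∈ V := by
    refine projection_induction hwf
      (Q := fun q => ∃ V : Submodule ℂ M.toStarSubalgebra, V.FG ∧ ∀ a, 1 * a * q ∈ V)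
      ⟨⊥, Submodule.fg_bot, fun a => by simp⟩ (fun q hq => hleft q hq 1 h1) ?_ 1 h1
    rintro p p' ⟨V, hV, h⟩ ⟨V', hV', h'⟩
    refine ⟨V ⊔ V', hV.sup hV', fun a => ?_⟩
    rw [mul_add]
    exact Submodule.add_mem_sup (h a) (h' a)
  refine hM ⟨?_⟩
  have : V = ⊤ := by
    rw [Submodule.eq_top_iff']
    intro a
    simpa using h a
  rwa [← this]

end FiniteDimension

section TotallyBounded

variable {M : VonNeumannAlgebra H} {τ : M.toStarSubalgebra →ₗ[ℂ] ℂ}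

theorem lt_of_d_lt {x y : H →ₗ.[ℂ] H} (hx : OpLE 0 x) (hy : OpLE 0 y) (h : d x y < 1 / 7) :
    3 / 4 < m x y * m y x := by
  have h0 := mul_nonneg (m_nonneg (y := y) hx) (m_nonneg (y := x) hy)
  rw [d, div_lt_iff₀ (by linarith)] at h
  linarith

/-- Infinitely many normalisations of 1 + q n would fall into finitely many balls of radius 1/7, so
two indices n < k share a centre c. By `lt_of_d_lt` the product of the four m's to and from c
exceeds (3/4)². Testing at ξ in the range of q n - q k and ζ in that of q k bounds the same product
by 1/2. Multiplying through c replaces a triangle inequality. -/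
theorem not_dTotallyBounded_SbInv (hτ : IsFaithfulNormalTracialState M τ)
    (hM : ¬ FiniteDimensional ℂ M.toStarSubalgebra) : ¬ DTotallyBounded M τ (SbInv M τ) := by
  intro htb
  obtain ⟨q, hanti, hq⟩ := exists_strictAnti_projections hM
  obtain ⟨t, htf, htS, ht⟩ := htb (1 / 7) (by norm_num)
  have hform : ∀ n (η : H), (inner ℂ (((1 + q n : M.toStarSubalgebra) : H →L[ℂ] H) η) η : ℂ).re
      = ‖η‖ ^ 2 + ‖(q n : H →L[ℂ] H) η‖ ^ 2 := fun n η => by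
    rw [← form_projection (hq n), ← re_inner_self, ← Complex.add_re, ← inner_add_left]
    rfl
  have hmem : ∀ n, density τ (1 + q n) ∈ SbInv M τ := fun n =>
    density_mem_SbInv hτ ((IsSelfAdjoint.one _).add (hq n).isSelfAdjoint) one_pos fun η => by
      rw [hform]; linarith [sq_nonneg ‖(q n : H →L[ℂ] H) η‖]
  choose c hct hc using fun n => ht _ (hmem n)
  have : Finite t := htf
  obtain ⟨n, k, hnk, hcc⟩ : ∃ n k, n < k ∧ c n = c k := by
    obtain ⟨n, k, hne, h⟩ := Finite.exists_ne_map_eq_of_infinite fun n => (⟨c n, hct n⟩ : t)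
    have h' := congrArg Subtype.val h
    rcases lt_or_gt_of_ne hne with hlt | hlt
    · exact ⟨n, k, hlt, h'⟩
    · exact ⟨k, n, hlt, h'.symm⟩
  have hxp := (hmem n).1.1.1.1
  have hyp := (hmem k).1.1.1.1
  have hcp := (htS (hct n)).1.1
  -- The centre is at distance below 1 from a bounded operator, so it is bounded and defined at all
  -- test vectors.
  have htop : (c n).domain = ⊤ := by
    refine domain_eq_top_of_isBoundedOp hcp.1 ?_
    exact isBoundedOp_of_d_lt_one hxp hcp ((hc n).trans (by norm_num)) (isBoundedOp_ofBounded _)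
  have hck := hc k
  rw [← hcc] at hck
  have h1 := lt_of_d_lt hxp.2.2 hcp.2.2 (hc n)
  have h2 := lt_of_d_lt hyp.2.2 hcp.2.2 hck
  have hlt := hanti hnk
  have hle : q k ≤ q n := hlt.le
  have hqk : q k ≠ 0 := fun h0 => by
    have h3 := hanti (Nat.lt_succ_self k)
    rw [h0] at h3
    exact absurd (projection_nonneg (hq (k + 1))) (not_le_of_gt h3)
  have hmul := mul_eq_of_projection_le (hq n) (hq k) hle
  have hmul' : (q n : H →L[ℂ] H) * q k = q k := by
    have := congrArg star hmul
    rwa [star_mul, (hq n).isSelfAdjoint.star_eq, (hq k).isSelfAdjoint.star_eq] at this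
  obtain ⟨ζ, hζ, hkζ⟩ := exists_apply_eq_self (hq k) fun h0 => hqk (Subtype.ext h0)
  have hnζ : (q n : H →L[ℂ] H) ζ = ζ := by
    have := DFunLike.congr_fun hmul' ζ
    rwa [mul_apply_eq_comp, hkζ] at this
  obtain ⟨ξ, hξ, hdξ⟩ := exists_apply_eq_self (projection_sub (hq n) (hq k) hle) fun h0 =>
    hlt.ne' (Subtype.ext (sub_eq_zero.1 h0))
  have hkξ : (q k : H →L[ℂ] H) ξ = 0 := by
    rw [← hdξ, ← mul_apply_eq_comp, mul_sub, hmul, (hq k).isIdempotentElem.eq, sub_self]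
    rfl
  have hnξ : (q n : H →L[ℂ] H) ξ = ξ := by
    have h3 : (q n : H →L[ℂ] H) ξ - (q k : H →L[ℂ] H) ξ = ξ := hdξ
    rwa [hkξ, sub_zero] at h3
  have hα : 0 < (τ (1 + q n)).re⁻¹ := by
    rw [map_add, Complex.add_re, hτ.re_one]
    have := hτ.re_nonneg (projection_nonneg (hq n))
    positivity
  have hβ : 0 < (τ (1 + q k)).re⁻¹ := by
    rw [map_add, Complex.add_re, hτ.re_one]
    have := hτ.re_nonneg (projection_nonneg (hq k))
    positivity
  have hdc : ∀ η : H, η ∈ (c n).domain := fun η => by rw [htop]; trivial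
  have e1 := m_mul_form_le hyp.2.2 hcp.2.2 (ξ := ξ) trivial (hdc ξ)
  have e2 := m_mul_form_le hcp.2.2 hxp.2.2 (ξ := ξ) (hdc ξ) trivial
  have e3 := m_mul_form_le hxp.2.2 hcp.2.2 (ξ := ζ) trivial (hdc ζ)
  have e4 := m_mul_form_le hcp.2.2 hyp.2.2 (ξ := ζ) (hdc ζ) trivial
  rw [density_form _ ⟨ξ, trivial⟩, hform] at e1 e2
  rw [density_form _ ⟨ζ, trivial⟩, hform] at e3 e4
  simp only [hkξ, hnξ, hkζ, hnζ, norm_zero] at e1 e2 e3 e4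
  have m1 := m_nonneg (y := c n) hxp.2.2
  have m2 := m_nonneg (y := c n) hyp.2.2
  have m3 := m_nonneg (y := density τ (1 + q n)) hcp.2.2
  have m4 := m_nonneg (y := density τ (1 + q k)) hcp.2.2
  set α := (τ (1 + q n)).re⁻¹
  set β := (τ (1 + q k)).re⁻¹
  set u1 := m (density τ (1 + q n)) (c n)
  set u2 := m (density τ (1 + q k)) (c n)
  set u3 := m (c n) (density τ (1 + q n))
  set u4 := m (c n) (density τ (1 + q k))
  have hξ2 : 0 < ‖ξ‖ ^ 2 := by have := norm_pos_iff.2 hξ; positivity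
  have hζ2 : 0 < ‖ζ‖ ^ 2 := by have := norm_pos_iff.2 hζ; positivity
  have f1 : u2 * u3 * (2 * α) ≤ β := by
    have := (mul_le_mul_of_nonneg_left e2 m2).trans e1
    have h3 : u2 * u3 * (2 * α) * ‖ξ‖ ^ 2 ≤ β * ‖ξ‖ ^ 2 := by linarith
    exact le_of_mul_le_mul_right h3 hξ2
  have f2 : u1 * u4 * β ≤ α := by
    have := (mul_le_mul_of_nonneg_left e4 m1).trans e3
    have h3 : u1 * u4 * β * (2 * ‖ζ‖ ^ 2) ≤ α * (2 * ‖ζ‖ ^ 2) := by linarith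
    exact le_of_mul_le_mul_right h3 (by positivity)
  have f3 : (u1 * u3) * (u2 * u4) * (2 * (α * β)) ≤ 1 * (α * β) := by
    have := mul_le_mul f1 f2 (by positivity) hβ.le
    linarith
  have f4 : (u1 * u3) * (u2 * u4) * 2 ≤ 1 :=
    le_of_mul_le_mul_right (by linarith) (mul_pos hα hβ)
  nlinarith

end TotallyBounded

end NotTotallyBounded

/-! ### Rapidly decreasing projections and a contraction with eigenvalues 1, 1/2, 1/4, …. -/

section GeometricContraction

variable {M : VonNeumannAlgebra H} {τ : M.toStarSubalgebra →ₗ[ℂ] ℂ}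

/-- An increasing sequence of projections of `M` converges strongly to a projection of `M`. -/
theorem exists_tendsto_projection {e : ℕ → M.toStarSubalgebra} (hmono : Monotone e)
    (he : ∀ n, IsStarProjection (e n : H →L[ℂ] H)) :
    ∃ s : M.toStarSubalgebra, IsStarProjection (s : H →L[ℂ] H) ∧ (∀ n, e n ≤ s) ∧
      ∀ ξ : H, Tendsto (fun n => (e n : H →L[ℂ] H) ξ) atTop (𝓝 ((s : H →L[ℂ] H) ξ)) := by
  choose hU hUe using fun n => isStarProjection_iff_eq_starProjection_range.1 (he n)
  have hUmono : Monotone fun n => (e n : H →L[ℂ] H).range := by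
    intro m n hmn
    rintro _ ⟨ξ, rfl⟩
    have h1 := mul_eq_of_projection_le (he n) (he m) (hmono hmn)
    have h2 : (e n : H →L[ℂ] H) * e m = e m := by
      have := congrArg star h1
      rwa [star_mul, (he n).isSelfAdjoint.star_eq, (he m).isSelfAdjoint.star_eq] at this
    exact ⟨(e m : H →L[ℂ] H) ξ, DFunLike.congr_fun h2 ξ⟩
  set s := (⨆ n, (e n : H →L[ℂ] H).range).topologicalClosure.starProjection with hs
  have hlim : ∀ ξ : H, Tendsto (fun n => (e n : H →L[ℂ] H) ξ) atTop (𝓝 (s ξ)) := by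
    intro ξ
    have := Submodule.starProjection_tendsto_closure_iSup
      (fun n => (e n : H →L[ℂ] H).range) hUmono ξ
    refine this.congr fun n => ?_
    exact (DFunLike.congr_fun (hUe n) ξ).symm
  have hsM : s ∈ M := mem_of_commute fun b hb => by
    ext ξ
    refine tendsto_nhds_unique ((b.continuous.tendsto _).comp (hlim ξ)) ?_
    refine (hlim (b ξ)).congr fun n => ?_
    exact DFunLike.congr_fun (VonNeumannAlgebra.mem_commutant_iff.1 hb _ (e n).2) ξ
  have hsp : IsStarProjection s := isStarProjection_starProjection
  refine ⟨⟨s, hsM⟩, hsp, fun n => ?_, hlim⟩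
  refine projection_le_of_mul_eq (he n) hsp ?_
  have h1 : s * (e n : H →L[ℂ] H) = e n := by
    ext ξ
    refine Submodule.starProjection_eq_self_iff.2 (Submodule.le_topologicalClosure _ ?_)
    exact Submodule.mem_iSup_of_mem n ⟨ξ, rfl⟩
  have := congrArg star h1
  rwa [star_mul, hsp.isSelfAdjoint.star_eq, (he n).isSelfAdjoint.star_eq] at this

/-- The complements 1 - q n increase strongly to a projection s, so the projections s - (1 - q n)
decrease to zero. Normality sends their traces to zero, and a subsequence has the required rate. -/
theorem exists_rapid_projections (hτ : IsFaithfulNormalTracialState M τ)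
    (hM : ¬ FiniteDimensional ℂ M.toStarSubalgebra) :
    ∃ q : ℕ → M.toStarSubalgebra, StrictAnti q ∧ (∀ n, IsStarProjection (q n : H →L[ℂ] H)) ∧
      q 0 ≠ 1 ∧ (∀ ξ : H, Tendsto (fun n => (q n : H →L[ℂ] H) ξ) atTop (𝓝 0)) ∧
      ∀ n, (τ (q n)).re ≤ (1 / 16) ^ n := by
  obtain ⟨q, hanti, hq⟩ := exists_strictAnti_projections hM
  have he : ∀ n, IsStarProjection ((1 - q n : M.toStarSubalgebra) : H →L[ℂ] H) :=
    fun n => (hq n).one_sub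
  have hmono : Monotone fun n => 1 - q n :=
    fun m n hmn => sub_le_sub_left (show (q n : H →L[ℂ] H) ≤ q m from hanti.antitone hmn) 1
  obtain ⟨s, hs, hle, hlim⟩ := exists_tendsto_projection hmono he
  have hp : ∀ n, IsStarProjection ((s - (1 - q n) : M.toStarSubalgebra) : H →L[ℂ] H) :=
    fun n => projection_sub hs (he n) (hle n)
  have hpanti : StrictAnti fun n => s - (1 - q n) := by
    intro m n hmn
    refine lt_of_le_of_ne (show (s : H →L[ℂ] H) - (1 - q n : M.toStarSubalgebra)
      ≤ (s : H →L[ℂ] H) - (1 - q m : M.toStarSubalgebra) from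
      sub_le_sub_left (show ((1 - q m : M.toStarSubalgebra) : H →L[ℂ] H) ≤ (1 - q n : M.toStarSubalgebra)
        from hmono hmn.le) (s : H →L[ℂ] H)) fun h => ?_
    exact (hanti hmn).ne (by simpa using h)
  have hτlim : Tendsto (fun n => (τ (s - (1 - q n))).re) atTop (𝓝 0) := by
    have h1 := hτ.tendsto_re (fun n => projection_nonneg (he n)) hmono hs.isSelfAdjoint
      fun ξ => (Complex.continuous_re.tendsto _).comp ((hlim ξ).inner tendsto_const_nhds)
    have h2 := (tendsto_const_nhds (x := (τ s).re)).sub h1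
    rw [sub_self] at h2
    refine h2.congr fun n => ?_
    rw [map_sub τ s, Complex.sub_re]
  obtain ⟨φ, hφ, hφτ⟩ := extraction_forall_of_eventually
    (P := fun n k => (τ (s - (1 - q k))).re ≤ (1 / 16) ^ (n : ℕ))
    fun n => (hτlim.eventually (gt_mem_nhds (show (0 : ℝ) < (1 / 16) ^ n by positivity))).mono
      fun k hk => hk.le
  -- The shift by one keeps the projection with index φ 0 strictly above the new first term, which
  -- is therefore not 1.
  refine ⟨fun n => s - (1 - q (φ (n + 1))), fun m n hmn => hpanti (hφ (by omega)),
    fun n => hp _, ?_, fun ξ => ?_, fun n => ?_⟩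
  · intro h
    have h1 : s - (1 - q (φ (0 + 1))) < s - (1 - q (φ 0)) := hpanti (hφ (by omega))
    simp only [h] at h1
    exact absurd (projection_le_one (hp (φ 0))) (not_le_of_gt h1)
  · have h1 := (tendsto_const_nhds (x := (s : H →L[ℂ] H) ξ)).sub (hlim ξ)
    rw [sub_self] at h1
    exact h1.comp (hφ.tendsto_atTop.comp (tendsto_add_atTop_nat 1))
  · refine (hφτ (n + 1)).trans ?_
    exact pow_le_pow_of_le_one (by norm_num) (by norm_num) (by omega)

theorem hasSum_smul_apply {c : ℕ → ℝ} {e : ℕ → H →L[ℂ] H} {r : H →L[ℂ] H}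
    (hr : HasSum (fun n => (c n : ℂ) • e n) r) (ξ : H) :
    HasSum (fun n => (c n : ℂ) • e n ξ) (r ξ) := by
  have := (ContinuousLinearMap.apply ℂ H ξ).hasSum hr
  exact this

theorem norm_projection_le_one {p : H →L[ℂ] H} (hp : IsStarProjection p) : ‖p‖ ≤ 1 :=
  ContinuousLinearMap.opNorm_le_bound _ zero_le_one fun ξ => by
    rw [one_mul]; exact norm_projection_apply_le hp ξ

theorem hasSum_half_pow : HasSum (fun n : ℕ => (1 / 2 : ℝ) ^ (n + 1)) 1 := by
  have e : (fun n : ℕ => (1 / 2 : ℝ) ^ (n + 1)) = fun n : ℕ => 1 / 2 / 2 ^ n := by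
    ext n
    rw [pow_succ, one_div_pow]
    ring
  rw [e]
  exact hasSum_geometric_two' 1

theorem sum_half_pow (k : ℕ) :
    ∑ n ∈ Finset.range (k + 1), (1 / 2 : ℝ) ^ (n + 1) = 1 - (1 / 2) ^ (k + 1) := by
  induction k with
  | zero => norm_num
  | succ k ih => rw [Finset.sum_range_succ, ih]; ring

/-- A positive contraction that is injective, with eigenvalues `1, 1/2, 1/4, …` on the successive
differences of a sequence of projections decreasing to zero. -/
theorem exists_geometric_contraction {q : ℕ → H →L[ℂ] H} (hanti : Antitone q)
    (hq : ∀ n, IsStarProjection (q n)) (hlim : ∀ ξ : H, Tendsto (fun n => q n ξ) atTop (𝓝 0)) :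
    ∃ r : H →L[ℂ] H, (∀ b : H →L[ℂ] H, (∀ n, q n * b = b * q n) → b * r = r * b) ∧
      0 ≤ r ∧ r ≤ 1 ∧ Function.Injective r ∧ (∀ ξ : H, q 0 ξ = 0 → r ξ = ξ) ∧
      ∀ (k : ℕ) (ξ : H), q k ξ = ξ → q (k + 1) ξ = 0 →
        r ξ = (((1 / 2) ^ (k + 1) : ℝ) : ℂ) • ξ := by
  have hgeom := hasSum_half_pow
  have he : ∀ n, IsStarProjection (1 - q n) := fun n => (hq n).one_sub
  -- The contraction is r = ∑ 2⁻⁽ⁿ⁺¹⁾(1 - q n).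
  have hsum : Summable fun n : ℕ => (((1 / 2) ^ (n + 1) : ℝ) : ℂ) • (1 - q n) := by
    refine Summable.of_norm_bounded hgeom.summable fun n => ?_
    rw [norm_smul, Complex.norm_real, Real.norm_of_nonneg (by positivity)]
    exact mul_le_of_le_one_right (by positivity) (norm_projection_le_one (he n))
  obtain ⟨r, hr⟩ := hsum
  have hrξ : ∀ ξ : H, HasSum
      (fun n : ℕ => (((1 / 2) ^ (n + 1) : ℝ) : ℂ) • (ξ - q n ξ)) (r ξ) :=
    fun ξ => hasSum_smul_apply hr ξ
  have hrM : ∀ b : H →L[ℂ] H, (∀ n, q n * b = b * q n) → b * r = r * b := fun b hb => by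
    ext ξ
    have h0 := b.hasSum (hrξ ξ)
    have h1 : ∀ n, b (q n ξ) = q n (b ξ) := fun n => (DFunLike.congr_fun (hb n) ξ).symm
    have h2 : (fun n : ℕ => b ((((1 / 2) ^ (n + 1) : ℝ) : ℂ) • (ξ - q n ξ)))
        = fun n : ℕ => (((1 / 2) ^ (n + 1) : ℝ) : ℂ) • (b ξ - q n (b ξ)) := by
      ext n
      rw [map_smul, map_sub, h1]
    rw [h2] at h0
    exact h0.unique (hrξ (b ξ))
  have hrsa : IsSelfAdjoint r := by
    have h1 := hr.star
    have h2 : ∀ n : ℕ, star ((((1 / 2) ^ (n + 1) : ℝ) : ℂ) • (1 - q n))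
        = (((1 / 2) ^ (n + 1) : ℝ) : ℂ) • (1 - q n) :=
      fun n => (isSelfAdjoint_ofReal_smul _ (he n).isSelfAdjoint).star_eq
    simp only [h2] at h1
    exact h1.unique hr
  have hform : ∀ ξ : H, HasSum
      (fun n : ℕ => (1 / 2 : ℝ) ^ (n + 1) * ‖(1 - q n) ξ‖ ^ 2)
      (inner ℂ (r ξ) ξ : ℂ).re := by
    intro ξ
    have h1 := Complex.reCLM.hasSum ((innerSL ℂ ξ).hasSum (hrξ ξ))
    have h2 : (inner ℂ (r ξ) ξ : ℂ).re = Complex.reCLM (innerSL ℂ ξ (r ξ)) := by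
      rw [← inner_conj_symm, Complex.conj_re]; rfl
    rw [h2]
    convert h1 using 1
    ext n
    rw [← form_projection (he n), ← form_ofReal_smul, ← inner_conj_symm, Complex.conj_re]
    rfl
  have hr0 : 0 ≤ r := nonneg_of_form hrsa fun ξ => (hform ξ).nonneg fun n => by positivity
  have hr1 : r ≤ 1 := le_one_of_form hrsa fun ξ => by
    have := hgeom.mul_right (‖ξ‖ ^ 2)
    rw [one_mul] at this
    refine hasSum_le (fun n => ?_) (hform ξ) this
    exact mul_le_mul_of_nonneg_left (pow_le_pow_left₀ (norm_nonneg _)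
      (norm_projection_apply_le (he n) ξ) 2) (by positivity)
  have hqq : ∀ m n, m ≤ n → q n * q m = q n := fun m n hmn =>
    mul_eq_of_projection_le (hq m) (hq n) (hanti hmn)
  have hqq' : ∀ m n, m ≤ n → q m * q n = q n := fun m n hmn => by
    have := congrArg star (hqq m n hmn)
    rwa [star_mul, (hq n).isSelfAdjoint.star_eq, (hq m).isSelfAdjoint.star_eq] at this
  have hall : ∀ ξ : H, HasSum (fun n : ℕ => (((1 / 2) ^ (n + 1) : ℝ) : ℂ) • ξ) ξ := by
    intro ξ
    have := (Complex.ofRealCLM.hasSum hgeom).smul_const ξ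
    simpa using this
  have hker : ∀ (k : ℕ) (ξ : H), q k ξ = 0 → ∀ n, k ≤ n →
      q n ξ = 0 := by
    intro k ξ hk n hn
    rw [← hqq k n hn, mul_apply_eq_comp, hk, map_zero]
  refine ⟨r, hrM, hr0, hr1, ?_, ?_, ?_⟩
  · refine (injective_iff_map_eq_zero r).2 fun ξ hξ => ?_
    have h1 := hform ξ
    rw [hξ, inner_zero_left, Complex.zero_re] at h1
    have h2 := (hasSum_zero_iff_of_nonneg fun n => by positivity).1 h1
    have h3 : ∀ n, q n ξ = ξ := fun n => by
      have h4 := congrFun h2 n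
      simp only [Pi.zero_apply, mul_eq_zero, pow_eq_zero_iff, ne_eq, OfNat.ofNat_ne_zero,
        not_false_eq_true, norm_eq_zero] at h4
      rcases h4 with h4 | h4
      · exact absurd h4 (by positivity)
      · exact (sub_eq_zero.1 h4).symm
    have h5 := hlim ξ
    simp only [h3] at h5
    exact tendsto_nhds_unique tendsto_const_nhds h5
  · intro ξ hξ
    have h1 := hrξ ξ
    simp only [fun n => hker 0 ξ hξ n (Nat.zero_le n), sub_zero] at h1
    exact h1.unique (hall ξ)
  · intro k ξ hk hk1
    -- On the range of q k - q (k + 1) the terms n ≤ k vanish and the others are scalar; the tail is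
    -- 1 minus the head sum, which is 2⁻⁽ᵏ⁺¹⁾.
    have h1 : ∀ n ∉ Finset.range (k + 1),
        (((1 / 2) ^ (n + 1) : ℝ) : ℂ) • q n ξ = 0 := fun n hn => by
      rw [hker (k + 1) ξ hk1 n (by simpa using hn), smul_zero]
    have h2 := (hall ξ).sub (hasSum_sum_of_ne_finset_zero h1)
    have h3 : ∑ n ∈ Finset.range (k + 1), (((1 / 2) ^ (n + 1) : ℝ) : ℂ) • q n ξ
        = ((1 - (1 / 2) ^ (k + 1) : ℝ) : ℂ) • ξ := by
      have h4 : ∀ n ∈ Finset.range (k + 1), (((1 / 2) ^ (n + 1) : ℝ) : ℂ) • q n ξ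
          = (((1 / 2) ^ (n + 1) : ℝ) : ℂ) • ξ := fun n hn => by
        have : n ≤ k := by simpa [Nat.lt_succ_iff] using hn
        rw [← hk, ← mul_apply_eq_comp, hqq' n k this]
      rw [Finset.sum_congr rfl h4, ← Finset.sum_smul, ← Complex.ofReal_sum]
      rw [sum_half_pow]
    simp only [← smul_sub] at h2
    rw [h3] at h2
    have h5 := (hrξ ξ).unique h2
    change r ξ = _
    rw [h5, Complex.ofReal_sub, sub_smul, Complex.ofReal_one, one_smul, sub_sub_cancel]

end GeometricContraction

/-! ### Normalisation to states, and inverses of injective contractions. -/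

section Inverses

variable {M : VonNeumannAlgebra H} {τ : M.toStarSubalgebra →ₗ[ℂ] ℂ}

section Scaling

variable {x : H →ₗ.[ℂ] H}

theorem smul_form (c : ℝ) (ξ : H) (h : ξ ∈ ((c : ℂ) • x).domain) (h' : ξ ∈ x.domain) :
    (inner ℂ (((c : ℂ) • x) ⟨ξ, h⟩) ξ : ℂ).re = c * (inner ℂ (x ⟨ξ, h'⟩) ξ : ℂ).re := by
  rw [LinearPMap.smul_apply, inner_smul_left, Complex.conj_ofReal, Complex.re_ofReal_mul]

theorem smul_mem_posAffiliated (hx : x ∈ posAffiliated M) {c : ℝ} (hc : 0 < c) :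
    (c : ℂ) • x ∈ posAffiliated M := by
  obtain ⟨hsa, haff, hpos⟩ := hx
  have hc0 : (c : ℂ) ≠ 0 := Complex.ofReal_ne_zero.2 hc.ne'
  refine ⟨isSelfAdjoint_of_maximal hsa.dense_domain (fun ξ η => ?_) fun η w h => ?_,
    fun b hb ξ => ?_, ?_⟩
  · rw [LinearPMap.smul_apply, LinearPMap.smul_apply, inner_smul_left, inner_smul_right,
      Complex.conj_ofReal, inner_apply_left hsa]
  · refine (exists_mem_domain hsa (η := η) (w := (c : ℂ)⁻¹ • w) fun ξ => ?_).1
    have := h ξ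
    rw [LinearPMap.smul_apply, inner_smul_right] at this
    rw [inner_smul_left, this, map_inv₀, Complex.conj_ofReal, ← mul_assoc, inv_mul_cancel₀ hc0,
      one_mul]
  · obtain ⟨h, e⟩ := haff b hb ξ
    refine ⟨h, ?_⟩
    rw [LinearPMap.smul_apply, LinearPMap.smul_apply, map_smul]
    exact congrArg _ e
  · rw [opLE_iff]
    intro ξ h1 h2
    rw [smul_form c ξ h2 h2]
    have := form_nonneg_of_opLE hpos ⟨ξ, h2⟩
    change (inner ℂ (0 : H) ξ : ℂ).re ≤ _
    rw [inner_zero_left]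
    exact mul_nonneg hc.le this

theorem trace_smul_le {c : ℝ} (hc : 0 < c) (x : H →ₗ.[ℂ] H) :
    trace M τ ((c : ℂ) • x) ≤ ENNReal.ofReal c * trace M τ x := by
  refine iSup₂_le fun a ha => iSup_le fun hax => ?_
  have e : (τ a).re = c * (τ (((c⁻¹ : ℝ) : ℂ) • a)).re := by
    rw [map_smul, smul_eq_mul, Complex.re_ofReal_mul, ← mul_assoc, mul_inv_cancel₀ hc.ne', one_mul]
  rw [e, ENNReal.ofReal_mul hc.le]
  gcongr
  refine le_iSup₂_of_le (((c⁻¹ : ℝ) : ℂ) • a) (ofReal_smul_nonneg (inv_nonneg.2 hc.le) ha)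
    (le_iSup_of_le ?_ le_rfl)
  rw [opLE_ofBounded_iff] at hax ⊢
  intro ξ
  have h1 := hax ⟨ξ, ξ.2⟩
  rw [smul_form c (ξ : H) ξ.2 ξ.2] at h1
  have h2 := form_ofReal_smul c⁻¹ (a : H →L[ℂ] H) (ξ : H)
  refine h2.trans_le ?_
  rw [inv_mul_le_iff₀ hc]
  exact h1

theorem trace_smul {c : ℝ} (hc : 0 < c) (x : H →ₗ.[ℂ] H) :
    trace M τ ((c : ℂ) • x) = ENNReal.ofReal c * trace M τ x := by
  refine le_antisymm (trace_smul_le hc x) ?_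
  have h := trace_smul_le (M := M) (τ := τ) (inv_pos.2 hc) ((c : ℂ) • x)
  have hc0 : (c : ℂ) ≠ 0 := Complex.ofReal_ne_zero.2 hc.ne'
  rw [smul_smul, Complex.ofReal_inv, inv_mul_cancel₀ hc0, one_smul] at h
  calc _ ≤ ENNReal.ofReal c * (ENNReal.ofReal c⁻¹ * trace M τ ((c : ℂ) • x)) := by gcongr
    _ = _ := by
      rw [← mul_assoc, ← ENNReal.ofReal_mul hc.le, mul_inv_cancel₀ hc.ne', ENNReal.ofReal_one,
        one_mul]

/-- A positive affiliated operator of finite nonzero trace can be normalised to a state. -/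
theorem exists_smul_mem_S (hx : x ∈ posAffiliated M) (h0 : 0 < trace M τ x)
    (h1 : trace M τ x < ⊤) : ∃ c : ℝ, 0 < c ∧ (c : ℂ) • x ∈ S M τ := by
  have hpos : 0 < (trace M τ x).toReal := ENNReal.toReal_pos h0.ne' h1.ne
  have hc := inv_pos.2 hpos
  have htr : trace M τ ((((trace M τ x).toReal⁻¹ : ℝ) : ℂ) • x) = 1 := by
    rw [trace_smul hc]
    conv_lhs => rw [← ENNReal.ofReal_toReal h1.ne]
    rw [ENNReal.toReal_ofReal ENNReal.toReal_nonneg, ← ENNReal.ofReal_mul hc.le,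
      inv_mul_cancel₀ hpos.ne', ENNReal.ofReal_one]
  exact ⟨_, hc, ⟨smul_mem_posAffiliated hx hc, htr ▸ ENNReal.one_lt_top⟩, htr⟩

end Scaling

section InverseOperators

/-- The operator `r⁻¹ - β` on the range of an injective bounded operator `r`. -/
def inverseSub (r : H →L[ℂ] H) (hr : Function.Injective r) (β : ℝ) : H →ₗ.[ℂ] H where
  domain := (r : H →ₗ[ℂ] H).range
  toFun := (LinearEquiv.ofInjective (r : H →ₗ[ℂ] H) hr).symm.toLinearMap
    - (β : ℂ) • (r : H →ₗ[ℂ] H).range.subtype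

theorem mem_inverseSub_domain (r : H →L[ℂ] H) (hr : Function.Injective r) (β : ℝ) (ξ : H) :
    r ξ ∈ (inverseSub r hr β).domain := ⟨ξ, rfl⟩

theorem inverseSub_apply (r : H →L[ℂ] H) (hr : Function.Injective r) (β : ℝ) (ξ : H)
    (h : r ξ ∈ (inverseSub r hr β).domain) :
    inverseSub r hr β ⟨r ξ, h⟩ = ξ - (β : ℂ) • r ξ := by
  have : (LinearEquiv.ofInjective (r : H →ₗ[ℂ] H) hr).symm ⟨r ξ, h⟩ = ξ := by
    rw [LinearEquiv.symm_apply_eq]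
    rfl
  change (LinearEquiv.ofInjective (r : H →ₗ[ℂ] H) hr).symm ⟨r ξ, h⟩ - (β : ℂ) • r ξ = _
  rw [this]

theorem inverseSub_eigenvector {r : H →L[ℂ] H} (hr : Function.Injective r) (β : ℝ) {ξ : H}
    {s : ℝ} (hs : s ≠ 0) (h : r ξ = (s : ℂ) • ξ) :
    ∃ hξ : ξ ∈ (inverseSub r hr β).domain,
      inverseSub r hr β ⟨ξ, hξ⟩ = ((s⁻¹ - β : ℝ) : ℂ) • ξ := by
  have hs0 : (s : ℂ) ≠ 0 := Complex.ofReal_ne_zero.2 hs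
  have e : r ((s : ℂ)⁻¹ • ξ) = ξ := by
    rw [map_smul, h, smul_smul, inv_mul_cancel₀ hs0, one_smul]
  have hξ : ξ ∈ (inverseSub r hr β).domain := ⟨(s : ℂ)⁻¹ • ξ, e⟩
  refine ⟨hξ, ?_⟩
  have h1 := inverseSub_apply r hr β ((s : ℂ)⁻¹ • ξ) (mem_inverseSub_domain r hr β _)
  have h2 : (⟨r ((s : ℂ)⁻¹ • ξ), mem_inverseSub_domain r hr β _⟩ : (inverseSub r hr β).domain)
      = ⟨ξ, hξ⟩ := Subtype.ext e
  rw [h2, e] at h1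
  rw [h1, Complex.ofReal_sub, Complex.ofReal_inv, sub_smul]

/-- This is r² ≤ r, from r - r² = (1 - r)r(1 - r) + r(1 - r)r with both summands positive. -/
theorem norm_sq_le_form {r : H →L[ℂ] H} (h0 : 0 ≤ r) (h1 : r ≤ 1) (ξ : H) :
    ‖r ξ‖ ^ 2 ≤ (inner ℂ ξ (r ξ) : ℂ).re := by
  have hsa := IsSelfAdjoint.of_nonneg h0
  have e1 := form_nonneg h0 (ξ - r ξ)
  have e2 := form_mono h1 (r ξ)
  rw [one_apply_eq_self, re_inner_self] at e2
  rw [map_sub, inner_sub_left, inner_sub_right, inner_sub_right, Complex.sub_re, Complex.sub_re,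
    Complex.sub_re, re_inner_self, inner_left_of_isSelfAdjoint hsa,
    inner_left_of_isSelfAdjoint hsa (r ξ) ξ, re_inner_self] at e1
  linarith

theorem denseRange_of_injective {r : H →L[ℂ] H} (hr : IsSelfAdjoint r)
    (hinj : Function.Injective r) : DenseRange r := by
  intro ξ
  have h : ξ - supp r ξ = 0 := by
    refine hinj ?_
    rw [map_sub, apply_supp_apply hr, sub_self, map_zero]
  rw [sub_eq_zero.1 h]
  exact supp_apply_mem r ξ

/-- If ⟨w, rξ⟩ = ⟨η, ξ - βrξ⟩ for all ξ, then η = r(w + βη) lies in the range of r, so the symmetric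
operator has no proper adjoint extension. Positivity is r² ≤ r together with β ≤ 1. -/
theorem inverseSub_mem_posAffiliated {r : M.toStarSubalgebra} (h0 : (0 : H →L[ℂ] H) ≤ r)
    (h1 : (r : H →L[ℂ] H) ≤ 1) (hr : Function.Injective (r : H →L[ℂ] H)) {β : ℝ} (hβ : β ≤ 1) :
    inverseSub (r : H →L[ℂ] H) hr β ∈ posAffiliated M := by
  have hsa : IsSelfAdjoint (r : H →L[ℂ] H) := IsSelfAdjoint.of_nonneg h0
  refine ⟨isSelfAdjoint_of_maximal (denseRange_of_injective hsa hr) ?_ ?_, ?_, ?_⟩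
  · rintro ⟨_, ξ, rfl⟩ ⟨_, η, rfl⟩
    change inner ℂ (inverseSub (r : H →L[ℂ] H) hr β
        ⟨(r : H →L[ℂ] H) ξ, mem_inverseSub_domain _ hr β ξ⟩) ((r : H →L[ℂ] H) η)
      = inner ℂ ((r : H →L[ℂ] H) ξ) (inverseSub (r : H →L[ℂ] H) hr β
        ⟨(r : H →L[ℂ] H) η, mem_inverseSub_domain _ hr β η⟩)
    rw [inverseSub_apply, inverseSub_apply, inner_sub_left, inner_sub_right, inner_smul_left,
      inner_smul_right, Complex.conj_ofReal, inner_left_of_isSelfAdjoint hsa ξ η]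
  · intro η w h
    refine ⟨w + (β : ℂ) • η, ?_⟩
    refine ext_inner_right ℂ fun ξ => ?_
    have h2 := h ⟨_, mem_inverseSub_domain _ hr β ξ⟩
    rw [inverseSub_apply, inner_sub_right, inner_smul_right] at h2
    change inner ℂ ((r : H →L[ℂ] H) (w + (β : ℂ) • η)) ξ = inner ℂ η ξ
    rw [inner_left_of_isSelfAdjoint hsa, inner_add_left, inner_smul_left, Complex.conj_ofReal]
    change inner ℂ w ((r : H →L[ℂ] H) ξ) = _ at h2
    rw [h2]
    ring
  · rintro b hb ⟨_, ξ, rfl⟩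
    have hc : b ((r : H →L[ℂ] H) ξ) = (r : H →L[ℂ] H) (b ξ) :=
      (DFunLike.congr_fun (VonNeumannAlgebra.mem_commutant_iff.1 hb _ r.2) ξ).symm
    refine ⟨⟨b ξ, hc.symm⟩, ?_⟩
    have h2 : ∀ h, inverseSub (r : H →L[ℂ] H) hr β ⟨b ((r : H →L[ℂ] H) ξ), h⟩
        = b ξ - (β : ℂ) • b ((r : H →L[ℂ] H) ξ) := by
      rw [hc]
      intro h
      exact inverseSub_apply _ _ _ _ _
    refine (h2 _).trans ?_
    refine Eq.trans ?_ (congrArg b (inverseSub_apply _ hr β ξ ⟨ξ, rfl⟩)).symm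
    rw [map_sub, map_smul]
  · rw [opLE_iff]
    rintro _ - ⟨ξ, rfl⟩
    change (inner ℂ (0 : H) _ : ℂ).re ≤ (inner ℂ (inverseSub (r : H →L[ℂ] H) hr β
      ⟨(r : H →L[ℂ] H) ξ, mem_inverseSub_domain _ hr β ξ⟩) ((r : H →L[ℂ] H) ξ) : ℂ).re
    rw [inner_zero_left, Complex.zero_re, inverseSub_apply, inner_sub_left, inner_smul_left,
      Complex.conj_ofReal, Complex.sub_re, Complex.re_ofReal_mul, re_inner_self]
    have := norm_sq_le_form h0 h1 ξ
    nlinarith [sq_nonneg ‖(r : H →L[ℂ] H) ξ‖]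

theorem opLE_inverseSub_iff {a r : H →L[ℂ] H} (hr : Function.Injective r) {β : ℝ} :
    OpLE (ofBounded a) (inverseSub r hr β) ↔ ∀ ξ : H,
      (inner ℂ (a (r ξ)) (r ξ) : ℂ).re ≤ (inner ℂ ξ (r ξ) : ℂ).re - β * ‖r ξ‖ ^ 2 := by
  have key : ∀ ξ : H, (inner ℂ (inverseSub r hr β ⟨r ξ, mem_inverseSub_domain r hr β ξ⟩) (r ξ) :
      ℂ).re = (inner ℂ ξ (r ξ) : ℂ).re - β * ‖r ξ‖ ^ 2 := fun ξ => by
    rw [inverseSub_apply, inner_sub_left, inner_smul_left, Complex.conj_ofReal, Complex.sub_re,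
      Complex.re_ofReal_mul, re_inner_self]
  rw [opLE_ofBounded_iff]
  constructor
  · intro h ξ
    rw [← key]
    exact h ⟨r ξ, mem_inverseSub_domain r hr β ξ⟩
  · rintro h ⟨_, ξ, rfl⟩
    exact (h ξ).trans_eq (key ξ).symm

/-- Since r⁻¹ + r ≥ 2, the nonzero positive element 1 - r lies below r⁻¹ - 1 ≤ r⁻¹ - β. Positivity
of the trace is needed to normalise. -/
theorem trace_inverseSub_pos (hτ : IsFaithfulNormalTracialState M τ) {r : M.toStarSubalgebra}
    (h0 : (0 : H →L[ℂ] H) ≤ r) (h1 : (r : H →L[ℂ] H) ≤ 1)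
    (hr : Function.Injective (r : H →L[ℂ] H)) (hne : r ≠ 1) {β : ℝ} (hβ : β ≤ 1) :
    0 < trace M τ (inverseSub (r : H →L[ℂ] H) hr β) := by
  have hsa : IsSelfAdjoint (r : H →L[ℂ] H) := IsSelfAdjoint.of_nonneg h0
  have hp : (0 : H →L[ℂ] H) ≤ (1 - r : M.toStarSubalgebra) := sub_nonneg.2 h1
  have hpos := hτ.re_pos hp (sub_ne_zero.2 hne.symm)
  refine (ENNReal.ofReal_pos.2 hpos).trans_le ?_
  refine le_iSup₂_of_le (1 - r) hp (le_iSup_of_le ?_ le_rfl)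
  rw [opLE_inverseSub_iff]
  intro ξ
  have e1 := form_nonneg h0 (ξ - (r : H →L[ℂ] H) ξ)
  have e2 : (inner ℂ (((1 - r : M.toStarSubalgebra) : H →L[ℂ] H) ((r : H →L[ℂ] H) ξ))
      ((r : H →L[ℂ] H) ξ) : ℂ).re = ‖(r : H →L[ℂ] H) ξ‖ ^ 2
        - (inner ℂ ((r : H →L[ℂ] H) ((r : H →L[ℂ] H) ξ)) ((r : H →L[ℂ] H) ξ) : ℂ).re := by
    rw [← re_inner_self, ← Complex.sub_re, ← inner_sub_left]
    rfl
  rw [e2]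
  rw [map_sub, inner_sub_left, inner_sub_right, inner_sub_right, Complex.sub_re, Complex.sub_re,
    Complex.sub_re, re_inner_self, inner_left_of_isSelfAdjoint hsa ξ ξ,
    inner_left_of_isSelfAdjoint hsa ((r : H →L[ℂ] H) ξ) ξ, re_inner_self] at e1
  nlinarith [sq_nonneg ‖(r : H →L[ℂ] H) ξ‖]

end InverseOperators

end Inverses

/-! ### Finite trace of r⁻² and the diameters of the unbounded pieces. -/

section UnboundedDiameter

variable {M : VonNeumannAlgebra H} {τ : M.toStarSubalgebra →ₗ[ℂ] ℂ}

section TraceBound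

variable {q : ℕ → M.toStarSubalgebra} {r : M.toStarSubalgebra}

theorem apply_sq_eigenvector {r : H →L[ℂ] H} {s : ℝ} {ξ : H} (h : r ξ = (s : ℂ) • ξ) :
    r (r ξ) = ((s * s : ℝ) : ℂ) • ξ := by
  rw [h, map_smul, h, smul_smul, Complex.ofReal_mul]

/-- Inverses of `r ^ 2` on the complements of the projections `q N`, with bounded traces. -/
theorem exists_partial_inverse (hτ : IsFaithfulNormalTracialState M τ) (hanti : Antitone q)
    (hq : ∀ n, IsStarProjection (q n : H →L[ℂ] H)) (hqτ : ∀ n, (τ (q n)).re ≤ (1 / 16) ^ n)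
    (hr0 : ∀ ξ : H, (q 0 : H →L[ℂ] H) ξ = 0 → (r : H →L[ℂ] H) ξ = ξ)
    (hrk : ∀ (k : ℕ) (ξ : H), (q k : H →L[ℂ] H) ξ = ξ → (q (k + 1) : H →L[ℂ] H) ξ = 0 →
      (r : H →L[ℂ] H) ξ = (((1 / 2) ^ (k + 1) : ℝ) : ℂ) • ξ) (N : ℕ) :
    ∃ s : M.toStarSubalgebra, IsSelfAdjoint (s : H →L[ℂ] H) ∧
      (∀ ξ : H, (r : H →L[ℂ] H) ((r : H →L[ℂ] H) ((s : H →L[ℂ] H) ξ))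
        = ξ - (q N : H →L[ℂ] H) ξ) ∧
      (∀ ξ : H, (s : H →L[ℂ] H) ((q N : H →L[ℂ] H) ξ) = 0) ∧
      (τ s).re ≤ 7 - 6 * (1 / 4) ^ N := by
  have hidem : ∀ n (ξ : H), (q n : H →L[ℂ] H) ((q n : H →L[ℂ] H) ξ) = (q n : H →L[ℂ] H) ξ :=
    fun n ξ => DFunLike.congr_fun (hq n).isIdempotentElem.eq ξ
  induction N with
  | zero =>
    refine ⟨1 - q 0, (hq 0).one_sub.isSelfAdjoint, fun ξ => ?_, fun ξ => ?_, ?_⟩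
    · have h : (q 0 : H →L[ℂ] H) (ξ - (q 0 : H →L[ℂ] H) ξ) = 0 := by
        rw [map_sub, hidem, sub_self]
      change (r : H →L[ℂ] H) ((r : H →L[ℂ] H) (ξ - (q 0 : H →L[ℂ] H) ξ)) = _
      rw [hr0 _ h, hr0 _ h]
    · change (q 0 : H →L[ℂ] H) ξ - (q 0 : H →L[ℂ] H) ((q 0 : H →L[ℂ] H) ξ) = 0
      rw [hidem, sub_self]
    · rw [map_sub, Complex.sub_re, hτ.re_one]
      have := hτ.re_nonneg (projection_nonneg (hq 0))
      norm_num
      exact this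
  | succ N ih =>
    obtain ⟨s, hsa, hs1, hs2, hs3⟩ := ih
    have hle : (q (N + 1) : H →L[ℂ] H) ≤ q N := hanti (Nat.le_succ N)
    have h1 := mul_eq_of_projection_le (hq N) (hq (N + 1)) hle
    have h2 : (q N : H →L[ℂ] H) * q (N + 1) = q (N + 1) := by
      have := congrArg star h1
      rwa [star_mul, (hq N).isSelfAdjoint.star_eq, (hq (N + 1)).isSelfAdjoint.star_eq] at this
    have h1' : ∀ ξ : H, (q (N + 1) : H →L[ℂ] H) ((q N : H →L[ℂ] H) ξ)
        = (q (N + 1) : H →L[ℂ] H) ξ := fun ξ => DFunLike.congr_fun h1 ξ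
    have h2' : ∀ ξ : H, (q N : H →L[ℂ] H) ((q (N + 1) : H →L[ℂ] H) ξ)
        = (q (N + 1) : H →L[ℂ] H) ξ := fun ξ => DFunLike.congr_fun h2 ξ
    have hp := projection_sub (hq N) (hq (N + 1)) hle
    have happ : ∀ ξ : H, ((s + (((4 : ℝ) ^ (N + 1) : ℝ) : ℂ) • (q N - q (N + 1)) :
        M.toStarSubalgebra) : H →L[ℂ] H) ξ = (s : H →L[ℂ] H) ξ + (((4 : ℝ) ^ (N + 1) : ℝ) : ℂ) •
          ((q N : H →L[ℂ] H) ξ - (q (N + 1) : H →L[ℂ] H) ξ) := fun ξ => rfl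
    -- On the range of q N - q (N + 1) the operator r² is 4⁻⁽ᴺ⁺¹⁾, so its inverse there is 4ᴺ⁺¹.
    refine ⟨s + (((4 : ℝ) ^ (N + 1) : ℝ) : ℂ) • (q N - q (N + 1)), ?_, fun ξ => ?_, fun ξ => ?_, ?_⟩
    · exact hsa.add (isSelfAdjoint_ofReal_smul _ hp.isSelfAdjoint)
    · have h3 := apply_sq_eigenvector (hrk N ((q N : H →L[ℂ] H) ξ - (q (N + 1) : H →L[ℂ] H) ξ)
        (by rw [map_sub, hidem, h2']) (by rw [map_sub, hidem, h1', sub_self]))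
      rw [happ, map_add, map_add, hs1, map_smul, map_smul, h3, smul_smul, ← Complex.ofReal_mul]
      have h4 : (4 : ℝ) ^ (N + 1) * ((1 / 2) ^ (N + 1) * (1 / 2) ^ (N + 1)) = 1 := by
        rw [← mul_pow, ← mul_pow]; norm_num
      rw [h4, Complex.ofReal_one, one_smul]
      abel
    · rw [happ, hidem, h2', sub_self, smul_zero, add_zero, ← h2', hs2]
    -- The trace grows by at most 4ᴺ⁺¹ · 16⁻ᴺ = 4 · 4⁻ᴺ, while the bound 7 - 6 · 4⁻ᴺ grows by (9/2)
    -- · 4⁻ᴺ, starting from 1.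
    · have h5 := hqτ N
      have h6 := hτ.re_nonneg (projection_nonneg (hq (N + 1)))
      rw [map_add, map_smul, map_sub, Complex.add_re, smul_eq_mul, Complex.re_ofReal_mul,
        Complex.sub_re]
      have h7 : (4 : ℝ) ^ (N + 1) * ((τ (q N)).re - (τ (q (N + 1))).re)
          ≤ 4 ^ (N + 1) * (1 / 16) ^ N := by
        gcongr
        linarith
      have h8 : (4 : ℝ) ^ (N + 1) * (1 / 16) ^ N = 4 * (1 / 4) ^ N := by
        rw [pow_succ, mul_right_comm, ← mul_pow, mul_comm]; norm_num
      have h9 : (0 : ℝ) < (1 / 4) ^ N := by positivity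
      rw [pow_succ (1 / 4 : ℝ)]
      linarith

theorem form_compress {e : H →L[ℂ] H} (he : IsSelfAdjoint e) (a : H →L[ℂ] H) (ξ : H) :
    (inner ℂ ((e * a * e) ξ) ξ : ℂ).re = (inner ℂ (a (e ξ)) (e ξ) : ℂ).re :=
  congrArg Complex.re (inner_left_of_isSelfAdjoint he (a (e ξ)) ξ)

/-- The hypothesis h says a ≤ r⁻² on the range of r². By traciality τ(a) is the sum of the traces of
the two diagonal compressions by q N and its complement. The complement part is dominated by the
partial inverse, and the other part is at most ‖a‖ · 16⁻ᴺ. -/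
theorem re_le_of_form_le (hτ : IsFaithfulNormalTracialState M τ) (hanti : Antitone q)
    (hq : ∀ n, IsStarProjection (q n : H →L[ℂ] H)) (hqτ : ∀ n, (τ (q n)).re ≤ (1 / 16) ^ n)
    (hr : IsSelfAdjoint (r : H →L[ℂ] H))
    (hr0 : ∀ ξ : H, (q 0 : H →L[ℂ] H) ξ = 0 → (r : H →L[ℂ] H) ξ = ξ)
    (hrk : ∀ (k : ℕ) (ξ : H), (q k : H →L[ℂ] H) ξ = ξ → (q (k + 1) : H →L[ℂ] H) ξ = 0 →
      (r : H →L[ℂ] H) ξ = (((1 / 2) ^ (k + 1) : ℝ) : ℂ) • ξ)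
    {a : M.toStarSubalgebra} (ha : (0 : H →L[ℂ] H) ≤ a)
    (h : ∀ ξ : H, (inner ℂ ((a : H →L[ℂ] H) ((r : H →L[ℂ] H) ((r : H →L[ℂ] H) ξ)))
      ((r : H →L[ℂ] H) ((r : H →L[ℂ] H) ξ)) : ℂ).re ≤ ‖(r : H →L[ℂ] H) ξ‖ ^ 2) :
    (τ a).re ≤ 7 := by
  have hasa : IsSelfAdjoint (a : H →L[ℂ] H) := IsSelfAdjoint.of_nonneg ha
  have hsplit : ∀ p : M.toStarSubalgebra, IsStarProjection (p : H →L[ℂ] H) →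
      τ (a * p) = τ (p * a * p) := fun p hp => by
    have hpp : p * p = p := Subtype.ext hp.isIdempotentElem.eq
    conv_lhs => rw [← hpp, ← mul_assoc, hτ.tracial, ← mul_assoc]
  have hsaC : ∀ p : M.toStarSubalgebra, IsStarProjection (p : H →L[ℂ] H) →
      IsSelfAdjoint ((p * a * p : M.toStarSubalgebra) : H →L[ℂ] H) := fun p hp => by
    have := hasa.conjugate (p : H →L[ℂ] H)
    rwa [hp.isSelfAdjoint.star_eq] at this
  have hbound : ∀ N, (τ a).re ≤ 7 + ‖(a : H →L[ℂ] H)‖ * (1 / 16) ^ N := by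
    intro N
    obtain ⟨s, hsa, hs1, hs2, hs3⟩ := exists_partial_inverse hτ hanti hq hqτ hr0 hrk N
    have he : IsStarProjection ((1 - q N : M.toStarSubalgebra) : H →L[ℂ] H) := (hq N).one_sub
    have h1 : (1 - q N) * a * (1 - q N) ≤ s := by
      refine le_of_form (hsaC _ he) hsa fun ξ => ?_
      refine (form_compress he.isSelfAdjoint (a : H →L[ℂ] H) ξ).trans_le ?_
      -- Taking sξ as the vector makes r²sξ = (1 - q N)ξ and ‖rsξ‖² = ⟨sξ, ξ⟩.
      have h2 := h ((s : H →L[ℂ] H) ξ)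
      have h3 : ‖(r : H →L[ℂ] H) ((s : H →L[ℂ] H) ξ)‖ ^ 2
          = (inner ℂ ((s : H →L[ℂ] H) ξ) ξ : ℂ).re := by
        rw [← re_inner_self, ← inner_left_of_isSelfAdjoint hr, hs1, inner_sub_left,
          ← inner_left_of_isSelfAdjoint hsa, ← inner_left_of_isSelfAdjoint hsa, hs2,
          inner_zero_left, sub_zero]
      rw [h3, hs1] at h2
      exact h2
    have h2 : q N * a * q N ≤ ((‖(a : H →L[ℂ] H)‖ : ℝ) : ℂ) • q N := by
      refine le_of_form (hsaC _ (hq N))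
        (isSelfAdjoint_ofReal_smul ‖(a : H →L[ℂ] H)‖ (hq N).isSelfAdjoint) fun ξ => ?_
      refine (form_compress (hq N).isSelfAdjoint (a : H →L[ℂ] H) ξ).trans_le ?_
      refine (form_le_norm _ _).trans_eq ?_
      rw [← form_projection (hq N)]
      exact (form_ofReal_smul _ _ _).symm
    have h3 := hτ.re_mono h1
    have h4 := hτ.re_mono h2
    rw [← hsplit _ he] at h3
    rw [← hsplit _ (hq N), map_smul, smul_eq_mul, Complex.re_ofReal_mul] at h4
    have h5 : τ a = τ (a * (1 - q N)) + τ (a * q N) := by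
      rw [← map_add, ← mul_add, sub_add_cancel, mul_one]
    have h6 := mul_le_mul_of_nonneg_left (hqτ N) (norm_nonneg (a : H →L[ℂ] H))
    have h7 : (0 : ℝ) < (1 / 4) ^ N := by positivity
    rw [h5, Complex.add_re]
    linarith
  have hlim := ((tendsto_pow_atTop_nhds_zero_of_lt_one (r := (1 / 16 : ℝ)) (by norm_num)
    (by norm_num)).const_mul ‖(a : H →L[ℂ] H)‖).const_add 7
  rw [mul_zero, add_zero] at hlim
  exact ge_of_tendsto' hlim hbound

end TraceBound

section UnboundedStates

theorem smul_inverseSub_not_mem_algebraSet {r : H →L[ℂ] H} (hr : Function.Injective r) {β c : ℝ}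
    (hc : 0 < c) (hmem : (c : ℂ) • inverseSub r hr β ∈ posAffiliated M)
    (heig : ∀ ε : ℝ, 0 < ε → ∃ s : ℝ, 0 < s ∧ s < ε ∧ ∃ ξ : H, ξ ≠ 0 ∧ r ξ = (s : ℂ) • ξ) :
    (c : ℂ) • inverseSub r hr β ∉ algebraSet M := by
  rw [← isBoundedOp_iff_mem_algebraSet hmem]
  rintro ⟨C, hC⟩
  have hB : 0 < |C| / c + |β| + 1 := by positivity
  obtain ⟨s, hs, hsε, ξ, hξ, h⟩ := heig _ (inv_pos.2 hB)
  obtain ⟨hdom, hval⟩ := inverseSub_eigenvector hr β hs.ne' h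
  have h1 := hC ⟨ξ, hdom⟩
  rw [LinearPMap.smul_apply, hval, smul_smul, norm_smul, ← Complex.ofReal_mul,
    Complex.norm_real] at h1
  have h2 := le_of_mul_le_mul_right h1 (norm_pos_iff.2 hξ)
  have h3 := (le_abs_self _).trans (h2.trans (le_abs_self C))
  have h4 : |C| / c + |β| + 1 < s⁻¹ := (lt_inv_comm₀ hB hs).2 hsε
  have h5 : c * (s⁻¹ - β) ≤ |C| := h3
  rw [mul_comm, ← le_div_iff₀ hc] at h5
  linarith [le_abs_self β]

/-- For small eigenvalues of `r` the operator `r⁻² - β` is not dominated by `r⁻¹ - β`. -/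
theorem m_smul_inverseSub_eq_zero {r r' : H →L[ℂ] H} (hr : Function.Injective r)
    (hr' : Function.Injective r') (hrr' : ∀ ξ, r' ξ = r (r ξ)) {β c c' : ℝ} (hβ0 : 0 ≤ β)
    (hβ : β ≤ 1) (hc : 0 < c) (hc' : 0 < c') (hpos : OpLE 0 ((c : ℂ) • inverseSub r hr β))
    (heig : ∀ ε : ℝ, 0 < ε → ∃ s : ℝ, 0 < s ∧ s < ε ∧ ∃ ξ : H, ξ ≠ 0 ∧ r ξ = (s : ℂ) • ξ) :
    m ((c : ℂ) • inverseSub r hr β) ((c' : ℂ) • inverseSub r' hr' β) = 0 := by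
  refine m_eq_zero_of_forall hpos fun t ht hle => ?_
  -- The bound s < 1/2 gives βs² ≤ 1/4. Domination multiplied by s² then yields (3/4)tc' ≤ cs,
  -- against cs < tc'/2.
  obtain ⟨s, hs, hsε, ξ, hξ, h⟩ := heig (min (1 / 2) (t * c' / (2 * c))) (by positivity)
  have hs2 : s < 1 / 2 := hsε.trans_le (min_le_left _ _)
  have hsc := hsε.trans_le (min_le_right _ _)
  rw [lt_div_iff₀ (by positivity)] at hsc
  obtain ⟨hd, hv⟩ := inverseSub_eigenvector hr β hs.ne' h
  obtain ⟨hd', hv'⟩ := inverseSub_eigenvector hr' β (mul_pos hs hs).ne'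
    ((hrr' ξ).trans (apply_sq_eigenvector h))
  have h1 := opLE_smul_iff.1 hle ξ hd hd'
  have hξ2 : 0 < ‖ξ‖ ^ 2 := by positivity
  rw [smul_form c ξ hd hd, smul_form c' ξ hd' hd', hv, hv', inner_smul_left, inner_smul_left,
    Complex.conj_ofReal, Complex.conj_ofReal, Complex.re_ofReal_mul, Complex.re_ofReal_mul,
    re_inner_self, ← mul_assoc, ← mul_assoc, ← mul_assoc] at h1
  have h2 := le_of_mul_le_mul_right h1 hξ2
  have h3 := mul_le_mul_of_nonneg_right h2 (mul_pos hs hs).le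
  have e1 : t * c' * ((s * s)⁻¹ - β) * (s * s) = t * c' * (1 - β * (s * s)) := by
    field_simp
  have e2 : c * (s⁻¹ - β) * (s * s) = c * (s - β * (s * s)) := by
    field_simp
  rw [e1, e2] at h3
  have htc : 0 < t * c' := mul_pos ht hc'
  have h4 : β * (s * s) ≤ 1 / 4 := by nlinarith
  have h5 : t * c' * (3 / 4) ≤ t * c' * (1 - β * (s * s)) := by
    gcongr
    linarith
  have h6 : c * (s - β * (s * s)) ≤ c * s := by
    gcongr
    have : 0 ≤ β * (s * s) := by positivity
    linarith
  linarith

/-- A class of states that contains the normalisations of the unbounded operators `r⁻¹ - β`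
has diameter one, and the diameter is attained. -/
theorem isGreatest_distances_of_inverseSub (hτ : IsFaithfulNormalTracialState M τ)
    (hM : ¬ FiniteDimensional ℂ M.toStarSubalgebra) {β : ℝ} (hβ0 : 0 ≤ β) (hβ : β ≤ 1)
    {A : Set (H →ₗ.[ℂ] H)} (hA : A ⊆ S M τ)
    (h : ∀ (r : H →L[ℂ] H) (hr : Function.Injective r) (c : ℝ), 0 < c → (∀ ξ, ‖r ξ‖ ≤ ‖ξ‖) →
      (∃ ξ : H, ξ ≠ 0 ∧ r ξ = ξ) → (c : ℂ) • inverseSub r hr β ∈ S M τ →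
      (c : ℂ) • inverseSub r hr β ∉ algebraSet M → (c : ℂ) • inverseSub r hr β ∈ A) :
    IsGreatest (distances A) 1 := by
  obtain ⟨q, hanti, hq, hq0, hqlim, hqτ⟩ := exists_rapid_projections hτ hM
  obtain ⟨r₀, hcomm, h0, h1, hinj, hr0, hrk⟩ :=
    exists_geometric_contraction (q := fun n => (q n : H →L[ℂ] H))
      (fun m n hmn => hanti.antitone hmn) hq hqlim
  obtain ⟨r, rfl⟩ : ∃ r : M.toStarSubalgebra, (r : H →L[ℂ] H) = r₀ :=
    ⟨⟨r₀, mem_of_commute fun b hb => hcomm b fun n =>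
      VonNeumannAlgebra.mem_commutant_iff.1 hb _ (q n).2⟩, rfl⟩
  have hsa : IsSelfAdjoint (r : H →L[ℂ] H) := IsSelfAdjoint.of_nonneg h0
  have hform1 : ∀ ξ : H, (inner ℂ ξ ((r : H →L[ℂ] H) ξ) : ℂ).re ≤ ‖ξ‖ ^ 2 := fun ξ => by
    have := form_mono h1 ξ
    rwa [one_apply_eq_self, re_inner_self, inner_left_of_isSelfAdjoint hsa] at this
  have hcontr2 : ∀ ξ : H, ‖(r : H →L[ℂ] H) ξ‖ ^ 2 ≤ ‖ξ‖ ^ 2 := fun ξ =>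
    (norm_sq_le_form h0 h1 ξ).trans (hform1 ξ)
  have hcontr : ∀ ξ : H, ‖(r : H →L[ℂ] H) ξ‖ ≤ ‖ξ‖ := fun ξ =>
    (pow_le_pow_iff_left₀ (norm_nonneg _) (norm_nonneg _) two_ne_zero).1 (hcontr2 ξ)
  have hrr : ∀ ξ : H, ((r * r : M.toStarSubalgebra) : H →L[ℂ] H) ξ
      = (r : H →L[ℂ] H) ((r : H →L[ℂ] H) ξ) := fun ξ => rfl
  have hsa2 : IsSelfAdjoint ((r * r : M.toStarSubalgebra) : H →L[ℂ] H) := by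
    have := IsSelfAdjoint.star_mul_self (r : H →L[ℂ] H)
    rwa [hsa.star_eq] at this
  have hform2 : ∀ ξ : H, (inner ℂ (((r * r : M.toStarSubalgebra) : H →L[ℂ] H) ξ) ξ : ℂ).re
      = ‖(r : H →L[ℂ] H) ξ‖ ^ 2 := fun ξ => by
    rw [hrr, inner_left_of_isSelfAdjoint hsa, re_inner_self]
  have h20 : (0 : H →L[ℂ] H) ≤ (r * r : M.toStarSubalgebra) :=
    nonneg_of_form hsa2 fun ξ => by rw [hform2]; positivity
  have h21 : ((r * r : M.toStarSubalgebra) : H →L[ℂ] H) ≤ 1 :=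
    le_one_of_form hsa2 fun ξ => by rw [hform2]; exact hcontr2 ξ
  have hinj2 : Function.Injective ((r * r : M.toStarSubalgebra) : H →L[ℂ] H) := hinj.comp hinj
  have heigk : ∀ k : ℕ, ∃ ξ : H, ξ ≠ 0 ∧
      (r : H →L[ℂ] H) ξ = (((1 / 2) ^ (k + 1) : ℝ) : ℂ) • ξ := by
    intro k
    have hle : (q (k + 1) : H →L[ℂ] H) ≤ q k := hanti.antitone (Nat.le_succ k)
    obtain ⟨ξ, hξ, hpξ⟩ := exists_apply_eq_self (projection_sub (hq k) (hq (k + 1)) hle)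
      (sub_ne_zero.2 fun he => (hanti (Nat.lt_succ_self k)).ne (Subtype.ext he.symm))
    have e1 := mul_eq_of_projection_le (hq k) (hq (k + 1)) hle
    have e2 := (hq (k + 1)).isIdempotentElem.eq
    have e3 : (q (k + 1) : H →L[ℂ] H) ξ = 0 := by
      rw [← hpξ, ← mul_apply_eq_comp, mul_sub, e1, e2, sub_self]; rfl
    refine ⟨ξ, hξ, hrk k ξ ?_ e3⟩
    rw [sub_apply, e3, sub_zero] at hpξ
    exact hpξ
  have heig : ∀ ε : ℝ, 0 < ε → ∃ s : ℝ, 0 < s ∧ s < ε ∧ ∃ ξ : H, ξ ≠ 0 ∧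
      (r : H →L[ℂ] H) ξ = (s : ℂ) • ξ := by
    intro ε hε
    obtain ⟨k, hk⟩ := exists_pow_lt_of_lt_one hε (show (1 / 2 : ℝ) < 1 by norm_num)
    refine ⟨(1 / 2) ^ (k + 1), by positivity, lt_of_le_of_lt ?_ hk, heigk k⟩
    exact pow_le_pow_of_le_one (by norm_num) (by norm_num) (Nat.le_succ k)
  have heig2 : ∀ ε : ℝ, 0 < ε → ∃ s : ℝ, 0 < s ∧ s < ε ∧ ∃ ξ : H, ξ ≠ 0 ∧
      ((r * r : M.toStarSubalgebra) : H →L[ℂ] H) ξ = (s : ℂ) • ξ := by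
    intro ε hε
    obtain ⟨s, hs, hsε, ξ, hξ, hsξ⟩ := heig (min 1 ε) (by positivity)
    refine ⟨s * s, mul_pos hs hs, ?_, ξ, hξ, (hrr ξ).trans (apply_sq_eigenvector hsξ)⟩
    nlinarith [hsε.trans_le (min_le_left _ _), hsε.trans_le (min_le_right _ _)]
  obtain ⟨ζ, hζ, hζq⟩ := exists_apply_eq_self (hq 0).one_sub
    (sub_ne_zero.2 fun he => hq0 (Subtype.ext he.symm))
  have hζr : (r : H →L[ℂ] H) ζ = ζ := hr0 ζ (by
    have : ζ - (q 0 : H →L[ℂ] H) ζ = ζ := hζq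
    exact sub_eq_self.1 this)
  have hne_one : ∀ b : M.toStarSubalgebra, (∀ ε : ℝ, 0 < ε → ∃ s : ℝ, 0 < s ∧ s < ε ∧
      ∃ ξ : H, ξ ≠ 0 ∧ (b : H →L[ℂ] H) ξ = (s : ℂ) • ξ) → b ≠ 1 := by
    rintro b hb rfl
    obtain ⟨s, -, hs1, ξ, hξ, hsξ⟩ := hb 1 one_pos
    have h3 : (1 : ℂ) • ξ = (s : ℂ) • ξ := (one_smul ℂ ξ).trans hsξ
    have h4 := smul_left_injective ℂ hξ h3
    rw [← Complex.ofReal_one, Complex.ofReal_inj] at h4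
    exact hs1.ne h4.symm
  have htrace : ∀ (b : H →L[ℂ] H) (hb : Function.Injective b),
      (∀ a : M.toStarSubalgebra, (0 : H →L[ℂ] H) ≤ a →
        OpLE (ofBounded (a : H →L[ℂ] H)) (inverseSub b hb β) → (τ a).re ≤ 7) →
      trace M τ (inverseSub b hb β) < ⊤ := fun b hb hab =>
    lt_of_le_of_lt (iSup₂_le fun a ha => iSup_le fun hax => ENNReal.ofReal_le_ofReal (hab a ha hax))
      ENNReal.ofReal_lt_top
  -- Both r⁻¹ - β and r⁻² - β lie below r⁻², because r ≤ 1 and β ≥ 0; one trace bound serves both.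
  have hseven := fun (a : M.toStarSubalgebra) (ha : (0 : H →L[ℂ] H) ≤ a) =>
    re_le_of_form_le hτ hanti.antitone hq hqτ hsa hr0 hrk ha
  obtain ⟨c, hc, hcS⟩ := exists_smul_mem_S (inverseSub_mem_posAffiliated h0 h1 hinj hβ)
    (trace_inverseSub_pos hτ h0 h1 hinj (hne_one r heig) hβ)
    (htrace _ hinj fun a ha hax => hseven a ha fun ξ => by
      have h3 := (opLE_inverseSub_iff hinj).1 hax ((r : H →L[ℂ] H) ξ)
      have h4 := hform1 ((r : H →L[ℂ] H) ξ)
      have h5 : 0 ≤ β * ‖(r : H →L[ℂ] H) ((r : H →L[ℂ] H) ξ)‖ ^ 2 := by positivity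
      linarith)
  obtain ⟨c', hc', hcS'⟩ := exists_smul_mem_S (inverseSub_mem_posAffiliated h20 h21 hinj2 hβ)
    (trace_inverseSub_pos hτ h20 h21 hinj2 (hne_one _ heig2) hβ)
    (htrace _ hinj2 fun a ha hax => hseven a ha fun ξ => by
      have h3 := (opLE_inverseSub_iff hinj2).1 hax ξ
      rw [← inner_left_of_isSelfAdjoint hsa2 ξ ξ, hform2] at h3
      have h5 : 0 ≤ β * ‖((r * r : M.toStarSubalgebra) : H →L[ℂ] H) ξ‖ ^ 2 := by positivity
      rw [hrr] at h3
      rw [hrr] at h5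
      linarith)
  refine isGreatest_distances hA
    (h _ hinj c hc hcontr ⟨ζ, hζ, hζr⟩ hcS
      (smul_inverseSub_not_mem_algebraSet hinj hc hcS.1.1 heig))
    (h _ hinj2 c' hc' (fun ξ => (hcontr _).trans (hcontr ξ)) ⟨ζ, hζ, ?_⟩ hcS'
      (smul_inverseSub_not_mem_algebraSet hinj2 hc' hcS'.1.1 heig2))
    (m_smul_inverseSub_eq_zero hinj hinj2 hrr hβ0 hβ hc hc' hcS.1.1.2.2 heig)
  rw [hrr, hζr, hζr]

/-- With β = 0 the operator cr⁻¹ is bounded below by c, because r is a contraction. -/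
theorem isGreatest_distances_SuInv (hτ : IsFaithfulNormalTracialState M τ)
    (hM : ¬ FiniteDimensional ℂ M.toStarSubalgebra) : IsGreatest (distances (SuInv M τ)) 1 := by
  refine isGreatest_distances_of_inverseSub hτ hM le_rfl zero_le_one (fun x hx => hx.1.1)
    fun r hr c hc hcontr _ hS hnot => ⟨⟨hS, ?_⟩, hnot⟩
  refine isBoundedlyInvertible_of_norm_le hS.1.1.1 hc ?_
  rintro ⟨_, ξ, rfl⟩
  have e : ((c : ℂ) • inverseSub r hr 0) ⟨r ξ, mem_inverseSub_domain r hr 0 ξ⟩ = (c : ℂ) • ξ := by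
    rw [LinearPMap.smul_apply, inverseSub_apply, Complex.ofReal_zero, zero_smul, sub_zero]
  change c * ‖r ξ‖ ≤ ‖((c : ℂ) • inverseSub r hr 0) ⟨r ξ, mem_inverseSub_domain r hr 0 ξ⟩‖
  rw [e, norm_smul, Complex.norm_real, Real.norm_of_nonneg hc.le]
  exact mul_le_mul_of_nonneg_left (hcontr ξ) hc.le

/-- With β = 1 a fixed vector of r is annihilated by r⁻¹ - 1, which excludes a bounded inverse. -/
theorem isGreatest_distances_SuSing (hτ : IsFaithfulNormalTracialState M τ)
    (hM : ¬ FiniteDimensional ℂ M.toStarSubalgebra) : IsGreatest (distances (SuSing M τ)) 1 := by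
  refine isGreatest_distances_of_inverseSub hτ hM zero_le_one le_rfl (fun x hx => hx.1.1)
    fun r hr c hc _ hex hS hnot => ⟨⟨hS, fun hinv => ?_⟩, hnot⟩
  obtain ⟨ξ, hξ, hrξ⟩ := hex
  obtain ⟨hd, hv⟩ := inverseSub_eigenvector hr 1 one_ne_zero
    (show r ξ = ((1 : ℝ) : ℂ) • ξ by rw [hrξ, Complex.ofReal_one, one_smul])
  refine not_isBoundedlyInvertible_of_apply_eq_zero (x := (c : ℂ) • inverseSub r hr 1) ⟨ξ, hd⟩
    hξ ?_ hinv.2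
  rw [LinearPMap.smul_apply, hv, inv_one, sub_self, Complex.ofReal_zero, zero_smul, smul_zero]

end UnboundedStates

end UnboundedDiameter

end HennionGeometry

end

open HennionGeometry in
theorem mainTheorem6 {H : Type*} [NormedAddCommGroup H] [InnerProductSpace ℂ H] [CompleteSpace H]
    (M : VonNeumannAlgebra H) (τ : M.toStarSubalgebra →ₗ[ℂ] ℂ)
    (hτ : IsFaithfulNormalTracialState M τ) :
    -- (1) bounded / boundedly invertible simultaneously, and the resulting partition of `S`
    ((∀ x ∈ S M τ, ∀ y ∈ S M τ, d x y < 1 →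
        (IsBoundedOp x ↔ IsBoundedOp y) ∧
        (IsBoundedlyInvertible x ↔ IsBoundedlyInvertible y)) ∧
      (⋃ i, piece M τ i) = S M τ ∧
      (∀ i, @IsClopen _ (hennionTopology M τ) ((↑) ⁻¹' piece M τ i : Set (S M τ))) ∧
      (∀ i j, i ≠ j → Disjoint (piece M τ i) (piece M τ j) ∧
        ∀ x ∈ piece M τ i, ∀ y ∈ piece M τ j, d x y = 1)) ∧
    -- (2)
    (∀ x ∈ SbInv M τ, ∀ y ∈ SbInv M τ, d x y < 1) ∧
    -- (3)
    (M.toStarSubalgebra ≠ ⊥ →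
      IsLUB (distances (SbInv M τ)) 1 ∧ IsGreatest (distances (SbSing M τ)) 1) ∧
    -- (4)
    (¬ FiniteDimensional ℂ M.toStarSubalgebra →
      IsGreatest (distances (SuInv M τ)) 1 ∧ IsGreatest (distances (SuSing M τ)) 1) ∧
    -- (5)
    (¬ FiniteDimensional ℂ M.toStarSubalgebra → ¬ DTotallyBounded M τ (SbInv M τ)) := by
  refine ⟨⟨fun x hx y hy h => ?_, iUnion_piece, isClopen_piece hτ, fun i j hij =>
    ⟨disjoint_piece hij, fun x hx y hy => d_eq_one_of_mem_piece hτ hij hx hy⟩⟩,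
    fun x hx y hy => d_lt_one_of_mem_SbInv hτ hx hy,
    fun hM => ⟨isLUB_distances_SbInv hτ hM, isGreatest_distances_SbSing hτ hM⟩,
    fun hM => ⟨isGreatest_distances_SuInv hτ hM, isGreatest_distances_SuSing hτ hM⟩,
    fun hM => not_dTotallyBounded_SbInv hτ hM⟩
  have h' : d y x < 1 := by rwa [d_comm]
  exact ⟨⟨isBoundedOp_of_d_lt_one hx.1.1 hy.1.1 h, isBoundedOp_of_d_lt_one hy.1.1 hx.1.1 h'⟩,
    isBoundedlyInvertible_of_d_lt_one hτ hx.1.1 hy.1.1 h,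
    isBoundedlyInvertible_of_d_lt_one hτ hy.1.1 hx.1.1 h'⟩
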